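/- Let $G$ be a finite subgroup of the orthogonal group of $\mathbb{R}^n$ generated by reflections, and let $F\subset\mathbb{R}^n$ be a fundamental region of $G$: $F$ is open and convex, $F\cap gF=\varnothing$ for $I\neq g\in G$, and $\mathbb{R}^n=\bigcup_{g\in G}g\overline F$. Let $W:\mathbb{R}^n\to\mathbb{R}$ be of class $C^2$ and assume the following. 1. There are distinct points $a_1,\dots,a_N$ with $W(a_i)=0$ for all $i$ and $W>0$ on $\mathbb{R}^n\setminus\{a_1,\dots,a_N\}$, and constants $c,\bar q>0$ such that $v^\top\partial^2W(u)v\ge 2c^2|v|^2$ for all $v\in\mathbb{R}^n$ and all $u$ with $|u-a_i|\le\bar q$ for some $i$. 2. $W(gu)=W(u)$ for all $g\in G$, $u\in\mathbb{R}^n$, and there is $M>0$ such that $W(su)\ge W(u)$ for $s\ge1$ and $|u|=M$. 3. $\overline F$ contains exactly one of the minima, say $a_1$. Let $G_{a_1}$ be the stabilizer of $a_1$ in $G$ and let $D=\mathrm{Int}\big(\bigcup_{g\in G_{a_1}}g\overline F\big)$. 4. $Q:\mathbb{R}^n\to\mathbb{R}$ is a continuous convex function with $Q(u+a_1)=|u|+H(u)$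 for all $u$, where $H\in C^2(\mathbb{R}^n;\mathbb{R})$, $H(0)=0$ and $H_u(0)=0$; moreover $Q(gu)=Q(u)$ for $g\in G_{a_1}$, $Q>0$ on $\mathbb{R}^n\setminus\{a_1\}$, and $\langle Q_u(u),W_u(u)\rangle\ge0$ for $u\in D\setminus\{a_1\}$. For $R>0$ let $B_R$ be the open ball of radius $R$ centered at the origin, let $D_R=D\cap B_R$, and let $A^R$ be the set of all $u\in W^{1,2}(B_R;\mathbb{R}^n)$ that are equivariant, $u(gx)=g\,u(x)$ for $g\in G$, and positive, $u(\overline F\cap B_R)\subset\overline F$ (both up to null sets). Let $J_{B_R}(u)=\int_{B_R}\{\tfrac12|\nabla u|^2+W(u)\}\,dx\in[0,\infty]$. Then there are constants $R_0>0$ and $d_0>0$, depending only on the data above and not on $R$, such that the following holds for every $R\ge R_0$. If $u_{4R}\in A^{4R}$ minimizes $J_{B_{4R}}$ over $A^{4R}$, is of class $C^2$ in $B_{4R}$ and satisfies $|u_{4R}|\le M$ on $B_{4R}$, then there is a set $D_R^*\subset D_{4R}$ with $$D_R^*\supset\{x\in D_{4R}\mid d(x,\partial D_{4R})\ge d_0\}\qquad\text{and}\qquad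 \sup_{D_R^*}Q(u_{4R})\le\bar q .$$ -/

import Mathlib

open MeasureTheory Set
open scoped ContDiff RealInnerProductSpace

/-- The Euclidean space `ℝⁿ`. -/
abbrev Eucl (n : ℕ) : Type := EuclideanSpace ℝ (Fin n)

/-- The orthogonal group of `ℝⁿ`. -/
abbrev Orth (n : ℕ) : Type := Eucl n ≃ₗᵢ[ℝ] Eucl n

/-- `γ` is the reflection in the hyperplane orthogonal to some unit vector `η`. -/
def IsHyperplaneReflection {n : ℕ} (γ : Orth n) : Prop :=
  ∃ η : Eucl n, ‖η‖ = 1 ∧ ∀ x : Eucl n, γ x = x - (2 * ⟪x, η⟫) • η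

/-- A Coxeter group: a finite subgroup of the orthogonal group generated by reflections. -/
structure IsFiniteReflectionGroup {n : ℕ} (G : Subgroup (Orth n)) : Prop where
  finite : Finite G
  generated : ∃ S : Set (Orth n),
    (∀ γ ∈ S, IsHyperplaneReflection γ) ∧ Subgroup.closure S = G

/-- `F` is a fundamental region of `G`. -/
structure IsFundamentalRegion {n : ℕ} (G : Subgroup (Orth n)) (F : Set (Eucl n)) : Prop where
  isOpen : IsOpen F
  convex : Convex ℝ F
  disjoint_image : ∀ g ∈ G, g ≠ 1 → F ∩ (g '' F) = ∅
  cover : (⋃ g ∈ G, g '' closure F) = univ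

/-- `W` is a `C²` potential whose zeros are exactly its `N` global minima `a i`, and whose
Hessian is at least `2 c²` on the closed balls of radius `q` around them. -/
structure HasNondegenerateMinima {n N : ℕ} (W : Eucl n → ℝ) (a : Fin N → Eucl n)
    (c q : ℝ) : Prop where
  contDiff : ContDiff ℝ 2 W
  injective : Function.Injective a
  zero_at : ∀ i, W (a i) = 0
  pos_off : ∀ u : Eucl n, u ∉ range a → 0 < W u
  c_pos : 0 < c
  q_pos : 0 < q
  hessian_ge : ∀ i, ∀ u : Eucl n, ‖u - a i‖ ≤ q →
    ∀ v : Eucl n, 2 * c ^ 2 * ‖v‖ ^ 2 ≤ (fderiv ℝ (fderiv ℝ W) u) v v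

/-- `W` is invariant under `G` and, along rays, does not drop below its values on the
sphere of radius `M` outside that sphere. -/
structure IsSymmetricPotential {n : ℕ} (G : Subgroup (Orth n)) (W : Eucl n → ℝ)
    (M : ℝ) : Prop where
  invariant : ∀ g ∈ G, ∀ u : Eucl n, W (g u) = W u
  M_pos : 0 < M
  radial : ∀ s : ℝ, 1 ≤ s → ∀ u : Eucl n, ‖u‖ = M → W u ≤ W (s • u)

/-- The closure of `F` contains exactly one of the minima `a i`, namely `a i₁`. -/
def HasSingleMinimumIn {n N : ℕ} (F : Set (Eucl n)) (a : Fin N → Eucl n) (i₁ : Fin N) : Prop :=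
  a i₁ ∈ closure F ∧ ∀ i, a i ∈ closure F → a i = a i₁

/-- The set `D`: the interior of the union of the images of the closure of `F` under the
stabilizer of `a₁` in `G`. -/
def stabRegion {n : ℕ} (G : Subgroup (Orth n)) (F : Set (Eucl n)) (a₁ : Eucl n) :
    Set (Eucl n) :=
  interior (⋃ g ∈ {g : Orth n | g ∈ G ∧ g a₁ = a₁}, g '' closure F)

/-- `Q`-monotonicity of the potential `W`. -/
structure IsQMonotone {n : ℕ} (G : Subgroup (Orth n)) (F : Set (Eucl n)) (W : Eucl n → ℝ)
    (a₁ : Eucl n) (Q : Eucl n → ℝ) : Prop where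
  continuous : Continuous Q
  shape : ∃ H : Eucl n → ℝ, ContDiff ℝ 2 H ∧ H 0 = 0 ∧ gradient H 0 = 0 ∧
    ∀ u : Eucl n, Q (u + a₁) = ‖u‖ + H u
  convex : ConvexOn ℝ univ Q
  invariant : ∀ g ∈ G, g a₁ = a₁ → ∀ u : Eucl n, Q (g u) = Q u
  pos_off : ∀ u : Eucl n, u ≠ a₁ → 0 < Q u
  monotone : ∀ u ∈ stabRegion G F a₁, u ≠ a₁ → 0 ≤ ⟪gradient Q u, gradient W u⟫

/-- `u` belongs to the Sobolev space `W^{1,2}(B_R; ℝⁿ)` and `Du` is its weak derivative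
(`B_R` is the open ball of radius `R` centred at the origin). -/
structure HasW12Deriv {n : ℕ} (R : ℝ) (u : Eucl n → Eucl n)
    (Du : Eucl n → Eucl n →L[ℝ] Eucl n) : Prop where
  memLp : MemLp u 2 (volume.restrict (Metric.ball 0 R))
  memLp_deriv : MemLp Du 2 (volume.restrict (Metric.ball 0 R))
  weak_deriv : ∀ φ : Eucl n → ℝ, ContDiff ℝ ∞ φ → HasCompactSupport φ →
    tsupport φ ⊆ Metric.ball 0 R → ∀ v : Eucl n,
      ∫ x in Metric.ball 0 R, (fderiv ℝ φ x v) • u x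
        = - ∫ x in Metric.ball 0 R, φ x • Du x v

/-- `u`, with weak derivative `Du`, belongs to the class of positive equivariant Sobolev maps
on `B_R`; as usual for Sobolev maps, pointwise relations are meant almost everywhere. -/
structure IsAdmissible {n : ℕ} (G : Subgroup (Orth n)) (F : Set (Eucl n)) (R : ℝ)
    (u : Eucl n → Eucl n) (Du : Eucl n → Eucl n →L[ℝ] Eucl n) : Prop where
  sobolev : HasW12Deriv R u Du
  equivariant : ∀ g ∈ G, ∀ᵐ x ∂(volume.restrict (Metric.ball 0 R)), u (g x) = g (u x)
  positive : ∀ᵐ x ∂(volume.restrict (closure F ∩ Metric.ball 0 R)), u x ∈ closure F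

/-- The energy `∫_{B_R} ½ |∇u|² + W(u)`, for nonnegative `W`, as an element of `[0, ∞]`;
`|∇u|` is the Euclidean (Frobenius) norm of the matrix of first derivatives. -/
noncomputable def energy {n : ℕ} (W : Eucl n → ℝ) (R : ℝ) (u : Eucl n → Eucl n)
    (Du : Eucl n → Eucl n →L[ℝ] Eucl n) : ENNReal :=
  ∫⁻ x in Metric.ball 0 R,
    ENNReal.ofReal
      (1 / 2 * ∑ i : Fin n, ‖Du x (EuclideanSpace.single i 1)‖ ^ 2 + W (u x))

/-- `u` minimizes the energy on `B_R` among all positive equivariant Sobolev maps. -/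
def IsEnergyMinimizer {n : ℕ} (G : Subgroup (Orth n)) (F : Set (Eucl n)) (W : Eucl n → ℝ)
    (R : ℝ) (u : Eucl n → Eucl n) : Prop :=
  ∃ Du : Eucl n → Eucl n →L[ℝ] Eucl n, IsAdmissible G F R u Du ∧
    ∀ (w : Eucl n → Eucl n) (Dw : Eucl n → Eucl n →L[ℝ] Eucl n),
      IsAdmissible G F R w Dw → energy W R u Du ≤ energy W R w Dw

/-! Write a₁ for `a i₁`, put ε = q/2 and P = (Q - ε)₊³. The scalar function P(u) is subharmonic on
D_{4R}, and its averages over large balls inside D_{4R} are small. The mean value inequality then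
makes it small at every point far from the boundary, and P(u) ≤ ε³ says exactly that Q(u) ≤ 2ε = q.

Smallness of the averages. On a ball B_r(x) in D_{4R}, and equivariantly on its images under G,
replace u by (1 - τ²)u + τ²m, where m is the locally constant equivariant map equal to a₁ on D and τ
is a cutoff. Where τ = 1 the new map has no energy. In the transition layer of width about one the
cost per unit volume is bounded, and no gradient bound for u is needed because of the square
(`norm_sq_convex_le`). Minimality gives ∫ W(u) ≤ C rⁿ⁻¹ over B_{r-1}(x), with C independent of x, r,
R and u (`exists_setIntegral_potential_le`). Since a₁ is the only zero of W in the closed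
symmetrized region and P vanishes near a₁, compactness gives P ≤ C W on the values of u
(`IsQMonotone.exists_truncCube_le`). So the average of P(u) is O(1/r).

Subharmonicity. Given Δu = W_u(u), the chain rule writes ΔP(u) as a Hessian term, nonnegative
because P is convex, plus ⟨P_u, W_u⟩, nonnegative by Q-monotonicity. Truncating removes the cone
singularity of Q at a₁, and the cube makes P of class C².

The Euler-Lagrange equation is not automatic, since minimality holds only among positive maps
(`IsRegularMinimizer.laplacianAt_eq`). Let f = Δu - W_u(u) at a point x of F. Moving u towards
points v of the closed region gives ⟨f, v - u(x)⟩ ≤ 0, so f is an outward normal at u(x). The vector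
W_u(u(x)) is fixed by the stabilizer of u(x), hence tangent to the region in both directions, so ⟨f,
W_u⟩ = 0. The function ⟨f, u⟩ has a local maximum at x, because u stays in the region, so ⟨f, Δu⟩ ≤
0. Subtracting, |f|² ≤ 0. The two-sided tangency requires the closed region to be the intersection
of the half-spaces bounded by the mirrors, which is where the theory of finite reflection groups
enters. -/

/-! ### Finite reflection groups and the shape of a fundamental region -/

section ReflectionGeometry

variable {n : ℕ}

lemma Orth.mul_apply (g h : Orth n) (x : Eucl n) : (g * h) x = g (h x) := rfl

lemma Orth.apply_inv_apply (g : Orth n) (x : Eucl n) : g (g⁻¹ x) = x := by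
  rw [← Orth.mul_apply, mul_inv_cancel]; rfl

lemma Orth.inv_apply_apply (g : Orth n) (x : Eucl n) : g⁻¹ (g x) = x := by
  rw [← Orth.mul_apply, inv_mul_cancel]; rfl

/-- The reflection in the hyperplane orthogonal to `η`. -/
noncomputable def hyperplaneReflection (η : Eucl n) : Orth n := (ℝ ∙ η)ᗮ.reflection

lemma hyperplaneReflection_apply {η : Eucl n} (hη : ‖η‖ = 1) (x : Eucl n) :
    hyperplaneReflection η x = x - (2 * ⟪x, η⟫) • η := by
  unfold hyperplaneReflection
  rw [Submodule.reflection_orthogonal_apply, Submodule.reflection_singleton_apply]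
  simp only [hη, real_inner_comm x η]
  simp only [RCLike.ofReal_real_eq_id, id_eq, one_pow, div_one, neg_sub, two_smul, two_mul, add_smul]

lemma hyperplaneReflection_self (η : Eucl n) : hyperplaneReflection η η = -η :=
  Submodule.reflection_orthogonalComplement_singleton_eq_neg η

lemma hyperplaneReflection_mul_self (η : Eucl n) :
    hyperplaneReflection η * hyperplaneReflection η = 1 :=
  Submodule.reflection_mul_reflection _

lemma hyperplaneReflection_hyperplaneReflection (η x : Eucl n) :
    hyperplaneReflection η (hyperplaneReflection η x) = x :=
  Submodule.reflection_reflection _ x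

lemma inner_hyperplaneReflection_left (η x y : Eucl n) :
    ⟪hyperplaneReflection η x, y⟫ = ⟪x, hyperplaneReflection η y⟫ := by
  rw [← (hyperplaneReflection η).inner_map_map x, hyperplaneReflection_hyperplaneReflection]

lemma hyperplaneReflection_map {η : Eucl n} (hη : ‖η‖ = 1) (g : Orth n) :
    hyperplaneReflection (g η) = g * hyperplaneReflection η * g⁻¹ := by
  ext1 x
  have h1 : ‖g η‖ = 1 := by simpa using hη
  have h2 : g (g⁻¹ x) = x := Orth.apply_inv_apply g x
  rw [Orth.mul_apply, Orth.mul_apply]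
  rw [hyperplaneReflection_apply h1, hyperplaneReflection_apply hη, map_sub, map_smul, h2]
  congr 3
  rw [← g.inner_map_map (g⁻¹ x) η, h2]

lemma IsHyperplaneReflection.exists_eq {γ : Orth n} (h : IsHyperplaneReflection γ) :
    ∃ η : Eucl n, ‖η‖ = 1 ∧ γ = hyperplaneReflection η := by
  obtain ⟨η, hη, h⟩ := h
  exact ⟨η, hη, by ext1 x; rw [h, hyperplaneReflection_apply hη]⟩

/-- Unit normals of the reflections in `G`, pointing to the side of `f`. -/
structure IsPosRoot (G : Subgroup (Orth n)) (f η : Eucl n) : Prop where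
  norm_eq : ‖η‖ = 1
  mem : hyperplaneReflection η ∈ G
  pos : 0 < ⟪f, η⟫

/-- `f` lies on no reflection hyperplane of `G`. -/
def IsRegularPoint (G : Subgroup (Orth n)) (f : Eucl n) : Prop :=
  ∀ η : Eucl n, ‖η‖ = 1 → hyperplaneReflection η ∈ G → ⟪f, η⟫ ≠ 0

/-- A positive root whose reflection keeps all other positive roots positive. -/
structure IsSimpleRoot (G : Subgroup (Orth n)) (f s : Eucl n) : Prop where
  posRoot : IsPosRoot G f s
  map_pos : ∀ η, IsPosRoot G f η → η ≠ s → 0 < ⟪f, hyperplaneReflection s η⟫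

variable {G : Subgroup (Orth n)} {f : Eucl n}

lemma hyperplaneReflection_map_mem {η : Eucl n} (hη : ‖η‖ = 1)
    (hm : hyperplaneReflection η ∈ G) {g : Orth n} (hg : g ∈ G) :
    hyperplaneReflection (g η) ∈ G := by
  rw [hyperplaneReflection_map hη]
  exact G.mul_mem (G.mul_mem hg hm) (G.inv_mem hg)

lemma IsSimpleRoot.map {s η : Eucl n} (hs : IsSimpleRoot G f s) (h : IsPosRoot G f η)
    (hne : η ≠ s) : IsPosRoot G f (hyperplaneReflection s η) :=
  ⟨by rw [LinearIsometryEquiv.norm_map]; exact h.norm_eq,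
    hyperplaneReflection_map_mem h.norm_eq h.mem hs.posRoot.mem, hs.map_pos η h hne⟩

lemma IsPosRoot.injOn {η η' : Eucl n} (h : IsPosRoot G f η) (h' : IsPosRoot G f η')
    (he : hyperplaneReflection η = hyperplaneReflection η') : η = η' := by
  have h1 : hyperplaneReflection η' η = -η := by rw [← he, hyperplaneReflection_self]
  rw [hyperplaneReflection_apply h'.norm_eq] at h1
  have h2 : η = ⟪η, η'⟫ • η' := by
    have : (2 : ℝ) • η = (2 : ℝ) • (⟪η, η'⟫ • η') := by
      rw [sub_eq_iff_eq_add] at h1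
      rw [smul_smul, two_smul]
      nth_rewrite 1 [h1]
      abel
    exact smul_right_injective _ two_ne_zero this
  have h3 : |⟪η, η'⟫| = 1 := by
    have := congrArg norm h2
    rw [norm_smul, h.norm_eq, h'.norm_eq, mul_one] at this
    simpa using this.symm
  rcases (abs_eq zero_le_one).1 h3 with h4 | h4
  · rw [h2, h4, one_smul]
  · exfalso
    have h5 := h.pos
    rw [h2, h4, inner_smul_right] at h5
    linarith [h'.pos]

lemma finite_setOf_isPosRoot (hG : Finite G) : {η | IsPosRoot G f η}.Finite := by
  have hfin : (G : Set (Orth n)).Finite := Set.toFinite _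
  refine Set.Finite.of_injOn (f := hyperplaneReflection) (t := (G : Set (Orth n))) ?_ ?_ hfin
  · intro η hη; exact hη.mem
  · intro η hη η' hη' he; exact hη.injOn hη' he

/-- A point on the wrong side of some reflection hyperplane is on the wrong side of the
hyperplane of a simple root. -/
lemma exists_isSimpleRoot_inner_neg (hG : Finite G) (hreg : IsRegularPoint G f) {p : Eucl n}
    (h : ∃ η, IsPosRoot G f η ∧ ⟪p, η⟫ < 0) :
    ∃ s, IsSimpleRoot G f s ∧ ⟪p, s⟫ < 0 := by
  have hfin : {η | IsPosRoot G f η ∧ ⟪p, η⟫ < 0}.Finite :=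
    (finite_setOf_isPosRoot (f := f) hG).subset fun η h => h.1
  -- The smallest ratio belongs to the mirrors crossed first on the segment from `f` to `p`; among
  -- these, the root with least `⟪f, η⟫` will be simple.
  obtain ⟨s₁, hs₁, hmax⟩ := Set.exists_min_image _ (fun η => ⟪p, η⟫ / ⟪f, η⟫) hfin h
  set ρ := ⟪p, s₁⟫ / ⟪f, s₁⟫ with hρ
  have hfin2 : {η | (IsPosRoot G f η ∧ ⟪p, η⟫ < 0) ∧ ⟪p, η⟫ = ρ * ⟪f, η⟫}.Finite :=
    hfin.subset fun η h => h.1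
  have hρneg : ρ < 0 := div_neg_of_neg_of_pos hs₁.2 hs₁.1.pos
  obtain ⟨s, ⟨⟨hs, hsp⟩, hsρ⟩, hmin⟩ := Set.exists_min_image _ (fun η => ⟪f, η⟫) hfin2
    ⟨s₁, hs₁, by rw [hρ, div_mul_cancel₀ _ hs₁.1.pos.ne']⟩
  have key : ∀ η, IsPosRoot G f η → ρ * ⟪f, η⟫ ≤ ⟪p, η⟫ := by
    intro η hη
    by_cases hp : ⟪p, η⟫ < 0
    · exact (le_div_iff₀ hη.pos).1 (hmax η ⟨hη, hp⟩)
    · push Not at hp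
      nlinarith [hη.pos]
  refine ⟨s, ⟨hs, fun η hη hne => ?_⟩, hsp⟩
  by_contra hcon
  have hn : ‖hyperplaneReflection s η‖ = 1 := by
    rw [LinearIsometryEquiv.norm_map]; exact hη.norm_eq
  have hmem : hyperplaneReflection (hyperplaneReflection s η) ∈ G :=
    hyperplaneReflection_map_mem hη.norm_eq hη.mem hs.mem
  have hlt : ⟪f, hyperplaneReflection s η⟫ < 0 :=
    lt_of_le_of_ne (not_lt.1 hcon) (hreg _ hn hmem)
  -- If `s` makes `η` negative, then `η` and `η'` are positive roots with sum `2b • s`, `b < 1`.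
  -- Equality in `key` for `s` forces it for both, and one of them has a smaller product with `f`
  -- than `s`.
  have hη' : IsPosRoot G f (-hyperplaneReflection s η) := by
    refine ⟨by rw [norm_neg, hn], ?_, by rw [inner_neg_right]; linarith⟩
    have : hyperplaneReflection (-hyperplaneReflection s η)
        = hyperplaneReflection (hyperplaneReflection s η) := by
      ext1 x
      rw [hyperplaneReflection_apply (by rw [norm_neg, hn]), hyperplaneReflection_apply hn]
      simp
    rwa [this]
  set η' := -hyperplaneReflection s η with hη'def
  set b := ⟪η, s⟫ with hb
  have hsum : η + η' = (2 * b) • s := by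
    rw [hη'def, hyperplaneReflection_apply hs.norm_eq]; abel
  have hbl : b < 1 := by
    refine lt_of_le_of_ne ?_ ?_
    · have := real_inner_le_norm η s
      rwa [hη.norm_eq, hs.norm_eq, mul_one] at this
    · intro h1
      exact hne ((inner_eq_one_iff_of_norm_eq_one hη.norm_eq hs.norm_eq).1 h1)
  have hf : ⟪f, η⟫ + ⟪f, η'⟫ = 2 * b * ⟪f, s⟫ := by
    rw [← inner_add_right, hsum, inner_smul_right]
  have hp : ⟪p, η⟫ + ⟪p, η'⟫ = 2 * b * ⟪p, s⟫ := by
    rw [← inner_add_right, hsum, inner_smul_right]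
  have h1 := key η hη
  have h2 := key η' hη'
  have hsum0 : ⟪p, η⟫ + ⟪p, η'⟫ = ρ * ⟪f, η⟫ + ρ * ⟪f, η'⟫ := by
    rw [hp, hsρ, ← mul_add, hf]; ring
  have e1 : ⟪p, η⟫ = ρ * ⟪f, η⟫ := by linarith
  have e2 : ⟪p, η'⟫ = ρ * ⟪f, η'⟫ := by linarith
  have m1 := hmin η ⟨⟨hη, by rw [e1]; exact mul_neg_of_neg_of_pos hρneg hη.pos⟩, e1⟩
  have m2 := hmin η' ⟨⟨hη', by rw [e2]; exact mul_neg_of_neg_of_pos hρneg hη'.pos⟩, e2⟩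
  have := hs.pos
  nlinarith

/-- The word in reflections attached to a list of roots. -/
noncomputable def reflectionWord (l : List (Eucl n)) : Orth n :=
  (l.map hyperplaneReflection).prod

lemma reflectionWord_cons (s : Eucl n) (l : List (Eucl n)) :
    reflectionWord (s :: l) = hyperplaneReflection s * reflectionWord l := by
  simp [reflectionWord]

/-- The exchange property. -/
lemma exists_reflectionWord_of_inner_neg (l : List (Eucl n))
    (hl : ∀ s ∈ l, IsSimpleRoot G f s) {γ : Eucl n} (hγ : IsPosRoot G f γ)
    (hneg : ⟪reflectionWord l f, γ⟫ < 0) :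
    ∃ l' : List (Eucl n), (∀ s ∈ l', IsSimpleRoot G f s) ∧ l'.length + 1 = l.length ∧
      hyperplaneReflection γ * reflectionWord l = reflectionWord l' := by
  induction l generalizing γ with
  | nil =>
    have := hγ.pos
    simp [reflectionWord] at hneg
    linarith
  | cons t l ih =>
    have ht := hl t (by simp)
    have hl' : ∀ s ∈ l, IsSimpleRoot G f s := fun s hs => hl s (by simp [hs])
    by_cases hγt : γ = t
    · refine ⟨l, hl', by simp, ?_⟩
      rw [reflectionWord_cons, hγt, ← mul_assoc, hyperplaneReflection_mul_self, one_mul]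
    -- As `t` is simple, it keeps `γ` positive; the induction applies to the reflected root, and
    -- conjugating by `t` brings the result back to `γ`.
    · have hγ' := ht.map hγ hγt
      have hneg' : ⟪reflectionWord l f, hyperplaneReflection t γ⟫ < 0 := by
        rw [← inner_hyperplaneReflection_left]
        rwa [reflectionWord_cons] at hneg
      obtain ⟨l', h1, h2, h3⟩ := ih hl' hγ' hneg'
      refine ⟨t :: l', ?_, by simp [h2], ?_⟩
      · intro s hs
        rcases List.mem_cons.1 hs with rfl | hs
        · exact ht
        · exact h1 s hs
      · rw [reflectionWord_cons, reflectionWord_cons, ← h3, hyperplaneReflection_map hγ.norm_eq]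
        have : (hyperplaneReflection t)⁻¹ = hyperplaneReflection t :=
          inv_eq_of_mul_eq_one_left (hyperplaneReflection_mul_self t)
        rw [this]
        have h4 := hyperplaneReflection_mul_self t
        calc hyperplaneReflection γ * (hyperplaneReflection t * reflectionWord l)
            = 1 * hyperplaneReflection γ * (hyperplaneReflection t * reflectionWord l) := by
              rw [one_mul]
          _ = _ := by rw [← h4]; simp only [mul_assoc]

/-- Descent on `⟪f, η⟫`: `f` reflected in `η` is on the wrong side of some simple `s`, which forces
`⟪η, s⟫ > 0`. Reflecting `η` in `s` then lowers `⟪f, η⟫`, and the two reflections are conjugate by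
that of `s`. -/
lemma hyperplaneReflection_mem_closure_simple (hG : Finite G) (hreg : IsRegularPoint G f)
    {η : Eucl n} (hη : IsPosRoot G f η) :
    hyperplaneReflection η ∈
      Subgroup.closure (hyperplaneReflection '' {s | IsSimpleRoot G f s}) := by
  have hfin := finite_setOf_isPosRoot (f := f) hG
  by_contra hcon
  obtain ⟨η, ⟨hη, hbad⟩, hmin⟩ := Set.exists_min_image
    {η | IsPosRoot G f η ∧ hyperplaneReflection η ∉
      Subgroup.closure (hyperplaneReflection '' {s | IsSimpleRoot G f s})}
    (fun η => ⟪f, η⟫) (hfin.subset fun η h => h.1) ⟨η, hη, hcon⟩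
  have hns : ¬ IsSimpleRoot G f η := fun h =>
    hbad (Subgroup.subset_closure ⟨η, h, rfl⟩)
  obtain ⟨s, hs, hsn⟩ := exists_isSimpleRoot_inner_neg (p := hyperplaneReflection η f) hG hreg
    ⟨η, hη, by
      rw [inner_hyperplaneReflection_left, hyperplaneReflection_self, inner_neg_right]
      linarith [hη.pos]⟩
  have hne : η ≠ s := fun h => hns (h ▸ hs)
  have hη' := hs.map hη hne
  have hlt : ⟪f, hyperplaneReflection s η⟫ < ⟪f, η⟫ := by
    rw [inner_hyperplaneReflection_left, hyperplaneReflection_apply hη.norm_eq,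
      inner_sub_right, inner_smul_right] at hsn
    rw [hyperplaneReflection_apply hs.posRoot.norm_eq, inner_sub_right, inner_smul_right]
    have h1 := hs.posRoot.pos
    have h2 := hη.pos
    rw [real_inner_comm s η]
    rw [real_inner_comm η s] at *
    have : 0 < ⟪η, s⟫ := by
      by_contra h
      nlinarith
    nlinarith
  refine absurd (hmin (hyperplaneReflection s η) ⟨hη', fun hmem => hbad ?_⟩) (not_le.2 hlt)
  have hsm : hyperplaneReflection s ∈
      Subgroup.closure (hyperplaneReflection '' {s | IsSimpleRoot G f s}) :=
    Subgroup.subset_closure ⟨s, hs, rfl⟩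
  have h3 := hyperplaneReflection_map hη'.norm_eq (hyperplaneReflection s)
  rw [hyperplaneReflection_hyperplaneReflection] at h3
  rw [h3]
  exact Subgroup.mul_mem _ (Subgroup.mul_mem _ hsm hmem) (Subgroup.inv_mem _ hsm)

lemma exists_eq_reflectionWord (hG : IsFiniteReflectionGroup G) (hreg : IsRegularPoint G f)
    {g : Orth n} (hg : g ∈ G) :
    ∃ l : List (Eucl n), (∀ s ∈ l, IsSimpleRoot G f s) ∧ g = reflectionWord l := by
  obtain ⟨S, hS, hSG⟩ := hG.generated
  have hle : G ≤ Subgroup.closure (hyperplaneReflection '' {s | IsSimpleRoot G f s}) := by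
    conv_lhs => rw [← hSG]
    rw [Subgroup.closure_le]
    intro γ hγ
    obtain ⟨η, hη, rfl⟩ := (hS γ hγ).exists_eq
    have hmem : hyperplaneReflection η ∈ G := hSG ▸ Subgroup.subset_closure hγ
    rcases lt_or_gt_of_ne (hreg η hη hmem) with h | h
    · have e : hyperplaneReflection (-η) = hyperplaneReflection η := by
        ext1 x
        rw [hyperplaneReflection_apply (by rw [norm_neg, hη]), hyperplaneReflection_apply hη]
        simp
      rw [← e]
      refine hyperplaneReflection_mem_closure_simple hG.finite hreg
        ⟨by rw [norm_neg, hη], e ▸ hmem, by rw [inner_neg_right]; linarith⟩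
    · exact hyperplaneReflection_mem_closure_simple hG.finite hreg ⟨hη, hmem, h⟩
  refine Subgroup.closure_induction_left (p := fun g _ => ∃ l : List (Eucl n),
    (∀ s ∈ l, IsSimpleRoot G f s) ∧ g = reflectionWord l) ?_ ?_ ?_ (hle hg)
  · exact ⟨[], by simp, by simp [reflectionWord]⟩
  · rintro _ ⟨s, hs, rfl⟩ y _ ⟨l, hl, rfl⟩
    refine ⟨s :: l, ?_, (reflectionWord_cons s l).symm⟩
    intro t ht
    rcases List.mem_cons.1 ht with rfl | ht
    · exact hs
    · exact hl t ht
  · rintro _ ⟨s, hs, rfl⟩ y _ ⟨l, hl, rfl⟩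
    refine ⟨s :: l, ?_, ?_⟩
    · intro t ht
      rcases List.mem_cons.1 ht with rfl | ht
      · exact hs
      · exact hl t ht
    · rw [reflectionWord_cons, inv_eq_of_mul_eq_one_left (hyperplaneReflection_mul_self s)]

/-- A finite reflection group acts freely on its chambers. -/
lemma eq_one_of_forall_inner_nonneg (hG : IsFiniteReflectionGroup G)
    (hreg : IsRegularPoint G f) {g : Orth n} (hg : g ∈ G)
    (hpos : ∀ η, IsPosRoot G f η → 0 ≤ ⟪g f, η⟫) : g = 1 := by
  have hex : ∃ k : ℕ, ∃ l : List (Eucl n), (∀ s ∈ l, IsSimpleRoot G f s) ∧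
      g = reflectionWord l ∧ l.length = k := by
    obtain ⟨l, hl, h⟩ := exists_eq_reflectionWord hG hreg hg
    exact ⟨_, l, hl, h, rfl⟩
  classical
  -- Take a shortest word for `g`. If it starts with `s`, positivity of `⟪g f, s⟫` lets the exchange
  -- property shorten it.
  obtain ⟨l, hl, hgl, hlen⟩ := Nat.find_spec hex
  rcases l with _ | ⟨s, l⟩
  · simpa [reflectionWord] using hgl
  exfalso
  have hs := hl s (by simp)
  have hl' : ∀ s ∈ l, IsSimpleRoot G f s := fun s hs => hl s (by simp [hs])
  rw [reflectionWord_cons] at hgl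
  have hne : ⟪g f, s⟫ ≠ 0 := by
    have h1 : g (g⁻¹ s) = s := Orth.apply_inv_apply g s
    have h2 : ⟪g f, s⟫ = ⟪f, g⁻¹ s⟫ := by rw [← g.inner_map_map f, h1]
    rw [h2]
    exact hreg _ (by rw [LinearIsometryEquiv.norm_map]; exact hs.posRoot.norm_eq)
      (hyperplaneReflection_map_mem hs.posRoot.norm_eq hs.posRoot.mem (G.inv_mem hg))
  have hgt : 0 < ⟪g f, s⟫ := lt_of_le_of_ne (hpos s hs.posRoot) hne.symm
  have hneg : ⟪reflectionWord l f, s⟫ < 0 := by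
    rw [hgl, Orth.mul_apply, inner_hyperplaneReflection_left,
      hyperplaneReflection_self, inner_neg_right] at hgt
    linarith
  obtain ⟨l', h1, h2, h3⟩ := exists_reflectionWord_of_inner_neg l hl' hs.posRoot hneg
  refine Nat.find_min hex (m := l'.length) ?_ ⟨l', h1, by rw [hgl, h3], rfl⟩
  rw [← hlen, List.length_cons]
  omega

variable {F : Set (Eucl n)}

lemma IsFundamentalRegion.nonempty (hF : IsFundamentalRegion G F) : F.Nonempty := by
  by_contra h
  rw [Set.not_nonempty_iff_eq_empty] at h
  have := hF.cover
  simp only [h, closure_empty, image_empty, iUnion_empty] at this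
  exact Set.empty_ne_univ this

lemma IsFundamentalRegion.exists_mem_image (hF : IsFundamentalRegion G F) (y : Eucl n) :
    ∃ g ∈ G, ∃ x ∈ closure F, g x = y := by
  have : y ∈ (⋃ g ∈ G, g '' closure F) := by rw [hF.cover]; trivial
  simpa only [mem_iUnion, mem_image, exists_prop] using this

lemma IsFundamentalRegion.eq_one (hF : IsFundamentalRegion G F) {g : Orth n} (hg : g ∈ G)
    {x : Eucl n} (hx : x ∈ F) (hgx : g x ∈ F) : g = 1 := by
  by_contra h
  have := hF.disjoint_image g hg h
  exact (Set.eq_empty_iff_forall_notMem.1 this (g x)) ⟨hgx, x, hx, rfl⟩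

/-- A point of `F` on a mirror would be fixed by a nontrivial element of `G`, so `F` would meet one
of its images. -/
lemma IsFundamentalRegion.isRegularPoint (hF : IsFundamentalRegion G F) (hf : f ∈ F) :
    IsRegularPoint G f := by
  intro η hη hmem h0
  have h1 : hyperplaneReflection η f = f := by
    rw [hyperplaneReflection_apply hη, h0]; simp
  have h2 := hF.eq_one hmem hf (by rw [h1]; exact hf)
  have h3 := hyperplaneReflection_self η
  rw [h2] at h3
  have h4 : η = 0 := by
    have : η = -η := h3
    have h5 : (2 : ℝ) • η = 0 := by
      rw [two_smul]
      nth_rewrite 1 [this]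
      exact neg_add_cancel η
    exact (smul_eq_zero.1 h5).resolve_left two_ne_zero
  rw [h4] at hη
  simp at hη

/-- `F` is convex and misses every mirror, so it lies on one side of each. The point `z` below is
where the segment from `f` to `y` would meet the mirror. -/
lemma IsFundamentalRegion.inner_pos (hF : IsFundamentalRegion G F) (hf : f ∈ F) {η : Eucl n}
    (hη : IsPosRoot G f η) {y : Eucl n} (hy : y ∈ F) : 0 < ⟪y, η⟫ := by
  by_contra hcon
  push Not at hcon
  have hp := hη.pos
  set a := ⟪f, η⟫
  set b := ⟪y, η⟫ with hb
  have hab : 0 < a - b := by linarith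
  set z := (-b / (a - b)) • f + (a / (a - b)) • y with hz
  have hzF : z ∈ F := hF.convex hf hy (div_nonneg (by linarith) hab.le)
    (div_nonneg hp.le hab.le) (by field_simp; ring)
  refine hF.isRegularPoint hzF η hη.norm_eq hη.mem ?_
  rw [hz, inner_add_left, real_inner_smul_left, real_inner_smul_left]
  change (-b / (a - b)) * a + (a / (a - b)) * b = 0
  field_simp; ring

lemma IsFundamentalRegion.isPosRoot_iff (hF : IsFundamentalRegion G F) (hf : f ∈ F)
    {y : Eucl n} (hy : y ∈ F) {η : Eucl n} : IsPosRoot G f η ↔ IsPosRoot G y η :=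
  ⟨fun h => ⟨h.norm_eq, h.mem, hF.inner_pos hf h hy⟩,
    fun h => ⟨h.norm_eq, h.mem, hF.inner_pos hy h hf⟩⟩

/-- The closure of a fundamental region is the intersection of the closed half-spaces
bounded by the reflection hyperplanes. -/
lemma IsFundamentalRegion.mem_closure_iff (hG : IsFiniteReflectionGroup G)
    (hF : IsFundamentalRegion G F) (hf : f ∈ F) {y : Eucl n} :
    y ∈ closure F ↔ ∀ η, IsPosRoot G f η → 0 ≤ ⟪y, η⟫ := by
  constructor
  · intro hy η hη
    have hcl : IsClosed {y : Eucl n | 0 ≤ ⟪y, η⟫} :=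
      isClosed_le continuous_const (by fun_prop)
    exact closure_minimal (fun z hz => (hF.inner_pos hf hη hz).le) hcl hy
  · intro hy
    have hfin := finite_setOf_isPosRoot (f := f) hG.finite
    -- Moving towards `f` makes the inequalities strict. Some `g` carries a point of the closure of
    -- `F` to `y + ε • f`; nearby points of `F` also land in the open half-spaces, and freeness
    -- gives `g = 1`.
    have hstep : ∀ ε : ℝ, 0 < ε → y + ε • f ∈ closure F := by
      intro ε hε
      have hopen : IsOpen (⋂ η ∈ {η | IsPosRoot G f η}, {z : Eucl n | 0 < ⟪z, η⟫}) :=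
        hfin.isOpen_biInter fun η _ => isOpen_lt continuous_const (by fun_prop)
      obtain ⟨g, hg, x, hx, hgx⟩ := hF.exists_mem_image (y + ε • f)
      have hmem : x ∈ g ⁻¹' (⋂ η ∈ {η | IsPosRoot G f η}, {z : Eucl n | 0 < ⟪z, η⟫}) := by
        rw [mem_preimage, hgx]
        simp only [mem_iInter, mem_ofPred_eq]
        intro η hη
        rw [inner_add_left, real_inner_smul_left]
        have := mul_pos hε hη.pos
        linarith [hy η hη]
      obtain ⟨z, hz1, hz2⟩ := _root_.mem_closure_iff.1 hx _ (hopen.preimage g.continuous) hmem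
      have hg1 : g = 1 := by
        refine eq_one_of_forall_inner_nonneg hG (hF.isRegularPoint hz2) hg fun η hη => ?_
        rw [mem_preimage] at hz1
        simp only [mem_iInter, mem_ofPred_eq] at hz1
        exact (hz1 η ((hF.isPosRoot_iff hf hz2).2 hη)).le
      rw [hg1] at hgx
      have : x = y + ε • f := hgx
      rwa [this] at hx
    have hlim : Filter.Tendsto (fun ε : ℝ => y + ε • f) (nhdsWithin 0 (Ioi 0)) (nhds y) := by
      have : Filter.Tendsto (fun ε : ℝ => y + ε • f) (nhds 0) (nhds (y + (0 : ℝ) • f)) :=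
        Continuous.tendsto (by fun_prop) 0
      rw [zero_smul, add_zero] at this
      exact this.mono_left nhdsWithin_le_nhds
    refine isClosed_closure.mem_of_tendsto hlim ?_
    filter_upwards [self_mem_nhdsWithin] with ε hε using hstep ε hε

/-- At a point `p` of the closed fundamental region, vectors fixed by the reflections fixing
`p` are tangent to the region in both directions. -/
lemma IsFundamentalRegion.eventually_add_smul_mem (hG : IsFiniteReflectionGroup G)
    (hF : IsFundamentalRegion G F) {p v : Eucl n} (hp : p ∈ closure F)
    (hv : ∀ g ∈ G, g p = p → g v = v) :
    ∀ᶠ t : ℝ in nhds 0, p + t • v ∈ closure F := by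
  obtain ⟨f, hf⟩ := hF.nonempty
  have hfin := finite_setOf_isPosRoot (f := f) hG.finite
  have hev : ∀ η ∈ {η | IsPosRoot G f η}, ∀ᶠ t : ℝ in nhds 0, 0 ≤ ⟪p + t • v, η⟫ := by
    intro η hη
    have hη' : IsPosRoot G f η := hη
    -- A mirror through `p` contains `v`, so its inequality stays an equality along the line; a
    -- mirror missing `p` is not reached for small `t`.
    rcases ((hF.mem_closure_iff hG hf).1 hp η hη).eq_or_lt with h | h
    · have h1 : hyperplaneReflection η p = p := by
        rw [hyperplaneReflection_apply hη'.norm_eq, ← h]; simp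
      have h2 := hv _ hη'.mem h1
      have h3 : ⟪v, η⟫ = 0 := by
        have : ⟪hyperplaneReflection η v, η⟫ = -⟪v, η⟫ := by
          rw [inner_hyperplaneReflection_left, hyperplaneReflection_self, inner_neg_right]
        rw [h2] at this
        linarith
      refine Filter.Eventually.of_forall fun t => ?_
      rw [inner_add_left, real_inner_smul_left, h3, ← h]; simp
    · have hc : Filter.Tendsto (fun t : ℝ => ⟪p + t • v, η⟫) (nhds 0)
          (nhds ⟪p + (0 : ℝ) • v, η⟫) := Continuous.tendsto (by fun_prop) 0
      rw [zero_smul, add_zero] at hc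
      exact (hc.eventually (lt_mem_nhds h)).mono fun t ht => le_of_lt ht
  have := (Filter.eventually_all_finite hfin).2 hev
  filter_upwards [this] with t ht
  exact (hF.mem_closure_iff hG hf).2 fun η hη => ht η hη

end ReflectionGeometry

/-! ### Integration by parts, the Laplacian and weak derivatives -/

section Calculus

variable {n : ℕ} {X Y Z : Type*} [NormedAddCommGroup X] [NormedSpace ℝ X]
  [NormedAddCommGroup Y] [NormedSpace ℝ Y] [NormedAddCommGroup Z] [NormedSpace ℝ Z]

lemma bilinear_eventuallyEq_zero_of_notMem_tsupport (L : X →L[ℝ] Y →L[ℝ] Z) {f : Eucl n → X}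
    {g : Eucl n → Y} {x : Eucl n} (hx : x ∉ tsupport g) :
    (fun y => L (f y) (g y)) =ᶠ[nhds x] fun _ => 0 := by
  rw [notMem_tsupport_iff_eventuallyEq] at hx
  filter_upwards [hx] with y hy
  rw [hy]; simp

/-- A product with a factor supported inside `U` is continuous as soon as the other factor is
continuous on `U`. -/
lemma continuous_bilinear_of_tsupport_subset (L : X →L[ℝ] Y →L[ℝ] Z) {U : Set (Eucl n)}
    (hU : IsOpen U) {f : Eucl n → X} {g : Eucl n → Y} (hf : ContinuousOn f U)
    (hg : Continuous g) (hgU : tsupport g ⊆ U) :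
    Continuous fun y => L (f y) (g y) := by
  rw [continuous_iff_continuousAt]
  intro x
  by_cases hx : x ∈ tsupport g
  · have h1 : ContinuousAt f x := hf.continuousAt (hU.mem_nhds (hgU hx))
    have h2 : ContinuousAt g x := hg.continuousAt
    exact (L.continuous.continuousAt.comp h1).clm_apply h2
  · exact continuousAt_const.congr (bilinear_eventuallyEq_zero_of_notMem_tsupport L hx).symm

lemma contDiff_smul_of_tsupport_subset {k : WithTop ℕ∞} {U : Set (Eucl n)} (hU : IsOpen U)
    {f : Eucl n → X} {g : Eucl n → ℝ} (hf : ContDiffOn ℝ k f U) (hg : ContDiff ℝ k g)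
    (hgU : tsupport g ⊆ U) : ContDiff ℝ k fun y => g y • f y := by
  rw [contDiff_iff_contDiffAt]
  intro x
  by_cases hx : x ∈ tsupport g
  · exact hg.contDiffAt.smul (hf.contDiffAt (hU.mem_nhds (hgU hx)))
  · refine contDiffAt_const (c := (0 : X)) |>.congr_of_eventuallyEq ?_
    rw [notMem_tsupport_iff_eventuallyEq] at hx
    filter_upwards [hx] with y hy
    rw [hy]; simp

lemma hasCompactSupport_bilinear (L : X →L[ℝ] Y →L[ℝ] Z) {f : Eucl n → X} {g : Eucl n → Y}
    (hgc : HasCompactSupport g) : HasCompactSupport fun y => L (f y) (g y) :=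
  hgc.mono fun y hy => by
    intro h0
    exact hy (by simp [h0])

lemma integrable_bilinear_of_tsupport_subset (L : X →L[ℝ] Y →L[ℝ] Z) {U : Set (Eucl n)}
    (hU : IsOpen U) {f : Eucl n → X} {g : Eucl n → Y} (hf : ContinuousOn f U)
    (hg : Continuous g) (hgc : HasCompactSupport g) (hgU : tsupport g ⊆ U) :
    Integrable fun y => L (f y) (g y) :=
  (continuous_bilinear_of_tsupport_subset L hU hf hg hgU).integrable_of_hasCompactSupport
    (hasCompactSupport_bilinear L hgc)

/-- Integration by parts on an open set against a compactly supported factor. -/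
lemma integral_bilinear_fderiv_of_tsupport_subset (L : X →L[ℝ] Y →L[ℝ] Z)
    {U : Set (Eucl n)} (hU : IsOpen U) {f : Eucl n → X} {g : Eucl n → Y}
    (hf : ContDiffOn ℝ 1 f U) (hg : ContDiff ℝ 1 g) (hgc : HasCompactSupport g)
    (hgU : tsupport g ⊆ U) (v : Eucl n) :
    ∫ y, L (f y) (fderiv ℝ g y v) = - ∫ y, L (fderiv ℝ f y v) (g y) := by
  have hf' : ContinuousOn (fun y => fderiv ℝ f y v) U :=
    (hf.continuousOn_fderiv_of_isOpen hU le_rfl).clm_apply continuousOn_const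
  have hg' : Continuous (fun y => fderiv ℝ g y v) :=
    (hg.continuous_fderiv one_ne_zero).clm_apply continuous_const
  refine integral_bilinear_fderiv_right_eq_neg_left_of_integrable
    (integrable_bilinear_of_tsupport_subset L hU hf' hg.continuous hgc hgU)
    (integrable_bilinear_of_tsupport_subset L hU hf.continuousOn hg' (hgc.fderiv_apply ℝ v)
      ((tsupport_fderiv_apply_subset ℝ v).trans hgU))
    (integrable_bilinear_of_tsupport_subset L hU hf.continuousOn hg.continuous hgc hgU) ?_ ?_
  · intro x hx
    exact (hf.contDiffAt (hU.mem_nhds (hgU hx))).differentiableAt one_ne_zero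
  · intro x _
    exact hg.differentiable one_ne_zero x

/-- The Laplacian, as the trace of the second derivative. -/
noncomputable def laplacianAt (f : Eucl n → X) (x : Eucl n) : X :=
  ∑ i : Fin n, fderiv ℝ (fderiv ℝ f) x (EuclideanSpace.single i 1) (EuclideanSpace.single i 1)

/-- The trace does not depend on the orthonormal basis; the rotated basis `g eᵢ` will give
equivariance of the Laplacian. -/
lemma laplacianAt_eq_sum {ι : Type*} [Fintype ι] (b : OrthonormalBasis ι ℝ (Eucl n))
    (f : Eucl n → X) (x : Eucl n) :
    laplacianAt f x = ∑ i, fderiv ℝ (fderiv ℝ f) x (b i) (b i) := by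
  have h1 := congrFun (InnerProductSpace.laplacian_eq_iteratedFDeriv_orthonormalBasis f b) x
  rw [InnerProductSpace.laplacian_eq_iteratedFDeriv_orthonormalBasis f
    (EuclideanSpace.basisFun (Fin n) ℝ)] at h1
  simpa [iteratedFDeriv_two_apply, laplacianAt] using h1

lemma fderiv_fderiv_apply {f : Eucl n → X} {x : Eucl n} (hf : ContDiffAt ℝ 2 f x)
    (v w : Eucl n) :
    fderiv ℝ (fun y => fderiv ℝ f y v) x w = fderiv ℝ (fderiv ℝ f) x w v := by
  have h1 : DifferentiableAt ℝ (fderiv ℝ f) x :=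
    (hf.fderiv_right (m := 1) (by norm_num)).differentiableAt one_ne_zero
  rw [fderiv_clm_apply h1 (differentiableAt_const v)]
  simp

/-- The Dirichlet form against a compactly supported map. -/
lemma integral_sum_inner_fderiv {F : Type*} [NormedAddCommGroup F] [InnerProductSpace ℝ F]
    {U : Set (Eucl n)} (hU : IsOpen U) {f g : Eucl n → F} (hf : ContDiffOn ℝ 2 f U)
    (hg : ContDiff ℝ 1 g) (hgc : HasCompactSupport g) (hgU : tsupport g ⊆ U) :
    ∫ y, ∑ i : Fin n, ⟪fderiv ℝ f y (EuclideanSpace.single i 1),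
      fderiv ℝ g y (EuclideanSpace.single i 1)⟫
      = - ∫ y, ⟪laplacianAt f y, g y⟫ := by
  set e : Fin n → Eucl n := fun i => EuclideanSpace.single i 1 with he
  have hf1 : ContDiffOn ℝ 1 (fderiv ℝ f) U := hf.fderiv_of_isOpen hU (by norm_num)
  have hfi : ∀ i, ContDiffOn ℝ 1 (fun y => fderiv ℝ f y (e i)) U := fun i =>
    hf1.clm_apply contDiffOn_const
  have hfi' : ∀ i, ContinuousOn (fun y => fderiv ℝ (fun y => fderiv ℝ f y (e i)) y (e i)) U :=
    fun i => ((hfi i).continuousOn_fderiv_of_isOpen hU le_rfl).clm_apply continuousOn_const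
  have key : ∀ i, ∫ y, ⟪fderiv ℝ f y (e i), fderiv ℝ g y (e i)⟫
      = - ∫ y, ⟪fderiv ℝ (fun y => fderiv ℝ f y (e i)) y (e i), g y⟫ := fun i =>
    integral_bilinear_fderiv_of_tsupport_subset (innerSL ℝ (E := F)) hU
      (hfi i) hg hgc hgU (e i)
  have hg' : ∀ i, Continuous (fun y => fderiv ℝ g y (e i)) := fun i =>
    (hg.continuous_fderiv one_ne_zero).clm_apply continuous_const
  have int1 : ∀ i, Integrable fun y => ⟪fderiv ℝ f y (e i), fderiv ℝ g y (e i)⟫ := fun i =>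
    integrable_bilinear_of_tsupport_subset (innerSL ℝ (E := F)) hU
      (hfi i).continuousOn (hg' i) (hgc.fderiv_apply ℝ (e i))
      ((tsupport_fderiv_apply_subset ℝ (e i)).trans hgU)
  have int2 : ∀ i, Integrable fun y =>
      ⟪fderiv ℝ (fun y => fderiv ℝ f y (e i)) y (e i), g y⟫ := fun i =>
    integrable_bilinear_of_tsupport_subset (innerSL ℝ (E := F)) hU
      (hfi' i) hg.continuous hgc hgU
  rw [integral_finsetSum _ fun i _ => int1 i, Finset.sum_congr rfl fun i _ => key i,
    Finset.sum_neg_distrib, ← integral_finsetSum _ fun i _ => int2 i]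
  congr 1
  refine integral_congr_ae (Filter.Eventually.of_forall fun y => ?_)
  beta_reduce
  by_cases hy : y ∈ U
  · have hc : ContDiffAt ℝ 2 f y := hf.contDiffAt (hU.mem_nhds hy)
    rw [laplacianAt, sum_inner]
    refine Finset.sum_congr rfl fun i _ => ?_
    rw [fderiv_fderiv_apply hc]
  · have : g y = 0 := image_eq_zero_of_notMem_tsupport fun h => hy (hgU h)
    simp [this]

/-- Both derivatives obey the same integration by parts formula, so their difference in each
direction integrates to zero against all test functions. This replaces the abstract `Du` in the
energy by the classical derivative. -/
lemma HasW12Deriv.ae_eq_fderiv {R : ℝ} {u : Eucl n → Eucl n}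
    {Du : Eucl n → Eucl n →L[ℝ] Eucl n} (h : HasW12Deriv R u Du)
    (hu : ContDiffOn ℝ 1 u (Metric.ball 0 R)) :
    ∀ᵐ x ∂(volume.restrict (Metric.ball (0 : Eucl n) R)), Du x = fderiv ℝ u x := by
  set B := Metric.ball (0 : Eucl n) R with hB
  have hBo : IsOpen B := Metric.isOpen_ball
  have hBm : MeasurableSet B := hBo.measurableSet
  have hcont : ContinuousOn (fderiv ℝ u) B := hu.continuousOn_fderiv_of_isOpen hBo le_rfl
  have hDu : IntegrableOn Du B := by
    have hfin : IsFiniteMeasure (volume.restrict B) :=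
      ⟨by rw [Measure.restrict_apply_univ]; exact measure_ball_lt_top⟩
    exact h.memLp_deriv.integrable (by norm_num)
  have hdir : ∀ v : Eucl n, ∀ᵐ x ∂volume, x ∈ B → Du x v - fderiv ℝ u x v = 0 := by
    intro v
    have hDuv : IntegrableOn (fun x => Du x v) B := hDu.apply_continuousLinearMap v
    have hcv : ContinuousOn (fun x => fderiv ℝ u x v) B := hcont.clm_apply continuousOn_const
    have hloc2 : LocallyIntegrableOn (fun x => fderiv ℝ u x v) B :=
      hcv.locallyIntegrableOn hBm
    refine hBo.ae_eq_zero_of_integral_contDiff_smul_eq_zero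
      (hDuv.locallyIntegrableOn.sub hloc2) ?_
    intro g hg hgc hgB
    have h1 := h.weak_deriv g hg hgc hgB v
    have hg1 : ContDiff ℝ 1 g := hg.of_le (by exact_mod_cast le_top)
    have h2 := integral_bilinear_fderiv_of_tsupport_subset
      (ContinuousLinearMap.lsmul ℝ ℝ (E := Eucl n)).flip hBo hu hg1 hgc hgB v
    simp only [ContinuousLinearMap.flip_apply, ContinuousLinearMap.lsmul_apply] at h2
    have hi2 := integrable_bilinear_of_tsupport_subset
      (ContinuousLinearMap.lsmul ℝ ℝ (E := Eucl n)).flip hBo hcv hg1.continuous hgc hgB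
    simp only [ContinuousLinearMap.flip_apply, ContinuousLinearMap.lsmul_apply] at hi2
    have hz : ∀ x ∉ B, g x = 0 := fun x hx =>
      image_eq_zero_of_notMem_tsupport fun h => hx (hgB h)
    have hi1 : IntegrableOn (fun x => g x • Du x v) B := by
      obtain ⟨C, hC⟩ := hgc.exists_bound_of_continuous hg1.continuous
      exact hDuv.bdd_smul (C := C) hg1.continuous.aestronglyMeasurable
        (Filter.Eventually.of_forall hC)
    have e1 : ∫ x, g x • (Du x v - fderiv ℝ u x v)
        = ∫ x in B, g x • (Du x v - fderiv ℝ u x v) := by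
      rw [setIntegral_eq_integral_of_forall_compl_eq_zero]
      intro x hx; rw [hz x hx, zero_smul]
    have e2 : ∫ x in B, (fderiv ℝ g x v) • u x = ∫ x, (fderiv ℝ g x v) • u x := by
      rw [setIntegral_eq_integral_of_forall_compl_eq_zero]
      intro x hx
      rw [fderiv_of_notMem_tsupport (𝕜 := ℝ) (fun h => hx (hgB h))]; simp
    have e3 : ∫ x in B, g x • fderiv ℝ u x v = ∫ x, g x • fderiv ℝ u x v := by
      rw [setIntegral_eq_integral_of_forall_compl_eq_zero]
      intro x hx; rw [hz x hx, zero_smul]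
    rw [e1]
    simp only [smul_sub]
    rw [integral_sub hi1 hi2.integrableOn, e3]
    rw [e2, h2] at h1
    rw [neg_inj.1 h1, sub_self]
  have hall : ∀ᵐ x ∂volume, ∀ i : Fin n, x ∈ B →
      Du x (EuclideanSpace.single i 1) - fderiv ℝ u x (EuclideanSpace.single i 1) = 0 :=
    ae_all_iff.2 fun i => hdir _
  rw [ae_restrict_iff' hBm]
  filter_upwards [hall] with x hx hxB
  refine ContinuousLinearMap.coe_injective ?_
  refine (EuclideanSpace.basisFun (Fin n) ℝ).toBasis.ext fun i => ?_
  have := sub_eq_zero.1 (hx i hxB)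
  simpa using this

lemma memLp_add_of_normed {α F : Type*} [MeasurableSpace α] {μ : Measure α}
    [NormedAddCommGroup F] {f g : α → F} {p : ENNReal} (hf : MemLp f p μ) (hg : MemLp g p μ) :
    MemLp (f + g) p μ := hf.add hg

/-- No boundary condition on `z` is needed: the test functions are supported in the ball and
localize the integration by parts. -/
lemma HasW12Deriv.add_of_tsupport_subset {R : ℝ} {u z : Eucl n → Eucl n}
    {Du : Eucl n → Eucl n →L[ℝ] Eucl n} (h : HasW12Deriv R u Du)
    (hz : ContDiff ℝ 1 z) (hzc : HasCompactSupport z) :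
    HasW12Deriv R (fun x => u x + z x) (fun x => Du x + fderiv ℝ z x) := by
  have hfin : IsFiniteMeasure (volume.restrict (Metric.ball (0 : Eucl n) R)) :=
      ⟨by rw [Measure.restrict_apply_univ]; exact measure_ball_lt_top⟩
  have hzL : MemLp z 2 (volume.restrict (Metric.ball (0 : Eucl n) R)) :=
    (hz.continuous.memLp_of_hasCompactSupport hzc (μ := volume)).restrict _
  have hzL' : MemLp (fderiv ℝ z) 2 (volume.restrict (Metric.ball (0 : Eucl n) R)) :=
    ((hz.continuous_fderiv one_ne_zero).memLp_of_hasCompactSupport (hzc.fderiv ℝ)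
      (μ := volume)).restrict _
  have a1 : MemLp (u + z) 2 (volume.restrict (Metric.ball (0 : Eucl n) R)) := h.memLp.add hzL
  have a2 : MemLp (Du + fderiv ℝ z) 2 (volume.restrict (Metric.ball (0 : Eucl n) R)) :=
    memLp_add_of_normed h.memLp_deriv hzL'
  constructor
  · exact a1
  · exact a2
  intro φ hφ hφc hφR v
  have hφ1 : ContDiff ℝ 1 φ := hφ.of_le (by exact_mod_cast le_top)
  have hφv : Continuous fun x => fderiv ℝ φ x v :=
    (hφ1.continuous_fderiv one_ne_zero).clm_apply continuous_const
  have hzv : Continuous fun x => fderiv ℝ z x v :=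
    (hz.continuous_fderiv one_ne_zero).clm_apply continuous_const
  obtain ⟨C, hC⟩ := hφc.exists_bound_of_continuous hφ1.continuous
  obtain ⟨C', hC'⟩ := (hφc.fderiv_apply ℝ v).exists_bound_of_continuous hφv
  have iu := h.memLp.integrable (q := 2) (by norm_num)
  have iDu := (h.memLp_deriv.integrable (q := 2) (by norm_num)).apply_continuousLinearMap v
  have i1 : IntegrableOn (fun x => fderiv ℝ φ x v • u x) (Metric.ball 0 R) :=
    iu.bdd_smul (C := C') hφv.aestronglyMeasurable (Filter.Eventually.of_forall hC')
  have i2 : IntegrableOn (fun x => φ x • Du x v) (Metric.ball 0 R) :=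
    iDu.bdd_smul (C := C) hφ1.continuous.aestronglyMeasurable (Filter.Eventually.of_forall hC)
  have i3 : Integrable (fun x => fderiv ℝ φ x v • z x) :=
    (hφv.smul hz.continuous).integrable_of_hasCompactSupport hzc.smul_left
  have i4 : Integrable (fun x => φ x • fderiv ℝ z x v) :=
    (hφ1.continuous.smul hzv).integrable_of_hasCompactSupport hφc.smul_right
  have hIBP := integral_bilinear_fderiv_of_tsupport_subset
      (ContinuousLinearMap.lsmul ℝ ℝ (E := Eucl n)).flip (Metric.isOpen_ball (x := 0) (ε := R))
      hz.contDiffOn hφ1 hφc hφR v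
  simp only [ContinuousLinearMap.flip_apply, ContinuousLinearMap.lsmul_apply] at hIBP
  have e2 : ∫ x in Metric.ball 0 R, (fderiv ℝ φ x v) • z x = ∫ x, (fderiv ℝ φ x v) • z x := by
    rw [setIntegral_eq_integral_of_forall_compl_eq_zero]
    intro x hx
    rw [fderiv_of_notMem_tsupport (𝕜 := ℝ) (fun h => hx (hφR h))]; simp
  have e3 : ∫ x in Metric.ball 0 R, φ x • fderiv ℝ z x v = ∫ x, φ x • fderiv ℝ z x v := by
    rw [setIntegral_eq_integral_of_forall_compl_eq_zero]
    intro x hx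
    rw [image_eq_zero_of_notMem_tsupport fun h => hx (hφR h), zero_smul]
  simp only [smul_add, add_apply]
  rw [integral_add i1 i3.integrableOn, integral_add i2 i4.integrableOn, h.weak_deriv φ hφ hφc hφR v,
    e2, e3, hIBP, neg_add]

end Calculus

/-! ### Equivariant comparison maps and invariant cutoffs -/

section Variations

variable {n : ℕ} {G : Subgroup (Orth n)} {F Ω : Set (Eucl n)} {R : ℝ} {b : Eucl n}

/-- `b` is compatible with `Ω`: it is fixed by the elements of `G` moving `Ω` onto a set that
meets `Ω`, so that `g y ↦ g b`, for `y ∈ Ω`, is well defined. -/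
structure IsCompatible (G : Subgroup (Orth n)) (F Ω : Set (Eucl n)) (b : Eucl n) : Prop where
  isOpen : IsOpen Ω
  fixes : ∀ g ∈ G, ∀ y ∈ Ω, g y ∈ Ω → g b = b
  positive : ∀ g ∈ G, ∀ y ∈ Ω, g y ∈ closure F → g b ∈ closure F

open Classical in
/-- The locally constant equivariant map on the orbit of `Ω` that is equal to `b` on `Ω`. -/
noncomputable def orbitMap (G : Subgroup (Orth n)) (Ω : Set (Eucl n)) (b y : Eucl n) : Eucl n :=
  if h : ∃ g ∈ G, g⁻¹ y ∈ Ω then h.choose b else 0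

/-- The union of the images of `Ω` under `G`. -/
def orbitSet (G : Subgroup (Orth n)) (Ω : Set (Eucl n)) : Set (Eucl n) :=
  {y | ∃ g ∈ G, g⁻¹ y ∈ Ω}

/-- Two admissible choices differ by an element moving a point of `Ω` to a point of `Ω`, and such
elements fix `b`. -/
lemma IsCompatible.orbitMap_eq (h : IsCompatible G F Ω b) {g : Orth n} (hg : g ∈ G)
    {y : Eucl n} (hy : g⁻¹ y ∈ Ω) : orbitMap G Ω b y = g b := by
  have hex : ∃ g ∈ G, g⁻¹ y ∈ Ω := ⟨g, hg, hy⟩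
  rw [orbitMap, dif_pos hex]
  set k := hex.choose with hk
  obtain ⟨hkG, hky⟩ := hex.choose_spec
  rw [← hk] at hkG hky
  have h1 : (k⁻¹ * g) b = b := by
    refine h.fixes _ (G.mul_mem (G.inv_mem hkG) hg) _ hy ?_
    rw [Orth.mul_apply, Orth.apply_inv_apply]
    exact hky
  calc k b = k ((k⁻¹ * g) b) := by rw [h1]
    _ = g b := by rw [Orth.mul_apply, Orth.apply_inv_apply]

lemma isOpen_orbitSet (hΩ : IsOpen Ω) : IsOpen (orbitSet G Ω) := by
  have : orbitSet G Ω = ⋃ g ∈ G, (fun y => g⁻¹ y) ⁻¹' Ω := by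
    ext y; simp [orbitSet]
  rw [this]
  exact isOpen_biUnion fun g _ => hΩ.preimage (g⁻¹).continuous

lemma IsCompatible.orbitMap_map (h : IsCompatible G F Ω b) {g : Orth n} (hg : g ∈ G)
    {y : Eucl n} (hy : y ∈ orbitSet G Ω) :
    orbitMap G Ω b (g y) = g (orbitMap G Ω b y) := by
  obtain ⟨k, hk, hky⟩ := hy
  rw [h.orbitMap_eq hk hky, h.orbitMap_eq (G.mul_mem hg hk) (y := g y), Orth.mul_apply]
  rw [mul_inv_rev, Orth.mul_apply, Orth.inv_apply_apply]
  exact hky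

lemma IsCompatible.orbitMap_eventuallyEq (h : IsCompatible G F Ω b) {y : Eucl n}
    (hy : y ∈ orbitSet G Ω) :
    orbitMap G Ω b =ᶠ[nhds y] fun _ => orbitMap G Ω b y := by
  obtain ⟨k, hk, hky⟩ := hy
  have : ∀ᶠ z in nhds y, k⁻¹ z ∈ Ω :=
    (k⁻¹).continuous.continuousAt.eventually_mem (h.isOpen.mem_nhds hky)
  filter_upwards [this] with z hz
  rw [h.orbitMap_eq hk hz, h.orbitMap_eq hk hky]

lemma IsCompatible.norm_orbitMap_le (h : IsCompatible G F Ω b) (y : Eucl n) :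
    ‖orbitMap G Ω b y‖ ≤ ‖b‖ := by
  by_cases hy : y ∈ orbitSet G Ω
  · obtain ⟨k, hk, hky⟩ := hy
    rw [h.orbitMap_eq hk hky, LinearIsometryEquiv.norm_map]
  · have : orbitMap G Ω b y = 0 := dif_neg hy
    rw [this, norm_zero]
    exact norm_nonneg _

/-- A `G`-invariant cutoff function supported in the part in `B_R` of the orbit of `Ω`. -/
structure IsCutoff (G : Subgroup (Orth n)) (Ω : Set (Eucl n)) (R : ℝ) (σ : Eucl n → ℝ) :
    Prop where
  contDiff : ContDiff ℝ 2 σ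
  nonneg : ∀ y, 0 ≤ σ y
  le_one : ∀ y, σ y ≤ 1
  invariant : ∀ g ∈ G, ∀ y, σ (g y) = σ y
  compact : HasCompactSupport σ
  support_ball : tsupport σ ⊆ Metric.ball 0 R
  support_orbit : tsupport σ ⊆ orbitSet G Ω

variable {σ : Eucl n → ℝ}

lemma IsCutoff.const_mul (h : IsCutoff G Ω R σ) {t : ℝ} (h0 : 0 ≤ t) (h1 : t ≤ 1) :
    IsCutoff G Ω R fun y => t * σ y := by
  have hsub : tsupport (fun y => t * σ y) ⊆ tsupport σ := tsupport_mul_subset_right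
  exact ⟨contDiff_const.mul h.contDiff, fun y => mul_nonneg h0 (h.nonneg y),
    fun y => mul_le_one₀ h1 (h.nonneg y) (h.le_one y),
    fun g hg y => by rw [h.invariant g hg], h.compact.mul_left,
    hsub.trans h.support_ball, hsub.trans h.support_orbit⟩

/-- The squared cutoff serves the energy comparison, where the factor `τ` in `∇(τ²) = 2τ∇τ` is
essential. -/
lemma IsCutoff.sq (h : IsCutoff G Ω R σ) : IsCutoff G Ω R fun y => σ y ^ 2 := by
  have hsub : tsupport (fun y => σ y ^ 2) ⊆ tsupport σ := by
    refine closure_mono fun y hy h0 => hy ?_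
    simp [h0]
  refine ⟨h.contDiff.pow 2, fun y => sq_nonneg _, fun y => pow_le_one₀ (h.nonneg y) (h.le_one y),
    fun g hg y => by rw [h.invariant g hg], ?_,
    hsub.trans h.support_ball, hsub.trans h.support_orbit⟩
  exact h.compact.of_isClosed_subset (isClosed_tsupport _) hsub

lemma IsCutoff.mem_orbitSet (h : IsCutoff G Ω R σ) {y : Eucl n} (hy : σ y ≠ 0) :
    y ∈ orbitSet G Ω := h.support_orbit (subset_tsupport _ hy)

/-- The variation of `u` towards the equivariant map generated by `b`. -/
noncomputable def variationTo (G : Subgroup (Orth n)) (Ω : Set (Eucl n)) (b : Eucl n)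
    (σ : Eucl n → ℝ) (u : Eucl n → Eucl n) (y : Eucl n) : Eucl n :=
  σ y • (orbitMap G Ω b y - u y)

variable {u : Eucl n → Eucl n} {Du : Eucl n → Eucl n →L[ℝ] Eucl n}

lemma contDiff_variationTo (hb : IsCompatible G F Ω b) (hσ : IsCutoff G Ω R σ)
    (hu : ContDiffOn ℝ 2 u (Metric.ball 0 R)) : ContDiff ℝ 2 (variationTo G Ω b σ u) := by
  have hm : ContDiffOn ℝ 2 (orbitMap G Ω b) (orbitSet G Ω) := fun y hy =>
    (contDiffAt_const.congr_of_eventuallyEq (hb.orbitMap_eventuallyEq hy)).contDiffWithinAt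
  refine contDiff_smul_of_tsupport_subset
    (Metric.isOpen_ball.inter (isOpen_orbitSet (G := G) hb.isOpen))
    ((hm.mono inter_subset_right).sub (hu.mono inter_subset_left)) hσ.contDiff
    (subset_inter hσ.support_ball hσ.support_orbit)

lemma tsupport_variationTo_subset : tsupport (variationTo G Ω b σ u) ⊆ tsupport σ :=
  tsupport_smul_subset_left _ _

lemma hasCompactSupport_variationTo (hσ : IsCutoff G Ω R σ) :
    HasCompactSupport (variationTo G Ω b σ u) :=
  hσ.compact.of_isClosed_subset (isClosed_tsupport _) tsupport_variationTo_subset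

/-- The new map is `(1 - σ)u + σm` with `m` equivariant and valued in the closure of `F` over that
set, so positivity survives by convexity and equivariance by invariance of `σ`. -/
lemma isAdmissible_add_variationTo (hFc : Convex ℝ F) (hb : IsCompatible G F Ω b)
    (hσ : IsCutoff G Ω R σ) (hu : ContDiffOn ℝ 2 u (Metric.ball 0 R))
    (hadm : IsAdmissible G F R u Du) :
    IsAdmissible G F R (fun y => u y + variationTo G Ω b σ u y)
      (fun y => Du y + fderiv ℝ (variationTo G Ω b σ u) y) := by
  refine ⟨hadm.sobolev.add_of_tsupport_subset
    ((contDiff_variationTo hb hσ hu).of_le one_le_two) (hasCompactSupport_variationTo hσ), ?_, ?_⟩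
  · intro g hg
    filter_upwards [hadm.equivariant g hg] with y hy
    simp only [variationTo, hσ.invariant g hg, hy, map_add, map_smul, map_sub]
    by_cases h0 : σ y = 0
    · simp [h0]
    · rw [hb.orbitMap_map hg (hσ.mem_orbitSet h0)]
  · have hmeas : MeasurableSet (closure F ∩ Metric.ball (0 : Eucl n) R) :=
      isClosed_closure.measurableSet.inter Metric.isOpen_ball.measurableSet
    filter_upwards [hadm.positive, ae_restrict_mem hmeas] with y hy hyF
    by_cases h0 : σ y = 0
    · simpa [variationTo, h0] using hy
    · obtain ⟨k, hk, hky⟩ := hσ.mem_orbitSet h0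
      have hbF : k b ∈ closure F := by
        refine hb.positive k hk _ hky ?_
        rw [Orth.apply_inv_apply]
        exact hyF.1
      rw [variationTo, hb.orbitMap_eq hk hky]
      have := hFc.closure hy hbF (sub_nonneg.2 (hσ.le_one y)) (hσ.nonneg y) (by ring)
      convert this using 1
      module

/-- The `G`-invariant function `1 - ∏ (1 - ψ ∘ g⁻¹)`. -/
noncomputable def orbitCutoff (G : Subgroup (Orth n)) [Fintype G] (ψ : Eucl n → ℝ)
    (y : Eucl n) : ℝ := 1 - ∏ g : G, (1 - ψ ((g : Orth n)⁻¹ y))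

section OrbitCutoff

variable [Fintype G] {ψ : Eucl n → ℝ}

lemma exists_ne_zero_of_orbitCutoff_ne_zero {y : Eucl n} (h : orbitCutoff G ψ y ≠ 0) :
    ∃ g ∈ G, ψ (g⁻¹ y) ≠ 0 := by
  by_contra hcon
  push Not at hcon
  refine h ?_
  rw [orbitCutoff, Finset.prod_eq_one, sub_self]
  intro g _
  rw [hcon g g.2, sub_zero]

lemma orbitCutoff_eq_one {y : Eucl n} {g : Orth n} (hg : g ∈ G) (h : ψ (g⁻¹ y) = 1) :
    orbitCutoff G ψ y = 1 := by
  rw [orbitCutoff, Finset.prod_eq_zero (Finset.mem_univ (⟨g, hg⟩ : G)), sub_zero]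
  exact sub_eq_zero.2 h.symm

/-- Unlike the sum of the translates of `ψ`, the expression `1 - ∏ (1 - ψ ∘ g⁻¹)` stays between 0
and 1, and it remains smooth. -/
lemma isCutoff_orbitCutoff (hψ : ContDiff ℝ 2 ψ) (h0 : ∀ y, 0 ≤ ψ y) (h1 : ∀ y, ψ y ≤ 1)
    (hc : HasCompactSupport ψ) (hball : tsupport ψ ⊆ Metric.ball 0 R) (hΩ : tsupport ψ ⊆ Ω) :
    IsCutoff G Ω R (orbitCutoff G ψ) := by
  have hsub : tsupport (orbitCutoff G ψ) ⊆ ⋃ g : G, (g : Orth n) '' tsupport ψ := by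
    refine closure_minimal ?_ ?_
    · intro y hy
      obtain ⟨g, hg, hgy⟩ := exists_ne_zero_of_orbitCutoff_ne_zero hy
      exact mem_iUnion.2 ⟨⟨g, hg⟩, g⁻¹ y, subset_tsupport _ hgy, Orth.apply_inv_apply g y⟩
    · exact isClosed_iUnion_of_finite fun g =>
        (g : Orth n).isometry.isClosedEmbedding.isClosedMap _ (isClosed_tsupport _)
  refine ⟨?_, ?_, ?_, ?_, ?_, ?_, ?_⟩
  · refine contDiff_const.sub (contDiff_prod fun g _ => contDiff_const.sub ?_)
    exact hψ.comp ((g : Orth n)⁻¹).contDiff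
  · intro y
    refine sub_nonneg.2 (Finset.prod_le_one ?_ ?_)
    · intro g _; linarith [h1 ((g : Orth n)⁻¹ y)]
    · intro g _; linarith [h0 ((g : Orth n)⁻¹ y)]
  · intro y
    refine sub_le_self _ (Finset.prod_nonneg ?_)
    intro g _; linarith [h1 ((g : Orth n)⁻¹ y)]
  · intro k hk y
    rw [orbitCutoff, orbitCutoff]
    congr 1
    -- The product at `k y` is the product at `y` reindexed by `g ↦ k⁻¹ g`.
    refine Fintype.prod_equiv (Equiv.mulLeft (⟨k, hk⟩⁻¹ : G)) _ _ fun g => ?_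
    congr 2
  · refine HasCompactSupport.intro' (K := ⋃ g : G, (g : Orth n) '' tsupport ψ) ?_ ?_ ?_
    · exact isCompact_iUnion fun g => hc.isCompact.image (g : Orth n).continuous
    · exact isClosed_iUnion_of_finite fun g =>
        (g : Orth n).isometry.isClosedEmbedding.isClosedMap _ (isClosed_tsupport _)
    · intro y hy
      exact image_eq_zero_of_notMem_tsupport fun h => hy (hsub h)
  · intro y hy
    obtain ⟨g, x, hx, rfl⟩ := mem_iUnion.1 (hsub hy)
    have := hball hx
    rw [mem_ball_zero_iff] at this ⊢
    rwa [LinearIsometryEquiv.norm_map]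
  · intro y hy
    obtain ⟨g, x, hx, rfl⟩ := mem_iUnion.1 (hsub hy)
    refine ⟨g, g.2, ?_⟩
    rw [Orth.inv_apply_apply]
    exact hΩ hx

end OrbitCutoff

end Variations

/-! ### First variation of the energy -/

section Minimality

variable {n : ℕ} {G : Subgroup (Orth n)} {F Ω : Set (Eucl n)} {R M K : ℝ} {b : Eucl n}
  {W : Eucl n → ℝ} {u w : Eucl n → Eucl n} {σ : Eucl n → ℝ}

/-- The energy density of a differentiable map. -/
noncomputable def energyDensity (W : Eucl n → ℝ) (w : Eucl n → Eucl n) (x : Eucl n) : ℝ :=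
  1 / 2 * ∑ i : Fin n, ‖fderiv ℝ w x (EuclideanSpace.single i 1)‖ ^ 2 + W (w x)

instance isFiniteMeasure_restrict_ball (x : Eucl n) (R : ℝ) :
    IsFiniteMeasure (volume.restrict (Metric.ball x R)) :=
  ⟨by rw [Measure.restrict_apply_univ]; exact measure_ball_lt_top⟩

lemma exists_bound_on_norm_le {X : Type*} [SeminormedAddCommGroup X] {f : Eucl n → X}
    (hf : Continuous f) (K : ℝ) : ∃ C : ℝ, 0 ≤ C ∧ ∀ v : Eucl n, ‖v‖ ≤ K → ‖f v‖ ≤ C := by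
  obtain ⟨C, hC⟩ := (isCompact_closedBall (0 : Eucl n) K).exists_bound_of_continuousOn
    hf.continuousOn
  exact ⟨max C 0, le_max_right _ _, fun v hv =>
    (hC v (mem_closedBall_zero_iff.2 hv)).trans (le_max_left _ _)⟩

lemma integrableOn_comp_of_bounded (hW : Continuous W) (hw : ContinuousOn w (Metric.ball 0 R))
    (hK : ∀ x ∈ Metric.ball (0 : Eucl n) R, ‖w x‖ ≤ K) :
    IntegrableOn (fun x => W (w x)) (Metric.ball 0 R) := by
  obtain ⟨C, -, hC⟩ := exists_bound_on_norm_le hW K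
  refine Integrable.of_bound (C := C)
    ((hW.comp_continuousOn hw).aestronglyMeasurable measurableSet_ball) ?_
  filter_upwards [ae_restrict_mem measurableSet_ball] with x hx using hC _ (hK x hx)

lemma integrableOn_energyDensity (hW : Continuous W) (hw : ContinuousOn w (Metric.ball 0 R))
    (hK : ∀ x ∈ Metric.ball (0 : Eucl n) R, ‖w x‖ ≤ K)
    (hD : MemLp (fderiv ℝ w) 2 (volume.restrict (Metric.ball 0 R))) :
    IntegrableOn (energyDensity W w) (Metric.ball 0 R) := by
  have h1 : ∀ i : Fin n, IntegrableOn
      (fun x => ‖fderiv ℝ w x (EuclideanSpace.single i 1)‖ ^ 2) (Metric.ball 0 R) := by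
    intro i
    have h2 : MemLp (fun x => fderiv ℝ w x (EuclideanSpace.single i 1)) 2
        (volume.restrict (Metric.ball 0 R)) :=
      (ContinuousLinearMap.apply ℝ (Eucl n) (EuclideanSpace.single i (1 : ℝ))).comp_memLp' hD
    exact h2.integrable_norm_pow (p := 2) two_ne_zero
  exact ((integrable_finsetSum _ fun i _ => h1 i).const_mul _).add
    (integrableOn_comp_of_bounded hW hw hK)

lemma energyDensity_nonneg (hW : ∀ v, 0 ≤ W v) (x : Eucl n) : 0 ≤ energyDensity W w x :=
  add_nonneg (mul_nonneg (by norm_num) (Finset.sum_nonneg fun i _ => sq_nonneg _)) (hW _)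

lemma energy_eq_ofReal_integral (hW : ∀ v, 0 ≤ W v) {Dw : Eucl n → Eucl n →L[ℝ] Eucl n}
    (hD : ∀ᵐ x ∂(volume.restrict (Metric.ball (0 : Eucl n) R)), Dw x = fderiv ℝ w x)
    (hint : IntegrableOn (energyDensity W w) (Metric.ball 0 R)) :
    energy W R w Dw = ENNReal.ofReal (∫ x in Metric.ball 0 R, energyDensity W w x) := by
  rw [ofReal_integral_eq_lintegral_ofReal hint
    (Filter.Eventually.of_forall fun x => energyDensity_nonneg hW x)]
  refine lintegral_congr_ae ?_
  filter_upwards [hD] with x hx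
  rw [hx, energyDensity]

lemma fderiv_add_variationTo (hb : IsCompatible G F Ω b)
    (hσ : IsCutoff G Ω R σ) (hu : ContDiffOn ℝ 2 u (Metric.ball 0 R)) {x : Eucl n}
    (hx : x ∈ Metric.ball 0 R) :
    fderiv ℝ (fun y => u y + variationTo G Ω b σ u y) x
      = fderiv ℝ u x + fderiv ℝ (variationTo G Ω b σ u) x :=
  fderiv_fun_add ((hu.contDiffAt (Metric.isOpen_ball.mem_nhds hx)).differentiableAt two_ne_zero)
    ((contDiff_variationTo hb hσ hu).differentiable two_ne_zero x)

lemma norm_add_variationTo_le (hb : IsCompatible G F Ω b)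
    (hσ : IsCutoff G Ω R σ) {x : Eucl n} (hx : ‖u x‖ ≤ M) :
    ‖u x + variationTo G Ω b σ u x‖ ≤ M + ‖b‖ := by
  have e : u x + variationTo G Ω b σ u x
      = (1 - σ x) • u x + σ x • orbitMap G Ω b x := by rw [variationTo]; module
  rw [e]
  have h0 := hσ.nonneg x
  have h1 := hσ.le_one x
  have hm := hb.norm_orbitMap_le x
  calc _ ≤ ‖(1 - σ x) • u x‖ + ‖σ x • orbitMap G Ω b x‖ := norm_add_le _ _
    _ = (1 - σ x) * ‖u x‖ + σ x * ‖orbitMap G Ω b x‖ := by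
      rw [norm_smul, norm_smul, Real.norm_of_nonneg h0, Real.norm_of_nonneg (by linarith)]
    _ ≤ 1 * ‖u x‖ + 1 * ‖orbitMap G Ω b x‖ := by gcongr; linarith
    _ ≤ M + ‖b‖ := by linarith

/-- A minimizer does not decrease its energy under variations towards equivariant maps. -/
lemma IsEnergyMinimizer.integral_le (hW : Continuous W) (hW0 : ∀ v, 0 ≤ W v)
    (hFc : Convex ℝ F) (hmin : IsEnergyMinimizer G F W R u)
    (hu : ContDiffOn ℝ 2 u (Metric.ball 0 R))
    (hM : ∀ x ∈ Metric.ball (0 : Eucl n) R, ‖u x‖ ≤ M)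
    (hb : IsCompatible G F Ω b) (hσ : IsCutoff G Ω R σ) :
    IntegrableOn (energyDensity W u) (Metric.ball 0 R) ∧
    IntegrableOn (energyDensity W fun y => u y + variationTo G Ω b σ u y) (Metric.ball 0 R) ∧
    ∫ x in Metric.ball 0 R, energyDensity W u x
      ≤ ∫ x in Metric.ball 0 R,
        energyDensity W (fun y => u y + variationTo G Ω b σ u y) x := by
  obtain ⟨Du, hadm, hle⟩ := hmin
  have hadm' := isAdmissible_add_variationTo hFc hb hσ hu hadm
  have hDu := hadm.sobolev.ae_eq_fderiv (hu.of_le one_le_two)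
  have hDw : ∀ᵐ x ∂(volume.restrict (Metric.ball (0 : Eucl n) R)),
      Du x + fderiv ℝ (variationTo G Ω b σ u) x
        = fderiv ℝ (fun y => u y + variationTo G Ω b σ u y) x := by
    filter_upwards [hDu, ae_restrict_mem measurableSet_ball] with x hx hxB
    rw [fderiv_add_variationTo hb hσ hu hxB, hx]
  have h1 : IntegrableOn (energyDensity W u) (Metric.ball 0 R) :=
    integrableOn_energyDensity hW hu.continuousOn hM
      ((memLp_congr_ae hDu).1 hadm.sobolev.memLp_deriv)
  have h2 : IntegrableOn (energyDensity W fun y => u y + variationTo G Ω b σ u y)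
      (Metric.ball 0 R) :=
    integrableOn_energyDensity hW
      (hu.continuousOn.add (contDiff_variationTo hb hσ hu).continuous.continuousOn)
      (fun x hx => norm_add_variationTo_le hb hσ (hM x hx))
      ((memLp_congr_ae hDw).1 hadm'.sobolev.memLp_deriv)
  refine ⟨h1, h2, ?_⟩
  have h3 := hle _ _ hadm'
  rw [energy_eq_ofReal_integral hW0 hDu h1, energy_eq_ofReal_integral hW0 hDw h2,
    ENNReal.ofReal_le_ofReal_iff (integral_nonneg fun x => energyDensity_nonneg hW0 x)] at h3
  exact h3

/-- Only `t ∈ [0, 1]` is available, since `tσ` must remain a cutoff; hence a sign for the derivative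
instead of its vanishing. -/
lemma HasDerivAt.nonneg_of_forall_le {h : ℝ → ℝ} {h' : ℝ} (hd : HasDerivAt h h' 0)
    (hle : ∀ t, 0 ≤ t → t ≤ 1 → h 0 ≤ h t) : 0 ≤ h' := by
  have h1 : Filter.Tendsto (slope h 0) (nhdsWithin 0 (Ioi 0)) (nhds h') :=
    (hasDerivAt_iff_tendsto_slope.1 hd).mono_left
      (nhdsWithin_mono _ fun x hx => (ne_of_gt hx))
  refine ge_of_tendsto h1 ?_
  filter_upwards [Ioo_mem_nhdsGT (zero_lt_one' ℝ)] with t ht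
  rw [slope_def_field]
  exact div_nonneg (sub_nonneg.2 (hle t ht.1.le ht.2.le)) (by linarith [ht.1])

lemma variationTo_const_mul (t : ℝ) :
    variationTo G Ω b (fun y => t * σ y) u = fun y => t • variationTo G Ω b σ u y := by
  ext1 y; rw [variationTo, variationTo, smul_smul]

/-- The potential part of the first variation. -/
lemma hasDerivAt_integral_potential (hW : ContDiff ℝ 1 W) {z : Eucl n → Eucl n}
    (hu : ContinuousOn u (Metric.ball 0 R))
    (hM : ∀ x ∈ Metric.ball (0 : Eucl n) R, ‖u x‖ ≤ M)
    (hz : Continuous z) (hzc : HasCompactSupport z) :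
    IntegrableOn (fun x => fderiv ℝ W (u x) (z x)) (Metric.ball 0 R) ∧
    HasDerivAt (fun t : ℝ => ∫ x in Metric.ball 0 R, W (u x + t • z x))
      (∫ x in Metric.ball 0 R, fderiv ℝ W (u x) (z x)) 0 := by
  obtain ⟨Cz, hCz⟩ := hzc.exists_bound_of_continuous hz
  have hdW : Continuous (fderiv ℝ W) := hW.continuous_fderiv one_ne_zero
  obtain ⟨C, hC0, hC⟩ := exists_bound_on_norm_le hdW (M + Cz)
  have hCz0 : 0 ≤ Cz := (norm_nonneg _).trans (hCz 0)
  have hcont : ∀ t : ℝ, ContinuousOn (fun x => u x + t • z x) (Metric.ball 0 R) := fun t =>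
    hu.add (hz.const_smul t).continuousOn
  have key := hasDerivAt_integral_of_dominated_loc_of_deriv_le (𝕜 := ℝ) (E := ℝ)
    (μ := volume.restrict (Metric.ball (0 : Eucl n) R)) (x₀ := 0) (s := Metric.ball 0 1)
    (F := fun t x => W (u x + t • z x)) (F' := fun t x => fderiv ℝ W (u x + t • z x) (z x))
    (bound := fun _ => C * Cz) (Metric.ball_mem_nhds _ one_pos)
    (Filter.Eventually.of_forall fun t =>
      (hW.continuous.comp_continuousOn (hcont t)).aestronglyMeasurable measurableSet_ball)
    (by simpa [IntegrableOn] using integrableOn_comp_of_bounded hW.continuous hu hM)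
    (((hdW.comp_continuousOn (hcont 0)).clm_apply hz.continuousOn).aestronglyMeasurable
      measurableSet_ball) ?_ (integrable_const _) ?_
  · simpa [IntegrableOn] using key
  · filter_upwards [ae_restrict_mem measurableSet_ball] with x hx t ht
    refine (ContinuousLinearMap.le_opNorm _ _).trans
      (mul_le_mul (hC _ ?_) (hCz x) (norm_nonneg _) hC0)
    have ht1 : ‖t‖ ≤ 1 := (mem_ball_zero_iff.1 ht).le
    calc ‖u x + t • z x‖ ≤ ‖u x‖ + ‖t‖ * ‖z x‖ := by
          rw [← norm_smul]; exact norm_add_le _ _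
      _ ≤ M + 1 * Cz := add_le_add (hM x hx) (mul_le_mul ht1 (hCz x) (norm_nonneg _) zero_le_one)
      _ = M + Cz := by ring
  · refine Filter.Eventually.of_forall fun x t _ => ?_
    have h1 : HasDerivAt (fun t : ℝ => u x + t • z x) (z x) t := by
      simpa using ((hasDerivAt_id t).smul_const (z x)).const_add (u x)
    exact ((hW.differentiable one_ne_zero _).hasFDerivAt.comp_hasDerivAt t h1)

lemma continuousOn_laplacianAt {U : Set (Eucl n)} (hU : IsOpen U) {X : Type*}
    [NormedAddCommGroup X] [NormedSpace ℝ X] {f : Eucl n → X} (hf : ContDiffOn ℝ 2 f U) :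
    ContinuousOn (laplacianAt f) U := by
  have h2 : ContinuousOn (fderiv ℝ (fderiv ℝ f)) U :=
    (hf.fderiv_of_isOpen hU (m := 1) (by norm_num)).continuousOn_fderiv_of_isOpen hU le_rfl
  exact continuousOn_finsetSum _ fun i _ =>
    (h2.clm_apply continuousOn_const).clm_apply continuousOn_const

lemma continuous_gradient (hW : ContDiff ℝ 1 W) : Continuous (gradient W) :=
  (InnerProductSpace.toDual ℝ (Eucl n)).symm.continuous.comp (hW.continuous_fderiv one_ne_zero)

lemma energyDensity_add_smul {z : Eucl n → Eucl n} {x : Eucl n} (hu : DifferentiableAt ℝ u x)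
    (hz : DifferentiableAt ℝ z x) (t : ℝ) :
    energyDensity W (fun y => u y + t • z y) x
      = energyDensity W u x + (t * (∑ i : Fin n, ⟪fderiv ℝ u x (EuclideanSpace.single i 1),
          fderiv ℝ z x (EuclideanSpace.single i 1)⟫)
        + (1 / 2 * t ^ 2 * (∑ i : Fin n, ‖fderiv ℝ z x (EuclideanSpace.single i 1)‖ ^ 2)
        + (W (u x + t • z x) - W (u x)))) := by
  have hd : fderiv ℝ (fun y => u y + t • z y) x = fderiv ℝ u x + t • fderiv ℝ z x := by
    rw [fderiv_fun_add hu (hz.fun_const_smul t), fderiv_fun_const_smul hz]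
  have hs : ∑ i : Fin n, ‖fderiv ℝ (fun y => u y + t • z y) x (EuclideanSpace.single i 1)‖ ^ 2
      = ∑ i : Fin n, ‖fderiv ℝ u x (EuclideanSpace.single i 1)‖ ^ 2
        + 2 * t * (∑ i : Fin n, ⟪fderiv ℝ u x (EuclideanSpace.single i 1),
          fderiv ℝ z x (EuclideanSpace.single i 1)⟫)
        + t ^ 2 * (∑ i : Fin n, ‖fderiv ℝ z x (EuclideanSpace.single i 1)‖ ^ 2) := by
    rw [Finset.mul_sum, Finset.mul_sum, ← Finset.sum_add_distrib, ← Finset.sum_add_distrib]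
    refine Finset.sum_congr rfl fun i _ => ?_
    rw [hd, add_apply, smul_apply, norm_add_sq_real,
      inner_smul_right, norm_smul, mul_pow, Real.norm_eq_abs, sq_abs]
    ring
  rw [energyDensity, energyDensity, hs]
  ring

/-- The first variation of the energy towards equivariant maps is nonnegative. -/
lemma IsEnergyMinimizer.integral_inner_le (hW : ContDiff ℝ 2 W) (hW0 : ∀ v, 0 ≤ W v)
    (hFc : Convex ℝ F) (hmin : IsEnergyMinimizer G F W R u)
    (hu : ContDiffOn ℝ 2 u (Metric.ball 0 R))
    (hM : ∀ x ∈ Metric.ball (0 : Eucl n) R, ‖u x‖ ≤ M)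
    (hb : IsCompatible G F Ω b) (hσ : IsCutoff G Ω R σ) :
    ∫ x, ⟪laplacianAt u x - gradient W (u x), variationTo G Ω b σ u x⟫ ≤ 0 := by
  set B := Metric.ball (0 : Eucl n) R with hB
  set z := variationTo G Ω b σ u with hz
  set e : Fin n → Eucl n := fun i => EuclideanSpace.single i 1 with he
  have hz2 : ContDiff ℝ 2 z := contDiff_variationTo hb hσ hu
  have hz1 : ContDiff ℝ 1 z := hz2.of_le one_le_two
  have hzc : HasCompactSupport z := hasCompactSupport_variationTo hσ
  have hzB : tsupport z ⊆ B := tsupport_variationTo_subset.trans hσ.support_ball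
  have hW1 : ContDiff ℝ 1 W := hW.of_le one_le_two
  obtain ⟨hint, hder⟩ := hasDerivAt_integral_potential hW1 hu.continuousOn hM hz1.continuous hzc
  have hdu : ∀ i, ContinuousOn (fun y => fderiv ℝ u y (e i)) B := fun i =>
    (hu.continuousOn_fderiv_of_isOpen Metric.isOpen_ball one_le_two).clm_apply continuousOn_const
  have hdz : ∀ i, Continuous (fun y => fderiv ℝ z y (e i)) := fun i =>
    (hz1.continuous_fderiv one_ne_zero).clm_apply continuous_const
  have int1 : ∀ i, Integrable fun y => ⟪fderiv ℝ u y (e i), fderiv ℝ z y (e i)⟫ := fun i =>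
    integrable_bilinear_of_tsupport_subset (innerSL ℝ (E := Eucl n)) Metric.isOpen_ball
      (hdu i) (hdz i) (hzc.fderiv_apply ℝ (e i))
      ((tsupport_fderiv_apply_subset ℝ (e i)).trans hzB)
  have int2 : ∀ i, Integrable fun y => ‖fderiv ℝ z y (e i)‖ ^ 2 := by
    intro i
    have hc : HasCompactSupport fun y => ‖fderiv ℝ z y (e i)‖ ^ 2 := by
      refine (hzc.fderiv_apply ℝ (e i)).mono fun y hy h0 => hy ?_
      simp [h0]
    have hcont : Continuous fun y => ‖fderiv ℝ z y (e i)‖ ^ 2 := (hdz i).norm.pow 2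
    exact hcont.integrable_of_hasCompactSupport hc
  have int1s : Integrable fun y => ∑ i, ⟪fderiv ℝ u y (e i), fderiv ℝ z y (e i)⟫ :=
    integrable_finsetSum _ fun i _ => int1 i
  have int2s : Integrable fun y => ∑ i, ‖fderiv ℝ z y (e i)‖ ^ 2 :=
    integrable_finsetSum _ fun i _ => int2 i
  have intW : IntegrableOn (fun x => W (u x)) B :=
    integrableOn_comp_of_bounded hW.continuous hu.continuousOn hM
  set A := ∫ x in B, ∑ i, ⟪fderiv ℝ u x (e i), fderiv ℝ z x (e i)⟫ with hA
  set A2 := ∫ x in B, ∑ i, ‖fderiv ℝ z x (e i)‖ ^ 2 with hA2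
  -- Minimality against the cutoff `tσ`, with the Dirichlet energy of `u` cancelled. The left side
  -- is the right side at `t = 0`, written out to match the derivative lemma.
  have hexp : ∀ t : ℝ, 0 ≤ t → t ≤ 1 →
      0 * A + 1 / 2 * (0 : ℝ) ^ 2 * A2 + ∫ x in B, W (u x + (0 : ℝ) • z x)
        ≤ t * A + 1 / 2 * t ^ 2 * A2 + ∫ x in B, W (u x + t • z x) := by
    intro t ht0 ht1
    obtain ⟨i1, i2, hle⟩ := hmin.integral_le hW.continuous hW0 hFc hu hM hb
      (hσ.const_mul ht0 ht1)
    rw [variationTo_const_mul, ← hz] at hle i2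
    have intWt : IntegrableOn (fun x => W (u x + t • z x)) B :=
      integrableOn_comp_of_bounded (K := M + ‖b‖) hW.continuous
        (hu.continuousOn.add (hz1.continuous.const_smul t).continuousOn) (fun x hx => by
          have := norm_add_variationTo_le hb (hσ.const_mul ht0 ht1) (hM x hx)
          rwa [variationTo_const_mul] at this)
    have hpt : ∀ x ∈ B, energyDensity W (fun y => u y + t • z y) x
        = energyDensity W u x + (t * (∑ i, ⟪fderiv ℝ u x (e i), fderiv ℝ z x (e i)⟫)
          + (1 / 2 * t ^ 2 * (∑ i, ‖fderiv ℝ z x (e i)‖ ^ 2)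
          + (W (u x + t • z x) - W (u x)))) := fun x hx =>
      energyDensity_add_smul
        ((hu.contDiffAt (Metric.isOpen_ball.mem_nhds hx)).differentiableAt two_ne_zero)
        (hz1.differentiable one_ne_zero x) t
    have hsum : ∫ x in B, energyDensity W (fun y => u y + t • z y) x
        = (∫ x in B, energyDensity W u x) + (t * A + (1 / 2 * t ^ 2 * A2
          + ((∫ x in B, W (u x + t • z x)) - ∫ x in B, W (u x)))) := by
      rw [setIntegral_congr_fun measurableSet_ball hpt]
      have j1 := int1s.integrableOn (s := B) |>.const_mul t
      have j2 := int2s.integrableOn (s := B) |>.const_mul (1 / 2 * t ^ 2)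
      have j3 : IntegrableOn (fun x => W (u x + t • z x) - W (u x)) B := intWt.sub intW
      have j23 : IntegrableOn (fun x => 1 / 2 * t ^ 2 * (∑ i, ‖fderiv ℝ z x (e i)‖ ^ 2)
        + (W (u x + t • z x) - W (u x))) B := j2.add j3
      have j123 : IntegrableOn (fun x => t * (∑ i, ⟪fderiv ℝ u x (e i), fderiv ℝ z x (e i)⟫)
        + (1 / 2 * t ^ 2 * (∑ i, ‖fderiv ℝ z x (e i)‖ ^ 2)
        + (W (u x + t • z x) - W (u x)))) B := j1.add j23
      rw [integral_add i1 j123, integral_add j1 j23,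
        integral_add j2 j3, integral_const_mul, integral_const_mul, integral_sub intWt intW]
    rw [hsum] at hle
    simp only [zero_smul, add_zero]
    linarith
  have hd : HasDerivAt (fun t : ℝ => t * A + 1 / 2 * t ^ 2 * A2 + ∫ x in B, W (u x + t • z x))
      (A + ∫ x in B, fderiv ℝ W (u x) (z x)) 0 := by
    have h1 : HasDerivAt (fun t : ℝ => t * A + 1 / 2 * t ^ 2 * A2) A 0 := by
      have := ((hasDerivAt_id' (0 : ℝ)).mul_const A).fun_add
        ((((hasDerivAt_id' (0 : ℝ)).fun_pow 2).const_mul (1 / 2)).mul_const A2)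
      simpa using this
    exact h1.add hder
  have hnn := hd.nonneg_of_forall_le hexp
  have hAeq : A = - ∫ y, ⟪laplacianAt u y, z y⟫ := by
    rw [← integral_sum_inner_fderiv Metric.isOpen_ball hu hz1 hzc hzB, hA,
      setIntegral_eq_integral_of_forall_compl_eq_zero]
    intro x hx
    rw [fderiv_of_notMem_tsupport (𝕜 := ℝ) (f := z) (fun h => hx (hzB h))]
    simp
  have hWeq : ∫ x in B, fderiv ℝ W (u x) (z x) = ∫ x, ⟪gradient W (u x), z x⟫ := by
    rw [setIntegral_eq_integral_of_forall_compl_eq_zero]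
    · simp only [inner_gradient_left]
    · intro x hx
      rw [image_eq_zero_of_notMem_tsupport fun h => hx (hzB h), map_zero]
  have hlapc : ContinuousOn (laplacianAt u) B := continuousOn_laplacianAt Metric.isOpen_ball hu
  have hgradc : ContinuousOn (fun x => gradient W (u x)) B :=
    (continuous_gradient hW1).comp_continuousOn hu.continuousOn
  have k1 : Integrable fun y => ⟪laplacianAt u y, z y⟫ :=
    integrable_bilinear_of_tsupport_subset (innerSL ℝ (E := Eucl n)) Metric.isOpen_ball
      hlapc hz1.continuous hzc hzB
  have k2 : Integrable fun y => ⟪gradient W (u y), z y⟫ :=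
    integrable_bilinear_of_tsupport_subset (innerSL ℝ (E := Eucl n)) Metric.isOpen_ball
      hgradc hz1.continuous hzc hzB
  simp only [inner_sub_left]
  rw [integral_sub k1 k2, ← hWeq]
  rw [hAeq] at hnn
  linarith

end Minimality

/-! ### The Euler-Lagrange equation under the positivity constraint -/

section EulerLagrange

variable {n : ℕ} {G : Subgroup (Orth n)} {F : Set (Eucl n)} {R M : ℝ}
  {W : Eucl n → ℝ} {u : Eucl n → Eucl n}

lemma isOpen_image_orth {Ω : Set (Eucl n)} (hΩ : IsOpen Ω) (g : Orth n) : IsOpen (g '' Ω) :=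
  g.toHomeomorph.isOpenMap _ hΩ

lemma orth_mem_ball {x : Eucl n} (g : Orth n) (hx : x ∈ Metric.ball (0 : Eucl n) R) :
    g x ∈ Metric.ball (0 : Eucl n) R := by
  rw [mem_ball_zero_iff] at hx ⊢
  rwa [LinearIsometryEquiv.norm_map]

/-- The open set `g F` meets the closure of `F`, hence meets `F` itself. -/
lemma IsFundamentalRegion.eq_one_of_mem_closure (hF : IsFundamentalRegion G F) {g : Orth n}
    (hg : g ∈ G) {x : Eucl n} (hx : x ∈ F) (hgx : g x ∈ closure F) : g = 1 := by
  obtain ⟨_, ⟨z, hz, rfl⟩, hzF⟩ := _root_.mem_closure_iff.1 hgx _ (isOpen_image_orth hF.isOpen g)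
    ⟨x, hx, rfl⟩
  exact hF.eq_one hg hz hzF

lemma IsFundamentalRegion.isCompatible_self (hF : IsFundamentalRegion G F) {v : Eucl n}
    (hv : v ∈ closure F) : IsCompatible G F F v where
  isOpen := hF.isOpen
  fixes := by
    intro g hg y hy hgy
    rw [hF.eq_one hg hy hgy]; rfl
  positive := by
    intro g hg y hy hgy
    rw [hF.eq_one_of_mem_closure hg hy hgy]; exact hv

lemma IsAdmissible.apply_map {Du : Eucl n → Eucl n →L[ℝ] Eucl n} (h : IsAdmissible G F R u Du)
    (hu : ContinuousOn u (Metric.ball 0 R)) {g : Orth n} (hg : g ∈ G) {x : Eucl n}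
    (hx : x ∈ Metric.ball (0 : Eucl n) R) : u (g x) = g (u x) := by
  refine Measure.eqOn_open_of_ae_eq (h.equivariant g hg) Metric.isOpen_ball ?_ ?_ hx
  · exact hu.comp g.continuous.continuousOn fun x hx => orth_mem_ball g hx
  · exact g.continuous.comp_continuousOn hu

/-- By continuity the bad points in the open set `F ∩ B` form an open null set, which is empty; the
closure follows by continuity. -/
lemma IsAdmissible.mem_closure {Du : Eucl n → Eucl n →L[ℝ] Eucl n}
    (h : IsAdmissible G F R u Du) (hF : IsOpen F)
    (hu : ContinuousOn u (Metric.ball 0 R)) {x : Eucl n}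
    (hxF : x ∈ closure F) (hx : x ∈ Metric.ball (0 : Eucl n) R) : u x ∈ closure F := by
  set B := Metric.ball (0 : Eucl n) R with hB
  have hBo : IsOpen B := Metric.isOpen_ball
  have hint : ∀ y ∈ F ∩ B, u y ∈ closure F := by
    have hopen : IsOpen ((F ∩ B) ∩ u ⁻¹' (closure F)ᶜ) :=
      (hu.mono inter_subset_right).isOpen_inter_preimage (hF.inter hBo)
        isClosed_closure.isOpen_compl
    have hpos := h.positive
    rw [ae_restrict_iff' (isClosed_closure.measurableSet.inter hBo.measurableSet)] at hpos
    have hnull : volume ((F ∩ B) ∩ u ⁻¹' (closure F)ᶜ) = 0 := by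
      refine measure_mono_null ?_ hpos
      intro y hy hcon
      exact hy.2 (hcon ⟨subset_closure hy.1.1, hy.1.2⟩)
    have hempty := hopen.eq_empty_of_measure_zero hnull
    intro y hy
    by_contra hcon
    exact (Set.eq_empty_iff_forall_notMem.1 hempty y) ⟨hy, hcon⟩
  have hcl : x ∈ closure (F ∩ B) := by
    rw [_root_.mem_closure_iff]
    intro o ho hxo
    obtain ⟨z, hz, hzF⟩ := _root_.mem_closure_iff.1 hxF _ (ho.inter hBo) ⟨hxo, hx⟩
    exact ⟨z, hz.1, hzF, hz.2⟩
  have h1 := ContinuousWithinAt.mem_closure_image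
    ((hu.continuousAt (hBo.mem_nhds hx)).continuousWithinAt (s := F ∩ B)) hcl
  exact closure_minimal (by rintro _ ⟨y, hy, rfl⟩; exact hint y hy) isClosed_closure h1

lemma fderiv_equivariant {X : Type*} [NormedAddCommGroup X] [NormedSpace ℝ X]
    {U : Set (Eucl n)} (hU : IsOpen U) {f : Eucl n → X} (g : Orth n) (A : X →L[ℝ] X)
    (hf : DifferentiableOn ℝ f U) (hgU : ∀ x ∈ U, g x ∈ U)
    (heq : ∀ x ∈ U, f (g x) = A (f x)) {x : Eucl n} (hx : x ∈ U) (v : Eucl n) :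
    fderiv ℝ f (g x) (g v) = A (fderiv ℝ f x v) := by
  have h1 : (fun y => f (g y)) =ᶠ[nhds x] fun y => A (f y) := by
    filter_upwards [hU.mem_nhds hx] with y hy using heq y hy
  have hx' : DifferentiableAt ℝ f x := hf.differentiableAt (hU.mem_nhds hx)
  have hgx : DifferentiableAt ℝ f (g x) := hf.differentiableAt (hU.mem_nhds (hgU x hx))
  have h2 := h1.fderiv_eq (𝕜 := ℝ)
  have h3 : HasFDerivAt (fun y => f (g y))
      ((fderiv ℝ f (g x)).comp (g.toContinuousLinearEquiv : Eucl n →L[ℝ] Eucl n)) x :=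
    hgx.hasFDerivAt.comp x g.toContinuousLinearEquiv.hasFDerivAt
  have h4 : HasFDerivAt (fun y => A (f y)) (A.comp (fderiv ℝ f x)) x :=
    A.hasFDerivAt.comp x hx'.hasFDerivAt
  rw [h3.fderiv, h4.fderiv] at h2
  exact DFunLike.congr_fun h2 v

lemma laplacianAt_equivariant {U : Set (Eucl n)} (hU : IsOpen U)
    (hu : ContDiffOn ℝ 2 u U) (g : Orth n) (hgU : ∀ x ∈ U, g x ∈ U)
    (heq : ∀ x ∈ U, u (g x) = g (u x)) {x : Eucl n} (hx : x ∈ U) :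
    laplacianAt u (g x) = g (laplacianAt u x) := by
  set e : Fin n → Eucl n := fun i => EuclideanSpace.single i 1 with he
  rw [laplacianAt_eq_sum ((EuclideanSpace.basisFun (Fin n) ℝ).map g), laplacianAt, map_sum]
  refine Finset.sum_congr rfl fun i _ => ?_
  have hd : ContDiffOn ℝ 1 (fderiv ℝ u) U := hu.fderiv_of_isOpen hU (by norm_num)
  have hfirst : ∀ y ∈ U, fderiv ℝ u (g y) (g (e i)) = g (fderiv ℝ u y (e i)) := fun y hy =>
    fderiv_equivariant hU g (g.toContinuousLinearEquiv : Eucl n →L[ℝ] Eucl n)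
      (hu.differentiableOn two_ne_zero) hgU heq hy (e i)
  have hx2 : ContDiffAt ℝ 2 u x := hu.contDiffAt (hU.mem_nhds hx)
  have hgx2 : ContDiffAt ℝ 2 u (g x) := hu.contDiffAt (hU.mem_nhds (hgU x hx))
  have hk : (fun y => fderiv ℝ u (g y) (g (e i))) =ᶠ[nhds x]
      fun y => g (fderiv ℝ u y (e i)) := by
    filter_upwards [hU.mem_nhds hx] with y hy using hfirst y hy
  have h2 := hk.fderiv_eq (𝕜 := ℝ)
  have hdx : DifferentiableAt ℝ (fun y => fderiv ℝ u y (e i)) x :=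
    ((hd.contDiffAt (hU.mem_nhds hx)).differentiableAt one_ne_zero).clm_apply
      (differentiableAt_const _)
  have hdgx : DifferentiableAt ℝ (fun y => fderiv ℝ u y (g (e i))) (g x) :=
    ((hd.contDiffAt (hU.mem_nhds (hgU x hx))).differentiableAt one_ne_zero).clm_apply
      (differentiableAt_const _)
  have h3 : HasFDerivAt (fun y => fderiv ℝ u (g y) (g (e i)))
      ((fderiv ℝ (fun y => fderiv ℝ u y (g (e i))) (g x)).comp
        (g.toContinuousLinearEquiv : Eucl n →L[ℝ] Eucl n)) x :=
    hdgx.hasFDerivAt.comp x g.toContinuousLinearEquiv.hasFDerivAt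
  have h4 : HasFDerivAt (fun y => g (fderiv ℝ u y (e i)))
      ((g.toContinuousLinearEquiv : Eucl n →L[ℝ] Eucl n).comp
        (fderiv ℝ (fun y => fderiv ℝ u y (e i)) x)) x :=
    g.toContinuousLinearEquiv.hasFDerivAt.comp x hdx.hasFDerivAt
  rw [h3.fderiv, h4.fderiv] at h2
  have h5 := DFunLike.congr_fun h2 (e i)
  change fderiv ℝ (fun y => fderiv ℝ u y (g (e i))) (g x) (g (e i))
    = g (fderiv ℝ (fun y => fderiv ℝ u y (e i)) x (e i)) at h5
  rw [fderiv_fderiv_apply hgx2, fderiv_fderiv_apply hx2] at h5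
  simpa [he] using h5

lemma gradient_equivariant (hW : Differentiable ℝ W) (g : Orth n)
    (hg : ∀ v, W (g v) = W v) (v : Eucl n) : gradient W (g v) = g (gradient W v) := by
  refine ext_inner_right ℝ fun w => ?_
  obtain ⟨w', rfl⟩ := g.surjective w
  rw [g.inner_map_map, inner_gradient_left, inner_gradient_left]
  exact fderiv_equivariant isOpen_univ g (ContinuousLinearMap.id ℝ ℝ) hW.differentiableOn
    (fun _ _ => trivial) (fun v _ => hg v) (mem_univ v) w'

lemma hasDerivAt_line {X : Type*} [NormedAddCommGroup X] [NormedSpace ℝ X] {f : Eucl n → X}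
    {x e : Eucl n} {t : ℝ} (hf : DifferentiableAt ℝ f (x + t • e)) :
    HasDerivAt (fun t : ℝ => f (x + t • e)) (fderiv ℝ f (x + t • e) e) t := by
  have h1 : HasDerivAt (fun t : ℝ => x + t • e) e t := by
    simpa using ((hasDerivAt_id t).smul_const e).const_add x
  exact hf.hasFDerivAt.comp_hasDerivAt t h1

lemma deriv_line_eventuallyEq {h : Eucl n → ℝ} {x : Eucl n} (hh : ContDiffAt ℝ 2 h x)
    (e : Eucl n) :
    deriv (fun t : ℝ => h (x + t • e)) =ᶠ[nhds 0] fun t => fderiv ℝ h (x + t • e) e := by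
  have h1 : ∀ᶠ y in nhds x, DifferentiableAt ℝ h y :=
    (hh.eventually (by simp)).mono fun y hy => hy.differentiableAt two_ne_zero
  have h2 : Filter.Tendsto (fun t : ℝ => x + t • e) (nhds 0) (nhds x) := by
    have : Filter.Tendsto (fun t : ℝ => x + t • e) (nhds 0) (nhds (x + (0 : ℝ) • e)) :=
      Continuous.tendsto (by fun_prop) 0
    simpa using this
  filter_upwards [h2.eventually h1] with t ht using (hasDerivAt_line ht).deriv

lemma deriv_deriv_line {h : Eucl n → ℝ} {x : Eucl n} (hh : ContDiffAt ℝ 2 h x)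
    (e : Eucl n) :
    deriv (deriv fun t : ℝ => h (x + t • e)) 0 = fderiv ℝ (fderiv ℝ h) x e e := by
  rw [(deriv_line_eventuallyEq hh e).deriv_eq]
  have h1 : DifferentiableAt ℝ (fderiv ℝ h) (x + (0 : ℝ) • e) := by
    rw [zero_smul, add_zero]
    exact (hh.fderiv_right (m := 1) (by norm_num)).differentiableAt one_ne_zero
  have h2 := (hasDerivAt_line h1).clm_apply (hasDerivAt_const (0 : ℝ) e)
  rw [h2.deriv]
  simp

/-- If the second derivative along a line were positive, the point would also be a local minimum on
that line; the restriction would be locally constant and its second derivative zero. -/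
lemma fderiv_fderiv_nonpos_of_isLocalMax {h : Eucl n → ℝ} {x : Eucl n}
    (hh : ContDiffAt ℝ 2 h x) (hmax : IsLocalMax h x) (e : Eucl n) :
    fderiv ℝ (fderiv ℝ h) x e e ≤ 0 := by
  rw [← deriv_deriv_line hh e]
  by_contra hcon
  push Not at hcon
  set k : ℝ → ℝ := fun t => h (x + t • e) with hk
  have h2 : Filter.Tendsto (fun t : ℝ => x + t • e) (nhds 0) (nhds x) := by
    have : Filter.Tendsto (fun t : ℝ => x + t • e) (nhds 0) (nhds (x + (0 : ℝ) • e)) :=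
      Continuous.tendsto (by fun_prop) 0
    simpa using this
  have hkmax : ∀ᶠ t in nhds 0, k t ≤ k 0 := by
    filter_upwards [h2.eventually hmax] with t ht
    simpa [hk] using ht
  have hd0 : deriv k 0 = 0 := IsLocalMax.deriv_eq_zero hkmax
  have hcont : ContinuousAt k 0 := by
    have : DifferentiableAt ℝ h (x + (0 : ℝ) • e) := by
      rw [zero_smul, add_zero]; exact hh.differentiableAt two_ne_zero
    exact (hasDerivAt_line this).continuousAt
  have hkmin := isLocalMin_of_deriv_deriv_pos hcon hd0 hcont
  have hconst : k =ᶠ[nhds 0] fun _ => k 0 := by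
    filter_upwards [hkmax, hkmin] with t h1 h2 using le_antisymm h1 h2
  have h3 : deriv (deriv k) 0 = 0 := by
    rw [hconst.deriv.deriv_eq]; simp
  exact hcon.ne' h3

lemma laplacianAt_inner {x : Eucl n} (hu : ContDiffAt ℝ 2 u x) (c : Eucl n) :
    laplacianAt (fun y => ⟪c, u y⟫) x = ⟪c, laplacianAt u x⟫ := by
  rw [laplacianAt, laplacianAt, inner_sum]
  refine Finset.sum_congr rfl fun i _ => ?_
  have hc : ContDiffAt ℝ 2 (fun y => ⟪c, u y⟫) x := contDiffAt_const.inner ℝ hu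
  rw [← fderiv_fderiv_apply hc, ← fderiv_fderiv_apply hu]
  have h1 : (fun y => fderiv ℝ (fun y => ⟪c, u y⟫) y (EuclideanSpace.single i 1))
      =ᶠ[nhds x] fun y => ⟪c, fderiv ℝ u y (EuclideanSpace.single i 1)⟫ := by
    filter_upwards [(hu.eventually (by simp))] with y hy
    have := (innerSL ℝ c).hasFDerivAt.comp y (hy.differentiableAt two_ne_zero).hasFDerivAt
    exact congrArg (fun L => L (EuclideanSpace.single i 1)) this.fderiv
  rw [h1.fderiv_eq]
  have hd : DifferentiableAt ℝ (fun y => fderiv ℝ u y (EuclideanSpace.single i 1)) x :=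
    ((hu.fderiv_right (m := 1) (by norm_num)).differentiableAt one_ne_zero).clm_apply
      (differentiableAt_const _)
  have := (innerSL ℝ c).hasFDerivAt.comp x hd.hasFDerivAt
  exact congrArg (fun L => L (EuclideanSpace.single i 1)) this.fderiv

/-- A bounded energy minimizer of class `C²`. -/
structure IsRegularMinimizer (G : Subgroup (Orth n)) (F : Set (Eucl n)) (W : Eucl n → ℝ)
    (R M : ℝ) (u : Eucl n → Eucl n) : Prop where
  isMin : IsEnergyMinimizer G F W R u
  contDiffOn : ContDiffOn ℝ 2 u (Metric.ball 0 R)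
  norm_le : ∀ x ∈ Metric.ball (0 : Eucl n) R, ‖u x‖ ≤ M

lemma IsRegularMinimizer.apply_map (h : IsRegularMinimizer G F W R M u) {g : Orth n}
    (hg : g ∈ G) {x : Eucl n} (hx : x ∈ Metric.ball (0 : Eucl n) R) : u (g x) = g (u x) := by
  obtain ⟨Du, hadm, -⟩ := h.isMin
  exact hadm.apply_map h.contDiffOn.continuousOn hg hx

lemma IsRegularMinimizer.mem_closure (h : IsRegularMinimizer G F W R M u) (hF : IsOpen F)
    {x : Eucl n} (hxF : x ∈ closure F) (hx : x ∈ Metric.ball (0 : Eucl n) R) :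
    u x ∈ closure F := by
  obtain ⟨Du, hadm, -⟩ := h.isMin
  exact hadm.mem_closure hF h.contDiffOn.continuousOn hxF hx

/-- The variational inequality satisfied by a minimizer in the open fundamental region. -/
lemma IsRegularMinimizer.inner_sub_nonpos (hG : Finite G) (hF : IsFundamentalRegion G F)
    (hW : ContDiff ℝ 2 W) (hW0 : ∀ v, 0 ≤ W v) (hWG : ∀ g ∈ G, ∀ v, W (g v) = W v)
    (h : IsRegularMinimizer G F W R M u) {x v : Eucl n} (hxF : x ∈ F)
    (hx : x ∈ Metric.ball (0 : Eucl n) R) (hv : v ∈ closure F) :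
    ⟪laplacianAt u x - gradient W (u x), v - u x⟫ ≤ 0 := by
  by_contra hcon
  push Not at hcon
  have hfin : Fintype G := Fintype.ofFinite G
  set B := Metric.ball (0 : Eucl n) R with hB
  have hBo : IsOpen B := Metric.isOpen_ball
  set f : Eucl n → Eucl n := fun y => laplacianAt u y - gradient W (u y) with hf
  have hfc : ContinuousOn f B := (continuousOn_laplacianAt hBo h.contDiffOn).sub
    ((continuous_gradient (hW.of_le one_le_two)).comp_continuousOn h.contDiffOn.continuousOn)
  have hfg : ∀ g ∈ G, ∀ y ∈ B, f (g y) = g (f y) := by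
    intro g hg y hy
    simp only [hf, map_sub]
    rw [laplacianAt_equivariant hBo h.contDiffOn g (fun x hx => orth_mem_ball g hx)
      (fun x hx => h.apply_map hg hx) hy, h.apply_map hg hy,
      gradient_equivariant (hW.differentiable two_ne_zero) g (hWG g hg)]
  have hev : ∀ᶠ y in nhds x, 0 < ⟪f y, v - u y⟫ ∧ y ∈ F ∩ B := by
    have hc : ContinuousAt (fun y => ⟪f y, v - u y⟫) x :=
      (hfc.continuousAt (hBo.mem_nhds hx)).inner
        (continuousAt_const.sub (h.contDiffOn.continuousOn.continuousAt (hBo.mem_nhds hx)))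
    exact (hc.eventually (lt_mem_nhds hcon)).and ((hF.isOpen.inter hBo).mem_nhds ⟨hxF, hx⟩)
  obtain ⟨δ, hδ, hball⟩ := Metric.eventually_nhds_iff_ball.1 hev
  -- Localize where the strict inequality persists. By equivariance of `f` and `u` the integrand is
  -- nonnegative on all images of this ball, so a positive integral contradicts the first variation.
  let ψ : ContDiffBump x := ⟨δ / 4, δ / 2, by positivity, by linarith⟩
  have hψs : tsupport ψ ⊆ Metric.ball x δ := by
    rw [ψ.tsupport_eq]
    exact Metric.closedBall_subset_ball (by change δ / 2 < δ; linarith)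
  have hσ : IsCutoff G F R (orbitCutoff G ψ) :=
    isCutoff_orbitCutoff ψ.contDiff (fun y => ψ.nonneg) (fun y => ψ.le_one) ψ.hasCompactSupport
      (fun y hy => (hball y (hψs hy)).2.2) (fun y hy => (hball y (hψs hy)).2.1)
  have hb := hF.isCompatible_self hv
  have hle := h.isMin.integral_inner_le hW hW0 hF.convex h.contDiffOn h.norm_le hb hσ
  set z := variationTo G F v (orbitCutoff G ψ) u with hz
  have hzc : HasCompactSupport z := hasCompactSupport_variationTo hσ
  have hzB : tsupport z ⊆ B := tsupport_variationTo_subset.trans hσ.support_ball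
  have hcont : Continuous fun y => ⟪f y, z y⟫ :=
    continuous_bilinear_of_tsupport_subset (innerSL ℝ (E := Eucl n)) hBo hfc
      (contDiff_variationTo hb hσ h.contDiffOn).continuous hzB
  have hcs : HasCompactSupport fun y => ⟪f y, z y⟫ :=
    hasCompactSupport_bilinear (innerSL ℝ (E := Eucl n)) hzc
  have hnn : ∀ y, 0 ≤ ⟪f y, z y⟫ := by
    intro y
    by_cases h0 : orbitCutoff G ψ y = 0
    · simp [hz, variationTo, h0]
    · obtain ⟨g, hg, hgy⟩ := exists_ne_zero_of_orbitCutoff_ne_zero h0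
      obtain ⟨hp, hyF, hyB⟩ := hball _ (hψs (subset_tsupport _ hgy))
      set y' := g⁻¹ y with hy'
      have hyy : y = g y' := (Orth.apply_inv_apply g y).symm
      rw [hz, variationTo, hb.orbitMap_eq hg (y := y) hyF, inner_smul_right]
      refine mul_nonneg (hσ.nonneg y) ?_
      rw [hyy, hfg g hg y' hyB, h.apply_map hg hyB, ← map_sub, g.inner_map_map]
      exact hp.le
  have hx1 : ψ ((1 : Orth n)⁻¹ x) = 1 := by
    rw [inv_one]
    exact ψ.one_of_mem_closedBall (Metric.mem_closedBall_self ψ.rIn_pos.le)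
  have hne : ⟪f x, z x⟫ ≠ 0 := by
    rw [hz, variationTo, orbitCutoff_eq_one G.one_mem hx1,
      hb.orbitMap_eq G.one_mem (y := x) (by rw [inv_one]; exact hxF), one_smul]
    exact hcon.ne'
  have := hcont.integral_pos_of_hasCompactSupport_nonneg_nonzero (μ := volume) hcs hnn hne
  linarith

/-- The Euler-Lagrange equation: the positivity constraint produces no reaction. -/
lemma IsRegularMinimizer.laplacianAt_eq (hG : IsFiniteReflectionGroup G)
    (hF : IsFundamentalRegion G F)
    (hW : ContDiff ℝ 2 W) (hW0 : ∀ v, 0 ≤ W v) (hWG : ∀ g ∈ G, ∀ v, W (g v) = W v)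
    (h : IsRegularMinimizer G F W R M u) {x : Eucl n}
    (hx : x ∈ Metric.ball (0 : Eucl n) R) :
    laplacianAt u x = gradient W (u x) := by
  set B := Metric.ball (0 : Eucl n) R with hB
  have hBo : IsOpen B := Metric.isOpen_ball
  have hint : ∀ y ∈ F ∩ B, laplacianAt u y = gradient W (u y) := by
    rintro y ⟨hyF, hyB⟩
    set f := laplacianAt u y - gradient W (u y) with hf
    have hvi : ∀ v ∈ closure F, ⟪f, v - u y⟫ ≤ 0 := fun v hv =>
      h.inner_sub_nonpos hG.finite hF hW hW0 hWG hyF hyB hv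
    have hp : u y ∈ closure F := h.mem_closure hF.isOpen (subset_closure hyF) hyB
    -- `W` is invariant, so its gradient at `u y` is fixed by the stabilizer of `u y`. Both `u y ±
    -- (δ/2)∇W` are then competitors in the variational inequality.
    have hgrad : ⟪f, gradient W (u y)⟫ = 0 := by
      have hfix : ∀ g ∈ G, g (u y) = u y → g (gradient W (u y)) = gradient W (u y) := by
        intro g hg hgu
        rw [← gradient_equivariant (hW.differentiable two_ne_zero) g (hWG g hg), hgu]
      have hev := hF.eventually_add_smul_mem hG hp hfix
      obtain ⟨δ, hδ, hball⟩ := Metric.eventually_nhds_iff_ball.1 hev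
      have hm : δ / 2 ∈ Metric.ball (0 : ℝ) δ := by
        rw [mem_ball_zero_iff, Real.norm_of_nonneg (by positivity)]; linarith
      have hm' : -(δ / 2) ∈ Metric.ball (0 : ℝ) δ := by
        rw [mem_ball_zero_iff, norm_neg, Real.norm_of_nonneg (by positivity)]; linarith
      have h1 := hvi _ (hball _ hm)
      have h2 := hvi _ (hball _ hm')
      rw [add_sub_cancel_left, inner_smul_right] at h1 h2
      nlinarith
    -- With `f` frozen at `y`, the inequality applied to the values `v = u z` says that `⟪f, u⟫` has
    -- a local maximum at `y`.
    have hlap : ⟪f, laplacianAt u y⟫ ≤ 0 := by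
      have hc2 : ContDiffAt ℝ 2 u y := h.contDiffOn.contDiffAt (hBo.mem_nhds hyB)
      have hmax : IsLocalMax (fun z => ⟪f, u z⟫) y := by
        filter_upwards [(hF.isOpen.inter hBo).mem_nhds ⟨hyF, hyB⟩] with z hz
        have := hvi _ (h.mem_closure hF.isOpen (subset_closure hz.1) hz.2)
        rw [inner_sub_right] at this
        linarith
      rw [← laplacianAt_inner hc2]
      exact Finset.sum_nonpos fun i _ =>
        fderiv_fderiv_nonpos_of_isLocalMax (contDiffAt_const.inner ℝ hc2) hmax _
    have hff : ⟪f, f⟫ ≤ 0 := by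
      nth_rewrite 2 [hf]
      rw [inner_sub_right, hgrad]
      linarith
    exact sub_eq_zero.1 (real_inner_self_nonpos.1 hff)
  -- Continuity of second derivatives extends the equation to the closed region, and equivariance
  -- then carries it across the mirrors.
  have hcl : ∀ y ∈ closure F ∩ B, laplacianAt u y = gradient W (u y) := by
    rintro y ⟨hyF, hyB⟩
    have hycl : y ∈ closure (F ∩ B) := by
      rw [_root_.mem_closure_iff]
      intro o ho hyo
      obtain ⟨z, hz, hzF⟩ := _root_.mem_closure_iff.1 hyF _ (ho.inter hBo) ⟨hyo, hyB⟩
      exact ⟨z, hz.1, hzF, hz.2⟩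
    have hfc : ContinuousAt (fun y => laplacianAt u y - gradient W (u y)) y :=
      ((continuousOn_laplacianAt hBo h.contDiffOn).sub
        ((continuous_gradient (hW.of_le one_le_two)).comp_continuousOn
          h.contDiffOn.continuousOn)).continuousAt (hBo.mem_nhds hyB)
    have h1 := ContinuousWithinAt.mem_closure_image (hfc.continuousWithinAt (s := F ∩ B)) hycl
    have h2 : closure ((fun y => laplacianAt u y - gradient W (u y)) '' (F ∩ B)) ⊆ {0} := by
      refine closure_minimal ?_ isClosed_singleton
      rintro _ ⟨z, hz, rfl⟩
      exact sub_eq_zero.2 (hint z hz)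
    exact sub_eq_zero.1 (h2 h1)
  obtain ⟨g, hg, y, hy, rfl⟩ := hF.exists_mem_image x
  have hyB : y ∈ B := by
    rw [hB, mem_ball_zero_iff] at hx ⊢
    rwa [LinearIsometryEquiv.norm_map] at hx
  rw [laplacianAt_equivariant hBo h.contDiffOn g (fun x hx => orth_mem_ball g hx)
      (fun x hx => h.apply_map hg hx) hyB, h.apply_map hg hyB,
      gradient_equivariant (hW.differentiable two_ne_zero) g (hWG g hg), hcl y ⟨hy, hyB⟩]

end EulerLagrange

/-! ### Energy comparison with the constant minimum -/

section EnergyEstimate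

variable {n : ℕ} {G : Subgroup (Orth n)} {F : Set (Eucl n)} {R M L : ℝ} {a : Eucl n}
  {W : Eucl n → ℝ} {u : Eucl n → Eucl n} {τ : Eucl n → ℝ}

/-- The union of the images of the closure of `F` under the stabilizer of `a`. -/
def stabUnion (G : Subgroup (Orth n)) (F : Set (Eucl n)) (a : Eucl n) : Set (Eucl n) :=
  {y | ∃ k ∈ G, k a = a ∧ k⁻¹ y ∈ closure F}

lemma stabRegion_eq_interior : stabRegion G F a = interior (stabUnion G F a) := by
  rw [stabRegion]
  congr 1
  ext y
  simp only [mem_iUnion, exists_prop, stabUnion, mem_ofPred_eq, mem_image]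
  constructor
  · rintro ⟨g, ⟨hg, hga⟩, x, hx, rfl⟩
    exact ⟨g, hg, hga, by rwa [Orth.inv_apply_apply]⟩
  · rintro ⟨g, hg, hga, hx⟩
    exact ⟨g, ⟨hg, hga⟩, _, hx, Orth.apply_inv_apply g y⟩

lemma stabRegion_subset_stabUnion : stabRegion G F a ⊆ stabUnion G F a := by
  rw [stabRegion_eq_interior]; exact interior_subset

lemma isOpen_stabRegion : IsOpen (stabRegion G F a) := isOpen_interior

lemma inv_apply_eq_self {g : Orth n} (h : g a = a) : g⁻¹ a = a := by
  nth_rewrite 1 [← h]; exact Orth.inv_apply_apply g a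

/-- `D` is covered by chambers `k F̄` with `k a = a`. If `g` maps a point of `D` into `D`, it maps
one such chamber onto another, so `g = l k⁻¹` fixes `a`. If instead `g y` lies in `F̄`, then `g` is
the inverse of some such `k`. -/
lemma IsFundamentalRegion.isCompatible_stabRegion (hF : IsFundamentalRegion G F)
    (ha : a ∈ closure F) : IsCompatible G F (stabRegion G F a) a where
  isOpen := isOpen_stabRegion
  fixes := by
    intro g hg y hy hgy
    obtain ⟨k, hk, hka, hky⟩ := stabRegion_subset_stabUnion hy
    have hopen : IsOpen {z | k z ∈ stabRegion G F a ∧ g (k z) ∈ stabRegion G F a} :=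
      (isOpen_stabRegion.preimage k.continuous).inter
        (isOpen_stabRegion.preimage (g.continuous.comp k.continuous))
    obtain ⟨z, ⟨_, hz2⟩, hzF⟩ := _root_.mem_closure_iff.1 hky _ hopen
      (by
        change k (k⁻¹ y) ∈ _ ∧ g (k (k⁻¹ y)) ∈ _
        rw [Orth.apply_inv_apply]
        exact ⟨hy, hgy⟩)
    obtain ⟨l, hl, hla, hlz⟩ := stabRegion_subset_stabUnion hz2
    have h1 := hF.eq_one_of_mem_closure (g := l⁻¹ * g * k)
      (G.mul_mem (G.mul_mem (G.inv_mem hl) hg) hk) hzF hlz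
    have h2 : g = l * k⁻¹ := by
      calc g = l * (l⁻¹ * g * k) * k⁻¹ := by group
        _ = l * k⁻¹ := by rw [h1, mul_one]
    rw [h2, Orth.mul_apply, inv_apply_eq_self hka, hla]
  positive := by
    intro g hg y hy hgy
    obtain ⟨_, ⟨x, hx, rfl⟩, hzF⟩ := _root_.mem_closure_iff.1 hgy _
      (isOpen_image_orth (isOpen_stabRegion (G := G) (F := F) (a := a)) g) ⟨y, hy, rfl⟩
    obtain ⟨k, hk, hka, hkx⟩ := stabRegion_subset_stabUnion hx
    have h1 := hF.eq_one_of_mem_closure (g := k⁻¹ * g⁻¹)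
      (G.mul_mem (G.inv_mem hk) (G.inv_mem hg)) hzF (by
        rw [Orth.mul_apply, Orth.inv_apply_apply]; exact hkx)
    have h2 : g = k⁻¹ := by
      calc g = (k⁻¹ * g⁻¹)⁻¹ * k⁻¹ := by group
        _ = k⁻¹ := by rw [h1, inv_one, one_mul]
    rw [h2, inv_apply_eq_self hka]
    exact ha

/-- The difference of the two sides is `(1 - t²)‖t x - v‖²`. With `t = τ`, `x = ∂ᵢu` and `v = 2 ∂ᵢτ
(m - u)`, the cost of the cutoff does not involve the derivative of `u`. -/
lemma norm_sq_convex_le {X : Type*} [NormedAddCommGroup X] [InnerProductSpace ℝ X] (x v : X)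
    {t : ℝ} (h0 : 0 ≤ t) (h1 : t ≤ 1) :
    ‖(1 - t ^ 2) • x + t • v‖ ^ 2 ≤ (1 - t ^ 2) * ‖x‖ ^ 2 + ‖v‖ ^ 2 := by
  have h2 : 0 ≤ 1 - t ^ 2 := by nlinarith
  have h3 := mul_nonneg h2 (sq_nonneg ‖t • x - v‖)
  rw [norm_sub_sq_real, norm_smul, real_inner_smul_left, Real.norm_of_nonneg h0] at h3
  rw [norm_add_sq_real, norm_smul, norm_smul, real_inner_smul_left, real_inner_smul_right,
    Real.norm_of_nonneg h0, Real.norm_of_nonneg h2]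
  nlinarith

lemma IsCutoff.fderiv_eq_zero_of_eq_one {Ω : Set (Eucl n)} (hτ : IsCutoff G Ω R τ) {y : Eucl n}
    (h : τ y = 1) : fderiv ℝ τ y = 0 := by
  refine IsLocalMax.fderiv_eq_zero (Filter.Eventually.of_forall fun z => ?_)
  rw [h]; exact hτ.le_one z

/-- Where `τ = 0` nothing changes. Where `τ = 1` the new map is locally valued in the zeros of `W`
up to vanishing derivatives, so at least `W(u)` is gained. In between, the extra gradient term and
the new potential are bounded. -/
lemma energyDensity_variationTo_le {Wmax : ℝ} (hF : IsFundamentalRegion G F)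
    (ha : a ∈ closure F) (hW0 : ∀ v, 0 ≤ W v) (hWG : ∀ g ∈ G, ∀ v, W (g v) = W v)
    (hWa : W a = 0) (hWmax : ∀ v, ‖v‖ ≤ M + ‖a‖ → W v ≤ Wmax)
    (hu : ContDiffOn ℝ 2 u (Metric.ball 0 R))
    (hM : ∀ x ∈ Metric.ball (0 : Eucl n) R, ‖u x‖ ≤ M)
    (hτ : IsCutoff G (stabRegion G F a) R τ) (hL : ∀ y, ‖fderiv ℝ τ y‖ ≤ L)
    {y : Eucl n} (hy : y ∈ Metric.ball (0 : Eucl n) R) :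
    energyDensity W (fun y => u y + variationTo G (stabRegion G F a) a (fun y => τ y ^ 2) u y) y
      ≤ energyDensity W u y
        + {y | 0 < τ y ∧ τ y < 1}.indicator
            (fun _ => 1 / 2 * (n * (2 * L * (M + ‖a‖)) ^ 2) + Wmax) y
        - {y | τ y = 1}.indicator (fun y => W (u y)) y := by
  set D := stabRegion G F a with hD
  have hb := hF.isCompatible_stabRegion ha
  have hσ := hτ.sq
  set z := variationTo G D a (fun y => τ y ^ 2) u with hz
  set e : Fin n → Eucl n := fun i => EuclideanSpace.single i 1 with he
  have hu1 : DifferentiableAt ℝ u y :=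
    (hu.contDiffAt (Metric.isOpen_ball.mem_nhds hy)).differentiableAt two_ne_zero
  have hsum : fderiv ℝ (fun y => u y + z y) y = fderiv ℝ u y + fderiv ℝ z y :=
    fderiv_add_variationTo hb hσ hu hy
  have hUM := hM y hy
  have hM0 : 0 ≤ M := (norm_nonneg _).trans hUM
  have hL0 : 0 ≤ L := (norm_nonneg _).trans (hL y)
  by_cases hys : y ∈ orbitSet G D
  · set m := orbitMap G D a y with hm
    have hzev : z =ᶠ[nhds y] fun x => τ x ^ 2 • (m - u x) := by
      filter_upwards [hb.orbitMap_eventuallyEq hys] with x hx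
      rw [hz, variationTo, hx]
    have hτd : HasFDerivAt τ (fderiv ℝ τ y) y :=
      (hτ.contDiff.differentiable two_ne_zero y).hasFDerivAt
    have hzd : ∀ v, fderiv ℝ z y v
        = τ y • ((2 * fderiv ℝ τ y v) • (m - u y)) - τ y ^ 2 • fderiv ℝ u y v := by
      intro v
      have h1 := (hτd.pow 2).smul (hu1.hasFDerivAt.const_sub m)
      have h2 := h1.fderiv
      have h3 : fderiv ℝ z y = fderiv ℝ (fun x => τ x ^ 2 • (m - u x)) y := hzev.fderiv_eq
      rw [h3]
      have h4 := congrArg (fun L => L v) h2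
      refine Eq.trans h4 ?_
      simp [smul_smul]
      module
    have hpt : ∀ i, ‖fderiv ℝ (fun y => u y + z y) y (e i)‖ ^ 2
        ≤ (1 - τ y ^ 2) * ‖fderiv ℝ u y (e i)‖ ^ 2
          + ‖(2 * fderiv ℝ τ y (e i)) • (m - u y)‖ ^ 2 := by
      intro i
      have : fderiv ℝ (fun y => u y + z y) y (e i) = (1 - τ y ^ 2) • fderiv ℝ u y (e i)
          + τ y • ((2 * fderiv ℝ τ y (e i)) • (m - u y)) := by
        rw [hsum, add_apply, hzd]; module
      rw [this]
      exact norm_sq_convex_le _ _ (hτ.nonneg y) (hτ.le_one y)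
    have hmn : ‖m - u y‖ ≤ M + ‖a‖ := by
      have := hb.norm_orbitMap_le y
      calc ‖m - u y‖ ≤ ‖m‖ + ‖u y‖ := norm_sub_le _ _
        _ ≤ M + ‖a‖ := by linarith
    have hWm : W m = 0 := by
      obtain ⟨k, hk, hky⟩ := hys
      rw [hm, hb.orbitMap_eq hk hky, hWG k hk, hWa]
    have hzy : z y = τ y ^ 2 • (m - u y) := rfl
    rcases (hτ.nonneg y).eq_or_lt with h0 | h0
    · have hW' : W (u y + z y) = W (u y) := by rw [hzy, ← h0]; simp
      have hE : ∀ i, fderiv ℝ (fun y => u y + z y) y (e i) = fderiv ℝ u y (e i) := by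
        intro i
        rw [hsum, add_apply, hzd, ← h0]; simp
      have n1 : y ∉ {y | 0 < τ y ∧ τ y < 1} := fun h => by
        have := h.1; linarith
      have n2 : y ∉ {y | τ y = 1} := fun h => by
        have : τ y = 1 := h
        linarith
      rw [indicator_of_notMem n1, indicator_of_notMem n2, energyDensity, energyDensity, hW']
      change 1 / 2 * ∑ i, ‖fderiv ℝ (fun y => u y + z y) y (e i)‖ ^ 2 + W (u y)
          ≤ 1 / 2 * ∑ i, ‖fderiv ℝ u y (e i)‖ ^ 2 + W (u y) + 0 - 0
      simp only [hE]
      linarith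
    · rcases (hτ.le_one y).eq_or_lt with h1 | h1
      · have n1 : y ∉ {y | 0 < τ y ∧ τ y < 1} := fun h => by
          have := h.2; linarith
        rw [indicator_of_notMem n1, indicator_of_mem (show y ∈ {y | τ y = 1} from h1)]
        have hW' : W (u y + z y) = 0 := by
          rw [hzy, h1, one_pow, one_smul, add_sub_cancel, hWm]
        have hE : ∑ i, ‖fderiv ℝ (fun y => u y + z y) y (e i)‖ ^ 2 ≤ 0 := by
          refine Finset.sum_nonpos fun i _ => (hpt i).trans ?_
          rw [h1, hτ.fderiv_eq_zero_of_eq_one h1]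
          simp
        have hE' : 0 ≤ ∑ i, ‖fderiv ℝ u y (e i)‖ ^ 2 := Finset.sum_nonneg fun i _ => sq_nonneg _
        rw [energyDensity, energyDensity, hW']
        change 1 / 2 * ∑ i, ‖fderiv ℝ (fun y => u y + z y) y (e i)‖ ^ 2 + 0
          ≤ 1 / 2 * ∑ i, ‖fderiv ℝ u y (e i)‖ ^ 2 + W (u y) + 0 - W (u y)
        linarith
      · have n2 : y ∉ {y | τ y = 1} := fun h => by
          have : τ y = 1 := h
          linarith
        rw [indicator_of_mem (show y ∈ {y | 0 < τ y ∧ τ y < 1} from ⟨h0, h1⟩),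
          indicator_of_notMem n2]
        have hW' : W (u y + z y) ≤ Wmax := hWmax _ (norm_add_variationTo_le hb hσ hUM)
        have hWu := hW0 (u y)
        have hE : ∑ i, ‖fderiv ℝ (fun y => u y + z y) y (e i)‖ ^ 2
            ≤ ∑ i, ‖fderiv ℝ u y (e i)‖ ^ 2 + n * (2 * L * (M + ‖a‖)) ^ 2 := by
          have hc : (n : ℝ) * (2 * L * (M + ‖a‖)) ^ 2
              = ∑ _i : Fin n, (2 * L * (M + ‖a‖)) ^ 2 := by simp
          rw [hc, ← Finset.sum_add_distrib]
          refine Finset.sum_le_sum fun i _ => (hpt i).trans (add_le_add ?_ ?_)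
          · have : 0 ≤ ‖fderiv ℝ u y (e i)‖ ^ 2 := sq_nonneg _
            nlinarith [sq_nonneg (τ y)]
          · refine pow_le_pow_left₀ (norm_nonneg _) ?_ 2
            rw [norm_smul, norm_mul, Real.norm_two]
            have h3 : ‖fderiv ℝ τ y (e i)‖ ≤ L := by
              have := (fderiv ℝ τ y).le_opNorm (e i)
              have h4 : ‖e i‖ = 1 := by simp [he]
              rw [h4, mul_one] at this
              exact this.trans (hL y)
            gcongr
        rw [energyDensity, energyDensity]
        change 1 / 2 * ∑ i, ‖fderiv ℝ (fun y => u y + z y) y (e i)‖ ^ 2 + W (u y + z y)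
          ≤ 1 / 2 * ∑ i, ‖fderiv ℝ u y (e i)‖ ^ 2 + W (u y)
            + (1 / 2 * (n * (2 * L * (M + ‖a‖)) ^ 2) + Wmax) - 0
        linarith
  · have h0 : τ y = 0 := by
      by_contra h
      exact hys (hτ.mem_orbitSet h)
    have hyt : y ∉ tsupport z := fun h => hys (hσ.support_orbit (tsupport_variationTo_subset h))
    have n1 : y ∉ {y | 0 < τ y ∧ τ y < 1} := fun h => by
      have := h.1; linarith
    have n2 : y ∉ {y | τ y = 1} := fun h => by
      have : τ y = 1 := h
      linarith
    rw [indicator_of_notMem n1, indicator_of_notMem n2, energyDensity, energyDensity, hsum,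
      fderiv_of_notMem_tsupport (𝕜 := ℝ) hyt, image_eq_zero_of_notMem_tsupport hyt]
    simp

/-- The potential energy of a minimizer on the set where a cutoff equals one is controlled by
the volume of the transition layer of the cutoff. -/
lemma IsRegularMinimizer.setIntegral_potential_le {Wmax : ℝ} (hF : IsFundamentalRegion G F)
    (ha : a ∈ closure F) (hW : Continuous W)
    (hW0 : ∀ v, 0 ≤ W v) (hWG : ∀ g ∈ G, ∀ v, W (g v) = W v)
    (hWa : W a = 0) (hWmax : ∀ v, ‖v‖ ≤ M + ‖a‖ → W v ≤ Wmax)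
    (h : IsRegularMinimizer G F W R M u)
    (hτ : IsCutoff G (stabRegion G F a) R τ) (hL : ∀ y, ‖fderiv ℝ τ y‖ ≤ L) :
    ∫ y in {y | τ y = 1}, W (u y)
      ≤ (1 / 2 * (n * (2 * L * (M + ‖a‖)) ^ 2) + Wmax)
        * volume.real {y | 0 < τ y ∧ τ y < 1} := by
  set B := Metric.ball (0 : Eucl n) R with hB
  set C := 1 / 2 * (n * (2 * L * (M + ‖a‖)) ^ 2) + Wmax with hC
  have hb := hF.isCompatible_stabRegion ha
  have hτc := hτ.contDiff.continuous
  have hA : MeasurableSet {y | 0 < τ y ∧ τ y < 1} :=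
    ((isOpen_lt continuous_const hτc).inter (isOpen_lt hτc continuous_const)).measurableSet
  have hO : MeasurableSet {y | τ y = 1} := (isClosed_eq hτc continuous_const).measurableSet
  have hsub : ∀ y, τ y ≠ 0 → y ∈ B := fun y hy => hτ.support_ball (subset_tsupport _ hy)
  have hAB : {y | 0 < τ y ∧ τ y < 1} ⊆ B := fun y hy => hsub y hy.1.ne'
  have hOB : {y | τ y = 1} ⊆ B := fun y hy => hsub y (by
    rw [show τ y = 1 from hy]; exact one_ne_zero)
  obtain ⟨i1, i2, hle⟩ := h.isMin.integral_le hW hW0 hF.convex h.contDiffOn h.norm_le hb hτ.sq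
  have iW : IntegrableOn (fun x => W (u x)) B :=
    integrableOn_comp_of_bounded hW h.contDiffOn.continuousOn h.norm_le
  have j1 : IntegrableOn ({y | 0 < τ y ∧ τ y < 1}.indicator fun _ => C) B :=
    (integrable_const C).indicator hA
  have j2 : IntegrableOn ({y | τ y = 1}.indicator fun y => W (u y)) B :=
    Integrable.indicator iW hO
  have j3 : IntegrableOn (fun y => energyDensity W u y
        + {y | 0 < τ y ∧ τ y < 1}.indicator (fun _ => C) y) B := i1.add j1
  have j4 : IntegrableOn (fun y => energyDensity W u y
        + {y | 0 < τ y ∧ τ y < 1}.indicator (fun _ => C) y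
        - {y | τ y = 1}.indicator (fun y => W (u y)) y) B := j3.sub j2
  have hmono := setIntegral_mono_on i2 j4 measurableSet_ball fun y hy =>
    energyDensity_variationTo_le hF ha hW0 hWG hWa hWmax h.contDiffOn h.norm_le hτ hL hy
  rw [integral_sub j3 j2, integral_add i1 j1, setIntegral_indicator hA, setIntegral_indicator hO,
    inter_eq_self_of_subset_right hAB, inter_eq_self_of_subset_right hOB, setIntegral_const,
    smul_eq_mul] at hmono
  linarith

end EnergyEstimate

/-! ### Radial cutoffs, their orbits and the volume of the transition layer -/

section CutoffConstruction

variable {n : ℕ}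

lemma contDiff_smoothTransition_two : ContDiff ℝ 2 Real.smoothTransition :=
  Real.smoothTransition.contDiff (n := 2)

lemma exists_bound_deriv_smoothTransition :
    ∃ C : ℝ, 0 ≤ C ∧ ∀ t, |deriv Real.smoothTransition t| ≤ C := by
  have hc : Continuous (deriv Real.smoothTransition) :=
    contDiff_smoothTransition_two.continuous_deriv one_le_two
  obtain ⟨C, hC⟩ := isCompact_Icc.exists_bound_of_continuousOn (s := Icc (0 : ℝ) 1)
    hc.continuousOn
  refine ⟨max C 0, le_max_right _ _, fun t => ?_⟩
  by_cases ht : t ∈ Icc (0 : ℝ) 1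
  · exact (hC t ht).trans (le_max_left _ _)
  · have : deriv Real.smoothTransition t = 0 := by
      rw [mem_Icc, not_and_or, not_le, not_le] at ht
      rcases ht with ht | ht
      · have : Real.smoothTransition =ᶠ[nhds t] fun _ => 0 := by
          filter_upwards [gt_mem_nhds ht] with s hs
          exact Real.smoothTransition.zero_of_nonpos hs.le
        rw [this.deriv_eq]; simp
      · have : Real.smoothTransition =ᶠ[nhds t] fun _ => 1 := by
          filter_upwards [lt_mem_nhds ht] with s hs
          exact Real.smoothTransition.one_of_one_le hs.le
        rw [this.deriv_eq]; simp
    rw [this, abs_zero]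
    exact le_max_right _ _

/-- A radial cutoff function, equal to one on `B_{r-1}(x)` and vanishing outside `B_r(x)`, whose
gradient is bounded independently of `r`. -/
noncomputable def radialCutoff (x : Eucl n) (r : ℝ) (y : Eucl n) : ℝ :=
  Real.smoothTransition ((r ^ 2 - ‖y - x‖ ^ 2) / r)

variable {x : Eucl n} {r : ℝ}

lemma contDiff_radialCutoff : ContDiff ℝ 2 (radialCutoff x r) :=
  contDiff_smoothTransition_two.comp
    ((contDiff_const.sub ((contDiff_id.sub contDiff_const).norm_sq ℝ)).div_const r)

lemma radialCutoff_eq_one (hr : 1 ≤ r) {y : Eucl n} (hy : ‖y - x‖ ≤ r - 1) :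
    radialCutoff x r y = 1 := by
  refine Real.smoothTransition.one_of_one_le ?_
  rw [le_div_iff₀ (by linarith)]
  -- Here `r² - (r - 1)² = 2r - 1 ≥ r`, which is where `1 ≤ r` is used.
  nlinarith [norm_nonneg (y - x)]

lemma radialCutoff_eq_zero (hr : 0 < r) {y : Eucl n} (hy : r ≤ ‖y - x‖) :
    radialCutoff x r y = 0 := by
  refine Real.smoothTransition.zero_of_nonpos (div_nonpos_of_nonpos_of_nonneg ?_ hr.le)
  nlinarith

lemma tsupport_radialCutoff_subset (hr : 0 < r) :
    tsupport (radialCutoff x r) ⊆ Metric.closedBall x r := by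
  refine closure_minimal (fun y hy => ?_) Metric.isClosed_closedBall
  rw [Metric.mem_closedBall, dist_eq_norm]
  by_contra h
  exact hy (radialCutoff_eq_zero hr (not_le.1 h).le)

/-- The argument of the transition function has gradient `-2(y - x)/r`, of norm at most 2 on the
closed ball; outside it the derivative vanishes. -/
lemma norm_fderiv_radialCutoff_le {C : ℝ} (hC0 : 0 ≤ C)
    (hC : ∀ t, |deriv Real.smoothTransition t| ≤ C) (hr : 0 < r) (y : Eucl n) :
    ‖fderiv ℝ (radialCutoff x r) y‖ ≤ 2 * C := by
  by_cases hy : y ∈ Metric.closedBall x r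
  · rw [Metric.mem_closedBall, dist_eq_norm] at hy
    refine ContinuousLinearMap.opNorm_le_bound _ (by positivity) fun v => ?_
    have h1 : HasFDerivAt (fun y : Eucl n => ‖y - x‖ ^ 2)
        ((2 : ℕ) • (innerSL ℝ (y - x) : Eucl n →L[ℝ] ℝ)) y := by
      simpa using ((hasFDerivAt_id y).sub_const x).norm_sq
    have h2 : HasFDerivAt (fun y : Eucl n => (r ^ 2 - ‖y - x‖ ^ 2) / r)
        (r⁻¹ • (-((2 : ℕ) • (innerSL ℝ (y - x) : Eucl n →L[ℝ] ℝ)))) y := by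
      simpa [div_eq_inv_mul] using (h1.const_sub (r ^ 2)).const_mul r⁻¹
    have h3 := ((contDiff_smoothTransition_two.differentiable two_ne_zero
      ((r ^ 2 - ‖y - x‖ ^ 2) / r)).hasDerivAt).comp_hasFDerivAt y h2
    have h4 : fderiv ℝ (radialCutoff x r) y = _ := h3.fderiv
    rw [h4]
    have h5 : |⟪y - x, v⟫| ≤ r * ‖v‖ :=
      (abs_real_inner_le_norm _ _).trans (mul_le_mul_of_nonneg_right hy (norm_nonneg _))
    have h6 := hC ((r ^ 2 - ‖y - x‖ ^ 2) / r)
    simp only [smul_apply, neg_apply, innerSL_apply_apply,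
      smul_eq_mul, nsmul_eq_mul, norm_mul, norm_neg, Real.norm_eq_abs, abs_inv, abs_of_pos hr]
    have h7 : r⁻¹ * |⟪y - x, v⟫| ≤ ‖v‖ := by
      rw [inv_mul_le_iff₀ hr]; exact h5
    have h8 : |((2 : ℕ) : ℝ)| = 2 := by norm_num
    rw [h8]
    calc |deriv Real.smoothTransition ((r ^ 2 - ‖y - x‖ ^ 2) / r)| * (r⁻¹ * (2 * |⟪y - x, v⟫|))
        = 2 * |deriv Real.smoothTransition ((r ^ 2 - ‖y - x‖ ^ 2) / r)|
          * (r⁻¹ * |⟪y - x, v⟫|) := by ring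
      _ ≤ 2 * C * ‖v‖ := by gcongr
  · rw [fderiv_of_notMem_tsupport (𝕜 := ℝ) (fun h => hy (tsupport_radialCutoff_subset hr h)),
      norm_zero]
    positivity

lemma abs_prod_sub_prod_le {ι : Type*} (s : Finset ι) {f g : ι → ℝ}
    (hf : ∀ i, |f i| ≤ 1) (hg : ∀ i, |g i| ≤ 1) :
    |∏ i ∈ s, f i - ∏ i ∈ s, g i| ≤ ∑ i ∈ s, |f i - g i| := by
  classical
  induction s using Finset.induction_on with
  | empty => simp
  | insert i s hi ih =>
    rw [Finset.prod_insert hi, Finset.prod_insert hi, Finset.sum_insert hi]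
    have hP : |∏ j ∈ s, f j| ≤ 1 := by
      rw [Finset.abs_prod]
      exact Finset.prod_le_one (fun j _ => abs_nonneg _) fun j _ => hf j
    calc |f i * ∏ j ∈ s, f j - g i * ∏ j ∈ s, g j|
        = |(f i - g i) * ∏ j ∈ s, f j + g i * (∏ j ∈ s, f j - ∏ j ∈ s, g j)| := by
          congr 1; ring
      _ ≤ |(f i - g i) * ∏ j ∈ s, f j| + |g i * (∏ j ∈ s, f j - ∏ j ∈ s, g j)| :=
          abs_add_le _ _
      _ = |f i - g i| * |∏ j ∈ s, f j| + |g i| * |∏ j ∈ s, f j - ∏ j ∈ s, g j| := by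
          rw [abs_mul, abs_mul]
      _ ≤ |f i - g i| * 1 + 1 * ∑ j ∈ s, |f j - g j| := by
          gcongr
          exact hg i
      _ = _ := by ring

variable {G : Subgroup (Orth n)} [Fintype G] {ψ : Eucl n → ℝ}

/-- A product of factors in `[0, 1]` varies by at most the sum of their variations, so it is
Lipschitz with constant `C` times the number of factors. -/
lemma norm_fderiv_orbitCutoff_le {C : ℝ} (hC0 : 0 ≤ C) (hψ : Differentiable ℝ ψ)
    (h0 : ∀ y, 0 ≤ ψ y) (h1 : ∀ y, ψ y ≤ 1) (hC : ∀ y, ‖fderiv ℝ ψ y‖ ≤ C) (y : Eucl n) :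
    ‖fderiv ℝ (orbitCutoff G ψ) y‖ ≤ Fintype.card G * C := by
  have hlip : ∀ p q, |ψ p - ψ q| ≤ C * ‖p - q‖ := fun p q =>
    convex_univ.norm_image_sub_le_of_norm_fderiv_le (𝕜 := ℝ) (fun z _ => hψ z)
      (fun z _ => hC z) (mem_univ q) (mem_univ p)
  refine norm_fderiv_le_of_lip' ℝ (by positivity) (Filter.Eventually.of_forall fun z => ?_)
  have hab : ∀ w, |1 - ψ w| ≤ 1 := fun w => by
    rw [abs_le]; constructor <;> linarith [h0 w, h1 w]
  have h2 : orbitCutoff G ψ z - orbitCutoff G ψ y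
      = ∏ g : G, (1 - ψ ((g : Orth n)⁻¹ y)) - ∏ g : G, (1 - ψ ((g : Orth n)⁻¹ z)) := by
    rw [orbitCutoff, orbitCutoff]; ring
  rw [h2, Real.norm_eq_abs]
  refine (abs_prod_sub_prod_le _ (fun g => hab _) (fun g => hab _)).trans ?_
  have h3 : ∀ g ∈ (Finset.univ : Finset G),
      |1 - ψ ((g : Orth n)⁻¹ y) - (1 - ψ ((g : Orth n)⁻¹ z))| ≤ C * ‖z - y‖ := by
    intro g _
    have h4 := hlip ((g : Orth n)⁻¹ z) ((g : Orth n)⁻¹ y)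
    rw [← map_sub, LinearIsometryEquiv.norm_map] at h4
    convert h4 using 2
    ring
  refine (Finset.sum_le_card_nsmul _ _ _ h3).trans ?_
  rw [nsmul_eq_mul, Finset.card_univ, mul_assoc]

lemma measureReal_ball_eq (x : Eucl n) {r : ℝ} (hr : 0 < r) :
    volume.real (Metric.ball x r) = r ^ n * volume.real (Metric.ball (0 : Eucl n) 1) := by
  rw [measureReal_def, Measure.addHaar_ball_of_pos _ _ hr, ENNReal.toReal_mul,
    ENNReal.toReal_ofReal (by positivity), finrank_euclideanSpace_fin, measureReal_def]

/-- Bernoulli's inequality for `(1 - 1/r)ⁿ`. Writing `rⁿ / r` avoids the truncated exponent `n - 1`.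
-/
lemma measureReal_annulus_le (x : Eucl n) {r : ℝ} (hr : 1 < r) :
    volume.real (Metric.ball x r \ Metric.ball x (r - 1))
      ≤ n * volume.real (Metric.ball (0 : Eucl n) 1) * (r ^ n / r) := by
  have hr0 : 0 < r := by linarith
  rw [measureReal_sdiff (Metric.ball_subset_ball (by linarith)) measurableSet_ball
    measure_ball_lt_top.ne, measureReal_ball_eq x hr0, measureReal_ball_eq x (by linarith)]
  have h1 : 1 + n * (-1 / r) ≤ (1 + -1 / r) ^ n :=
    one_add_mul_le_pow (by
      rw [le_div_iff₀ hr0]; nlinarith) n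
  have h2 : (r - 1) ^ n = r ^ n * (1 + -1 / r) ^ n := by
    rw [← mul_pow]; congr 1; field_simp; ring
  have h3 : r ^ n - (r - 1) ^ n ≤ n * (r ^ n / r) := by
    rw [h2]
    have h4 : 0 < r ^ n := by positivity
    have h5 := mul_le_mul_of_nonneg_left h1 h4.le
    have h6 : r ^ n * (1 + n * (-1 / r)) = r ^ n - n * (r ^ n / r) := by ring
    linarith
  have h7 : 0 ≤ volume.real (Metric.ball (0 : Eucl n) 1) := measureReal_nonneg
  nlinarith

/-- Where the orbit cutoff is positive, `y` lies in some `B_r(g x)`; lying in the smaller concentric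
ball would make the cutoff one. So the layer is covered by one annulus per element of `G`. -/
lemma measureReal_transition_le (x : Eucl n) {r : ℝ} (hr : 1 < r) :
    volume.real {y | 0 < orbitCutoff G (radialCutoff x r) y ∧
        orbitCutoff G (radialCutoff x r) y < 1}
      ≤ Fintype.card G * (n * volume.real (Metric.ball (0 : Eucl n) 1) * (r ^ n / r)) := by
  have hsub : {y | 0 < orbitCutoff G (radialCutoff x r) y ∧
      orbitCutoff G (radialCutoff x r) y < 1} ⊆
      ⋃ g ∈ (Finset.univ : Finset G),
        (Metric.ball ((g : Orth n) x) r \ Metric.ball ((g : Orth n) x) (r - 1)) := by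
    rintro y ⟨h0, h1⟩
    obtain ⟨g, hg, hgy⟩ := exists_ne_zero_of_orbitCutoff_ne_zero h0.ne'
    have hd : dist y (g x) = ‖g⁻¹ y - x‖ := by
      rw [dist_eq_norm, ← LinearIsometryEquiv.norm_map g⁻¹, map_sub, Orth.inv_apply_apply]
    refine mem_iUnion₂.2 ⟨⟨g, hg⟩, Finset.mem_univ _, ?_, ?_⟩
    · rw [Metric.mem_ball, hd]
      by_contra hcon
      exact hgy (radialCutoff_eq_zero (by linarith) (not_lt.1 hcon))
    · rw [Metric.mem_ball, hd]
      intro hcon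
      exact h1.ne (orbitCutoff_eq_one hg (radialCutoff_eq_one hr.le hcon.le))
  have hfin : volume (⋃ g ∈ (Finset.univ : Finset G),
      (Metric.ball ((g : Orth n) x) r \ Metric.ball ((g : Orth n) x) (r - 1))) ≠ ⊤ := by
    refine ((measure_biUnion_finset_le _ _).trans_lt ?_).ne
    exact ENNReal.sum_lt_top.2 fun g _ => (measure_mono sdiff_subset).trans_lt measure_ball_lt_top
  refine (measureReal_mono hsub hfin).trans ((measureReal_biUnion_finset_le _ _).trans ?_)
  refine (Finset.sum_le_card_nsmul _ _ _ fun (g : G) _ =>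
    measureReal_annulus_le ((g : Orth n) x) hr).trans ?_
  rw [nsmul_eq_mul, Finset.card_univ]

end CutoffConstruction

/-! ### Potential energy on interior balls -/

section InteriorEnergyBound

variable {n : ℕ} {G : Subgroup (Orth n)} {F : Set (Eucl n)} {M : ℝ} {a : Eucl n}
  {W : Eucl n → ℝ}

/-- On balls inside the symmetrized region the potential energy of a minimizer grows at most
like the area of the boundary of the ball. -/
lemma exists_setIntegral_potential_le (hG : Finite G) (hF : IsFundamentalRegion G F)
    (ha : a ∈ closure F) (hW : Continuous W) (hW0 : ∀ v, 0 ≤ W v)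
    (hWG : ∀ g ∈ G, ∀ v, W (g v) = W v) (hWa : W a = 0) :
    ∃ C : ℝ, 0 ≤ C ∧ ∀ (R : ℝ) (u : Eucl n → Eucl n), IsRegularMinimizer G F W R M u →
      ∀ (x : Eucl n) (r : ℝ), 1 < r →
        Metric.closedBall x r ⊆ stabRegion G F a ∩ Metric.ball 0 R →
        ∫ y in Metric.ball x (r - 1), W (u y) ≤ C * (r ^ n / r) := by
  have hfin : Fintype G := Fintype.ofFinite G
  obtain ⟨T, hT0, hT⟩ := exists_bound_deriv_smoothTransition
  obtain ⟨Wmax, hWmax0, hWmax⟩ := exists_bound_on_norm_le hW (M + ‖a‖)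
  have hWmax' : ∀ v, ‖v‖ ≤ M + ‖a‖ → W v ≤ Wmax := fun v hv =>
    (le_abs_self _).trans (hWmax v hv)
  set L : ℝ := Fintype.card G * (2 * T) with hL
  set K : ℝ := 1 / 2 * (n * (2 * L * (M + ‖a‖)) ^ 2) + Wmax with hK
  have hK0 : 0 ≤ K := by positivity
  set V : ℝ := volume.real (Metric.ball (0 : Eucl n) 1) with hV
  have hV0 : 0 ≤ V := measureReal_nonneg
  refine ⟨K * (Fintype.card G * (n * V)), by positivity, ?_⟩
  intro R u hu x r hr hball
  have hr0 : 0 < r := by linarith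
  set ψ := radialCutoff x r with hψ
  have hψ0 : ∀ y, 0 ≤ ψ y := fun y => Real.smoothTransition.nonneg _
  have hψ1 : ∀ y, ψ y ≤ 1 := fun y => Real.smoothTransition.le_one _
  have hsupp : tsupport ψ ⊆ Metric.closedBall x r := tsupport_radialCutoff_subset hr0
  have hτ : IsCutoff G (stabRegion G F a) R (orbitCutoff G ψ) :=
    isCutoff_orbitCutoff contDiff_radialCutoff hψ0 hψ1
      ((isCompact_closedBall x r).of_isClosed_subset (isClosed_tsupport _) hsupp)
      (fun y hy => (hball (hsupp hy)).2) (fun y hy => (hball (hsupp hy)).1)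
  have hLb : ∀ y, ‖fderiv ℝ (orbitCutoff G ψ) y‖ ≤ L :=
    norm_fderiv_orbitCutoff_le (by positivity)
      (contDiff_radialCutoff.differentiable two_ne_zero) hψ0 hψ1
      (norm_fderiv_radialCutoff_le hT0 hT hr0)
  have h1 := hu.setIntegral_potential_le hF ha hW hW0 hWG hWa hWmax' hτ hLb
  have hsub : Metric.ball x (r - 1) ⊆ {y | orbitCutoff G ψ y = 1} := by
    intro y hy
    rw [Metric.mem_ball, dist_eq_norm] at hy
    exact orbitCutoff_eq_one (g := 1) G.one_mem
      (by rw [inv_one]; exact radialCutoff_eq_one hr.le hy.le)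
  have hOB : {y | orbitCutoff G ψ y = 1} ⊆ Metric.ball (0 : Eucl n) R := fun y hy =>
    hτ.support_ball (subset_tsupport _ (by
      rw [Function.mem_support, show orbitCutoff G ψ y = 1 from hy]; exact one_ne_zero))
  have hint : IntegrableOn (fun y => W (u y)) {y | orbitCutoff G ψ y = 1} :=
    (integrableOn_comp_of_bounded hW hu.contDiffOn.continuousOn hu.norm_le).mono_set hOB
  calc ∫ y in Metric.ball x (r - 1), W (u y)
      ≤ ∫ y in {y | orbitCutoff G ψ y = 1}, W (u y) :=
        setIntegral_mono_set hint (Filter.Eventually.of_forall fun y => hW0 _)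
          (LE.le.eventuallyLE hsub)
    _ ≤ K * volume.real {y | 0 < orbitCutoff G ψ y ∧ orbitCutoff G ψ y < 1} := h1
    _ ≤ K * (Fintype.card G * (n * V * (r ^ n / r))) :=
        mul_le_mul_of_nonneg_left (measureReal_transition_le x hr) hK0
    _ = _ := by ring

end InteriorEnergyBound

/-! ### Mean value inequality for subharmonic functions -/

section MeanValue

variable {n : ℕ}

/-- Exponents from 2 on make both one-sided derivatives at 0 vanish. -/
lemma hasDerivAt_max_zero_pow (k : ℕ) (t : ℝ) :
    HasDerivAt (fun t : ℝ => max t 0 ^ (k + 2)) ((k + 2 : ℕ) * max t 0 ^ (k + 1)) t := by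
  rcases lt_trichotomy t 0 with ht | rfl | ht
  · have h1 : (fun t : ℝ => max t 0 ^ (k + 2)) =ᶠ[nhds t] fun _ => 0 := by
      filter_upwards [gt_mem_nhds ht] with s hs
      rw [max_eq_right hs.le]; simp
    rw [max_eq_right ht.le]
    simpa using (hasDerivAt_const t (0 : ℝ)).congr_of_eventuallyEq h1
  · have h1 : HasDerivWithinAt (fun t : ℝ => max t 0 ^ (k + 2)) 0 (Iic 0) 0 :=
      (hasDerivWithinAt_const (0 : ℝ) (Iic 0) (0 : ℝ)).congr
        (fun s hs => by rw [max_eq_right hs]; simp) (by simp)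
    have h2 : HasDerivWithinAt (fun t : ℝ => max t 0 ^ (k + 2)) 0 (Ici 0) 0 := by
      have h3 : HasDerivAt (fun t : ℝ => t ^ (k + 2)) 0 0 := by
        simpa using hasDerivAt_pow (k + 2) (0 : ℝ)
      exact h3.hasDerivWithinAt.congr (fun s hs => by rw [max_eq_left hs]) (by simp)
    have h3 := h1.union h2
    rw [Iic_union_Ici, hasDerivWithinAt_univ] at h3
    simpa using h3
  · have h1 : (fun t : ℝ => max t 0 ^ (k + 2)) =ᶠ[nhds t] fun t => t ^ (k + 2) := by
      filter_upwards [lt_mem_nhds ht] with s hs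
      rw [max_eq_left hs.le]
    rw [max_eq_left ht.le]
    exact (hasDerivAt_pow (k + 2) t).congr_of_eventuallyEq h1

lemma contDiff_two_max_zero_cube : ContDiff ℝ 2 fun t : ℝ => max t 0 ^ 3 := by
  have hc1 : ContDiff ℝ 1 fun t : ℝ => max t 0 ^ 2 := by
    rw [show (1 : WithTop ℕ∞) = 0 + 1 from (zero_add 1).symm, contDiff_succ_iff_deriv]
    refine ⟨fun t => (hasDerivAt_max_zero_pow 0 t).differentiableAt, by simp, ?_⟩
    rw [contDiff_zero, funext fun t => (hasDerivAt_max_zero_pow 0 t).deriv]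
    fun_prop
  rw [show (2 : WithTop ℕ∞) = 1 + 1 from one_add_one_eq_two.symm, contDiff_succ_iff_deriv]
  refine ⟨fun t => (hasDerivAt_max_zero_pow 1 t).differentiableAt, by simp, ?_⟩
  rw [funext fun t => (hasDerivAt_max_zero_pow 1 t).deriv]
  exact contDiff_const.mul hc1

/-- The profile `(1 - |z|²)₊³`. -/
noncomputable def bumpCube (z : Eucl n) : ℝ := max (1 - ‖z‖ ^ 2) 0 ^ 3

/-- The averaging kernel `6 (1 - |z|²)₊²`, for which `∇ (1 - |z|²)₊³` is `-(kernel) z`. -/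
noncomputable def meanKernel (z : Eucl n) : ℝ := 6 * max (1 - ‖z‖ ^ 2) 0 ^ 2

lemma contDiff_bumpCube : ContDiff ℝ 2 (bumpCube (n := n)) :=
  contDiff_two_max_zero_cube.comp (contDiff_const.sub (contDiff_id.norm_sq ℝ))

lemma fderiv_bumpCube (z v : Eucl n) : fderiv ℝ bumpCube z v = -(meanKernel z * ⟪z, v⟫) := by
  have h1 : HasFDerivAt (fun y : Eucl n => ‖y‖ ^ 2)
      ((2 : ℕ) • (innerSL ℝ z : Eucl n →L[ℝ] ℝ)) z := by
    simpa using (hasFDerivAt_id z).norm_sq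
  have h2 := (hasDerivAt_max_zero_pow 1 (1 - ‖z‖ ^ 2)).comp_hasFDerivAt z (h1.const_sub 1)
  have h3 : fderiv ℝ (bumpCube (n := n)) z = _ := h2.fderiv
  rw [h3]
  simp only [smul_apply, neg_apply, innerSL_apply_apply, smul_eq_mul, nsmul_eq_mul, meanKernel]
  push_cast
  ring

lemma norm_lt_one_of_max_ne {z : Eucl n} {k : ℕ} (hk : k ≠ 0)
    (h : max (1 - ‖z‖ ^ 2) 0 ^ k ≠ 0) : ‖z‖ < 1 := by
  by_contra hcon
  push Not at hcon
  refine h ?_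
  rw [max_eq_right (by nlinarith), zero_pow hk]

lemma norm_lt_one_of_bumpCube_ne {z : Eucl n} (h : bumpCube z ≠ 0) : ‖z‖ < 1 :=
  norm_lt_one_of_max_ne three_ne_zero h

lemma norm_lt_one_of_meanKernel_ne {z : Eucl n} (h : meanKernel z ≠ 0) : ‖z‖ < 1 :=
  norm_lt_one_of_max_ne two_ne_zero fun h0 => h (by rw [meanKernel, h0, mul_zero])

lemma hasCompactSupport_of_norm_lt_one {f : Eucl n → ℝ} (h : ∀ z, f z ≠ 0 → ‖z‖ < 1) :
    HasCompactSupport f :=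
  HasCompactSupport.intro (isCompact_closedBall (0 : Eucl n) 1) fun z hz => by
    by_contra hcon
    exact hz (mem_closedBall_zero_iff.2 (h z hcon).le)

lemma hasCompactSupport_bumpCube : HasCompactSupport (bumpCube (n := n)) :=
  hasCompactSupport_of_norm_lt_one fun _ h => norm_lt_one_of_bumpCube_ne h

lemma hasCompactSupport_meanKernel : HasCompactSupport (meanKernel (n := n)) :=
  hasCompactSupport_of_norm_lt_one fun _ h => norm_lt_one_of_meanKernel_ne h

lemma continuous_meanKernel : Continuous (meanKernel (n := n)) := by
  unfold meanKernel; fun_prop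

lemma meanKernel_nonneg (z : Eucl n) : 0 ≤ meanKernel z := by
  unfold meanKernel; positivity

lemma bumpCube_nonneg (z : Eucl n) : 0 ≤ bumpCube z := by
  unfold bumpCube; positivity

lemma meanKernel_le (z : Eucl n) : meanKernel z ≤ 6 := by
  have h1 : max (1 - ‖z‖ ^ 2) 0 ≤ 1 := max_le (by linarith [sq_nonneg ‖z‖]) zero_le_one
  have h2 : max (1 - ‖z‖ ^ 2) 0 ^ 2 ≤ 1 := pow_le_one₀ (le_max_right _ _) h1
  unfold meanKernel; linarith

lemma integral_meanKernel_pos : 0 < ∫ z, meanKernel (n := n) z :=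
  continuous_meanKernel.integral_pos_of_hasCompactSupport_nonneg_nonzero
    hasCompactSupport_meanKernel meanKernel_nonneg (x := 0) (by simp [meanKernel])

variable {g : Eucl n → ℝ} {x : Eucl n}

lemma hasDerivAt_integral_meanKernel (hg : ContDiff ℝ 2 g) (s : ℝ) :
    HasDerivAt (fun s : ℝ => ∫ z, meanKernel z * g (x + s • z))
      (∫ z, meanKernel z * fderiv ℝ g (x + s • z) z) s := by
  have hdg : Continuous (fderiv ℝ g) := hg.continuous_fderiv two_ne_zero
  obtain ⟨C, hC⟩ := (isCompact_closedBall x (|s| + 1)).exists_bound_of_continuousOn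
    hdg.continuousOn
  have hF : ∀ s : ℝ, Continuous fun z => meanKernel z * g (x + s • z) := fun s =>
    continuous_meanKernel.mul (hg.continuous.comp (by fun_prop))
  have hF' : Continuous fun z => meanKernel z * fderiv ℝ g (x + s • z) z :=
    continuous_meanKernel.mul ((hdg.comp (by fun_prop)).clm_apply continuous_id)
  refine (hasDerivAt_integral_of_dominated_loc_of_deriv_le (𝕜 := ℝ) (E := ℝ) (μ := volume)
    (x₀ := s) (s := Metric.ball s 1) (F := fun s z => meanKernel z * g (x + s • z))
    (F' := fun s z => meanKernel z * fderiv ℝ g (x + s • z) z)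
    (bound := fun z => meanKernel z * C) (Metric.ball_mem_nhds _ one_pos)
    (Filter.Eventually.of_forall fun s => (hF s).aestronglyMeasurable)
    ((hF s).integrable_of_hasCompactSupport hasCompactSupport_meanKernel.mul_right)
    hF'.aestronglyMeasurable ?_ ?_ ?_).2
  · refine Filter.Eventually.of_forall fun z t ht => ?_
    by_cases h0 : meanKernel z = 0
    · simp [h0]
    · have hz := norm_lt_one_of_meanKernel_ne h0
      rw [norm_mul, Real.norm_of_nonneg (meanKernel_nonneg z)]
      refine mul_le_mul_of_nonneg_left ?_ (meanKernel_nonneg z)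
      have ht' : |t| ≤ |s| + 1 := by
        have h1 : |t - s| < 1 := by
          have h2 := Metric.mem_ball.1 ht
          rwa [Real.dist_eq] at h2
        have h2 := abs_add_le s (t - s)
        rw [add_sub_cancel] at h2
        linarith
      have hmem : x + t • z ∈ Metric.closedBall x (|s| + 1) := by
        rw [Metric.mem_closedBall, dist_eq_norm, add_sub_cancel_left, norm_smul, Real.norm_eq_abs]
        nlinarith [abs_nonneg t, norm_nonneg z]
      have hC1 := hC _ hmem
      calc ‖fderiv ℝ g (x + t • z) z‖ ≤ ‖fderiv ℝ g (x + t • z)‖ * ‖z‖ :=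
            ContinuousLinearMap.le_opNorm _ _
        _ ≤ C * 1 := mul_le_mul hC1 hz.le (norm_nonneg _) ((norm_nonneg _).trans hC1)
        _ = C := mul_one C
  · exact (continuous_meanKernel.mul continuous_const).integrable_of_hasCompactSupport
      hasCompactSupport_meanKernel.mul_right
  · refine Filter.Eventually.of_forall fun z t _ => ?_
    exact (hasDerivAt_line (hg.differentiable two_ne_zero _)).const_mul (meanKernel z)

lemma fderiv_comp_affine {X : Type*} [NormedAddCommGroup X] [NormedSpace ℝ X] {f : Eucl n → X}
    (hf : Differentiable ℝ f) (s : ℝ) (z : Eucl n) :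
    fderiv ℝ (fun z => f (x + s • z)) z = s • fderiv ℝ f (x + s • z) := by
  have h1 : HasFDerivAt (fun z : Eucl n => x + s • z)
      (s • ContinuousLinearMap.id ℝ (Eucl n)) z :=
    ((hasFDerivAt_id z).const_smul s).const_add x
  have h2 := (hf (x + s • z)).hasFDerivAt.comp z h1
  refine h2.fderiv.trans ?_
  ext v
  simp

lemma laplacianAt_comp_affine (hg : ContDiff ℝ 2 g) (s : ℝ) (z : Eucl n) :
    laplacianAt (fun z => g (x + s • z)) z = s ^ 2 * laplacianAt g (x + s • z) := by
  have hd : Differentiable ℝ (fderiv ℝ g) :=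
    (hg.fderiv_right (m := 1) (by norm_num)).differentiable one_ne_zero
  have h1 : fderiv ℝ (fun z => g (x + s • z)) = fun z => s • fderiv ℝ g (x + s • z) :=
    funext fun z => fderiv_comp_affine (hg.differentiable two_ne_zero) s z
  have hd' : DifferentiableAt ℝ (fun z => fderiv ℝ g (x + s • z)) z :=
    (hd _).comp z (by fun_prop)
  rw [laplacianAt, h1, fderiv_fun_const_smul hd', fderiv_comp_affine hd, laplacianAt,
    Finset.mul_sum]
  refine Finset.sum_congr rfl fun i _ => ?_
  simp only [smul_apply, smul_eq_mul]
  ring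

/-- The derivative of the spherical-type means is nonnegative for subharmonic functions. -/
lemma integral_meanKernel_fderiv_nonneg (hg : ContDiff ℝ 2 g) {ρ s : ℝ}
    (hs : 0 < s) (hsρ : s ≤ ρ) (hlap : ∀ y ∈ Metric.ball x ρ, 0 ≤ laplacianAt g y) :
    0 ≤ ∫ z, meanKernel z * fderiv ℝ g (x + s • z) z := by
  have hgs : ContDiff ℝ 2 fun z : Eucl n => g (x + s • z) :=
    hg.comp (contDiff_const.add (contDiff_id.const_smul s))
  -- As `∇ bumpCube = -(meanKernel) z`, the radial derivative of the average becomes, after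
  -- integration by parts, the Laplacian tested against the nonnegative `bumpCube`.
  have key := integral_sum_inner_fderiv (U := univ) isOpen_univ hgs.contDiffOn
    (contDiff_bumpCube.of_le one_le_two) hasCompactSupport_bumpCube (subset_univ _)
  have h1 : ∀ z : Eucl n, ∑ i : Fin n,
      ⟪fderiv ℝ (fun z : Eucl n => g (x + s • z)) z (EuclideanSpace.single i 1),
        fderiv ℝ bumpCube z (EuclideanSpace.single i 1)⟫
      = -s * (meanKernel z * fderiv ℝ g (x + s • z) z) := by
    intro z
    have hz : z = ∑ i : Fin n, z i • EuclideanSpace.single i (1 : ℝ) := by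
      have := (EuclideanSpace.basisFun (Fin n) ℝ).sum_repr z
      simpa using this.symm
    have hexp : fderiv ℝ g (x + s • z) z
        = ∑ i : Fin n, z i * fderiv ℝ g (x + s • z) (EuclideanSpace.single i 1) := by
      conv_lhs => rw [hz]
      rw [map_sum]
      rw [← hz]
      simp only [map_smul, smul_eq_mul]
    rw [hexp, Finset.mul_sum, Finset.mul_sum]
    refine Finset.sum_congr rfl fun i _ => ?_
    rw [fderiv_bumpCube, fderiv_comp_affine (hg.differentiable two_ne_zero)]
    simp [EuclideanSpace.inner_single_right]
    ring
  have h2 : 0 ≤ ∫ z, ⟪laplacianAt (fun z : Eucl n => g (x + s • z)) z, bumpCube z⟫ := by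
    refine integral_nonneg fun z => ?_
    rw [laplacianAt_comp_affine hg]
    by_cases h0 : bumpCube z = 0
    · simp [h0]
    · have hz := norm_lt_one_of_bumpCube_ne h0
      have hmem : x + s • z ∈ Metric.ball x ρ := by
        rw [Metric.mem_ball, dist_eq_norm, add_sub_cancel_left, norm_smul,
          Real.norm_of_nonneg hs.le]
        nlinarith
      exact mul_nonneg (bumpCube_nonneg z) (mul_nonneg (sq_nonneg s) (hlap _ hmem))
  simp only [h1] at key
  rw [integral_const_mul] at key
  nlinarith

/-- The mean value inequality for nonnegative subharmonic functions on balls. -/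
lemma exists_mean_value_le (n : ℕ) : ∃ c : ℝ, 0 < c ∧ ∀ (g : Eucl n → ℝ) (x : Eucl n) (ρ : ℝ),
    ContDiff ℝ 2 g → 0 < ρ → (∀ y ∈ Metric.ball x ρ, 0 ≤ laplacianAt g y) →
    (∀ y ∈ Metric.ball x ρ, 0 ≤ g y) →
    g x ≤ c * ((ρ ^ n)⁻¹ * ∫ y in Metric.ball x ρ, g y) := by
  have hpos := integral_meanKernel_pos (n := n)
  set κ := ∫ z, meanKernel (n := n) z with hκ
  refine ⟨6 / κ, by positivity, ?_⟩
  intro g x ρ hg hρ hlap hg0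
  have hder := fun s => hasDerivAt_integral_meanKernel (x := x) hg s
  -- The kernel average at scale `s` is nondecreasing in `s`; at `s = 0` it equals `κ * g x`, and at
  -- `s = ρ` it is at most 6, the maximum of the kernel, times the rescaled integral.
  have hmono : MonotoneOn (fun s : ℝ => ∫ z, meanKernel z * g (x + s • z)) (Icc 0 ρ) := by
    refine monotoneOn_of_deriv_nonneg (convex_Icc 0 ρ)
      (fun s _ => (hder s).continuousAt.continuousWithinAt)
      (fun s _ => (hder s).differentiableAt.differentiableWithinAt) ?_
    intro s hs
    rw [interior_Icc] at hs
    rw [(hder s).deriv]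
    exact integral_meanKernel_fderiv_nonneg hg hs.1 hs.2.le hlap
  have h1 := hmono (left_mem_Icc.2 hρ.le) (right_mem_Icc.2 hρ.le) hρ.le
  simp only [zero_smul, add_zero] at h1
  rw [integral_mul_const] at h1
  set h := (Metric.ball x ρ).indicator g with hh
  have hint : Integrable h := by
    rw [hh, integrable_indicator_iff measurableSet_ball]
    exact (hg.continuous.continuousOn.integrableOn_compact
      (isCompact_closedBall x ρ)).mono_set Metric.ball_subset_closedBall
  have hint2 : Integrable fun z => h (x + ρ • z) :=
    (hint.comp_add_left x).comp_smul hρ.ne'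
  have h2 : ∫ z, meanKernel z * g (x + ρ • z) ≤ ∫ z, 6 * h (x + ρ • z) := by
    refine integral_mono ?_ (hint2.const_mul 6) fun z => ?_
    · refine (continuous_meanKernel.mul
        (hg.continuous.comp (by fun_prop))).integrable_of_hasCompactSupport
        hasCompactSupport_meanKernel.mul_right
    · by_cases h0 : meanKernel z = 0
      · simp only [h0, zero_mul]
        refine mul_nonneg (by norm_num) (indicator_nonneg (fun y hy => hg0 y hy) _)
      · have hz := norm_lt_one_of_meanKernel_ne h0
        have hmem : x + ρ • z ∈ Metric.ball x ρ := by
          rw [Metric.mem_ball, dist_eq_norm, add_sub_cancel_left, norm_smul,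
            Real.norm_of_nonneg hρ.le]
          nlinarith
        simp only [hh]
        rw [indicator_of_mem hmem]
        exact mul_le_mul_of_nonneg_right (meanKernel_le z) (hg0 _ hmem)
  have h3 : ∫ z, 6 * h (x + ρ • z) = 6 * ((ρ ^ n)⁻¹ * ∫ y in Metric.ball x ρ, g y) := by
    rw [integral_const_mul, Measure.integral_comp_smul volume (fun y => h (x + y)) ρ,
      integral_add_left_eq_self h x, hh, integral_indicator measurableSet_ball,
      finrank_euclideanSpace_fin, smul_eq_mul, abs_of_pos (by positivity)]
  rw [h3] at h2
  have h4 : κ * g x ≤ 6 * ((ρ ^ n)⁻¹ * ∫ y in Metric.ball x ρ, g y) := h1.trans h2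
  calc g x = (κ * g x) / κ := by field_simp
    _ ≤ (6 * ((ρ ^ n)⁻¹ * ∫ y in Metric.ball x ρ, g y)) / κ :=
        div_le_div_of_nonneg_right h4 hpos.le
    _ = _ := by ring

end MeanValue

/-! ### Subharmonicity of the truncated `Q(u)` and its control by `W` -/

section Subharmonic

variable {n : ℕ} {G : Subgroup (Orth n)} {F : Set (Eucl n)} {R M ε : ℝ} {a : Eucl n}
  {W Q P : Eucl n → ℝ} {u : Eucl n → Eucl n}

/-- A smooth convex truncation of `Q`. -/
noncomputable def truncCube (Q : Eucl n → ℝ) (ε : ℝ) (v : Eucl n) : ℝ := max (Q v - ε) 0 ^ 3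

lemma truncCube_nonneg (v : Eucl n) : 0 ≤ truncCube Q ε v := by
  unfold truncCube; positivity

lemma IsQMonotone.apply_self (hQ : IsQMonotone G F W a Q) : Q a = 0 := by
  obtain ⟨H, -, hH0, -, hQH⟩ := hQ.shape
  have := hQH 0
  rwa [zero_add, norm_zero, hH0, add_zero] at this

lemma IsQMonotone.contDiffAt (hQ : IsQMonotone G F W a Q) {v : Eucl n} (hv : v ≠ a) :
    ContDiffAt ℝ 2 Q v := by
  obtain ⟨H, hH, -, -, hQH⟩ := hQ.shape
  have h1 : Q = fun v => ‖v - a‖ + H (v - a) := by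
    ext v
    rw [← hQH, sub_add_cancel]
  rw [h1]
  have h2 : ContDiffAt ℝ 2 (fun v : Eucl n => v - a) v := contDiffAt_id.sub contDiffAt_const
  exact (h2.norm ℝ (sub_ne_zero.2 hv)).add (hH.contDiffAt.comp v h2)

lemma IsQMonotone.truncCube_eventuallyEq (hQ : IsQMonotone G F W a Q) (hε : 0 < ε) :
    truncCube Q ε =ᶠ[nhds a] fun _ => 0 := by
  have h1 : ∀ᶠ v in nhds a, Q v < ε :=
    hQ.continuous.continuousAt.eventually (gt_mem_nhds (by rw [hQ.apply_self]; exact hε))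
  filter_upwards [h1] with v hv
  rw [truncCube, max_eq_right (by linarith)]
  norm_num

/-- Near `a` the truncation is zero, so the cone singularity of `Q` disappears; elsewhere `Q` is
`C²` and so is the cube of the positive part. -/
lemma IsQMonotone.contDiff_truncCube (hQ : IsQMonotone G F W a Q) (hε : 0 < ε) :
    ContDiff ℝ 2 (truncCube Q ε) := by
  rw [contDiff_iff_contDiffAt]
  intro v
  by_cases hv : v = a
  · subst hv
    exact contDiffAt_const.congr_of_eventuallyEq (hQ.truncCube_eventuallyEq hε)
  · exact contDiff_two_max_zero_cube.contDiffAt.comp v ((hQ.contDiffAt hv).sub contDiffAt_const)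

lemma IsQMonotone.convexOn_truncCube (hQ : IsQMonotone G F W a Q) :
    ConvexOn ℝ univ (truncCube Q ε) := by
  have h1 : ConvexOn ℝ univ fun v => Q v - ε := by
    simp only [sub_eq_add_neg]
    exact ConvexOn.add hQ.convex (convexOn_const (-ε) convex_univ)
  have h2 : ConvexOn ℝ univ fun v => max (Q v - ε) 0 := h1.sup (convexOn_const 0 convex_univ)
  exact h2.pow (fun v _ => le_max_right _ _) 3

lemma fderiv_fderiv_nonneg_of_convexOn (hP : ContDiff ℝ 2 P) (hc : ConvexOn ℝ univ P)
    (v e : Eucl n) : 0 ≤ fderiv ℝ (fderiv ℝ P) v e e := by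
  rw [← deriv_deriv_line hP.contDiffAt e]
  have h1 : ConvexOn ℝ univ fun t : ℝ => P (v + t • e) := by
    refine ⟨convex_univ, fun s _ t _ α β hα hβ hαβ => ?_⟩
    have := hc.2 (mem_univ (v + s • e)) (mem_univ (v + t • e)) hα hβ hαβ
    convert this using 2
    rw [smul_add, smul_add, add_add_add_comm, ← add_smul, hαβ, one_smul, add_smul, smul_smul,
      smul_smul]
    rfl
  have h2 : MonotoneOn (deriv fun t : ℝ => P (v + t • e)) univ :=
    h1.monotoneOn_deriv fun t _ =>
      (hasDerivAt_line (hP.differentiable two_ne_zero _)).differentiableAt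
  exact (monotoneOn_univ.1 h2).deriv_nonneg

lemma laplacianAt_comp (hP : ContDiff ℝ 2 P) {y : Eucl n} (hu : ContDiffAt ℝ 2 u y) :
    laplacianAt (fun y => P (u y)) y
      = ∑ i : Fin n, fderiv ℝ (fderiv ℝ P) (u y) (fderiv ℝ u y (EuclideanSpace.single i 1))
          (fderiv ℝ u y (EuclideanSpace.single i 1)) + fderiv ℝ P (u y) (laplacianAt u y) := by
  rw [laplacianAt, laplacianAt, map_sum, ← Finset.sum_add_distrib]
  refine Finset.sum_congr rfl fun i _ => ?_
  set e : Eucl n := EuclideanSpace.single i 1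
  have hPu : ContDiffAt ℝ 2 (fun y => P (u y)) y := hP.contDiffAt.comp y hu
  rw [← fderiv_fderiv_apply hPu, ← fderiv_fderiv_apply hu]
  have h1 : (fun z => fderiv ℝ (fun y => P (u y)) z e)
      =ᶠ[nhds y] fun z => fderiv ℝ P (u z) (fderiv ℝ u z e) := by
    filter_upwards [hu.eventually (by simp)] with z hz
    have := (hP.differentiable two_ne_zero (u z)).hasFDerivAt.comp z
      (hz.differentiableAt two_ne_zero).hasFDerivAt
    exact congrArg (fun L => L e) this.fderiv
  rw [h1.fderiv_eq]
  have hd : DifferentiableAt ℝ (fun z => fderiv ℝ u z e) y :=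
    ((hu.fderiv_right (m := 1) (by norm_num)).differentiableAt one_ne_zero).clm_apply
      (differentiableAt_const _)
  have hdP : HasFDerivAt (fun z => fderiv ℝ P (u z))
      ((fderiv ℝ (fderiv ℝ P) (u y)).comp (fderiv ℝ u y)) y :=
    (((hP.fderiv_right (m := 1) (by norm_num)).differentiable one_ne_zero
      (u y)).hasFDerivAt).comp y (hu.differentiableAt two_ne_zero).hasFDerivAt
  rw [(hdP.clm_apply hd.hasFDerivAt).fderiv]
  simp [add_comm]

lemma laplacianAt_congr {X : Type*} [NormedAddCommGroup X] [NormedSpace ℝ X]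
    {f g : Eucl n → X} {y : Eucl n} (h : f =ᶠ[nhds y] g) : laplacianAt f y = laplacianAt g y := by
  rw [laplacianAt, laplacianAt, h.fderiv.fderiv_eq]

lemma isClosed_stabUnion (hG : Finite G) : IsClosed (stabUnion G F a) := by
  have h1 : stabUnion G F a = ⋃ g ∈ {g : Orth n | g ∈ G ∧ g a = a}, (fun y => g⁻¹ y) ⁻¹' closure F := by
    ext y
    simp only [stabUnion, mem_iUnion, mem_preimage, exists_prop, mem_ofPred_eq, and_assoc]
  rw [h1]
  have hfin : (G : Set (Orth n)).Finite := Set.toFinite _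
  exact (hfin.subset fun g hg => hg.1).isClosed_biUnion fun g _ =>
    isClosed_closure.preimage (g⁻¹).continuous

lemma stabUnion_subset_closure_stabRegion (hF : IsOpen F) :
    stabUnion G F a ⊆ closure (stabRegion G F a) := by
  rintro y ⟨k, hk, hka, hky⟩
  have h1 : k '' F ⊆ stabRegion G F a := by
    rw [stabRegion_eq_interior]
    refine interior_maximal ?_ (isOpen_image_orth hF k)
    rintro _ ⟨z, hz, rfl⟩
    exact ⟨k, hk, hka, by rw [Orth.inv_apply_apply]; exact subset_closure hz⟩
  have h2 : k (k⁻¹ y) ∈ closure (k '' F) :=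
    image_closure_subset_closure_image k.continuous ⟨_, hky, rfl⟩
  rw [Orth.apply_inv_apply] at h2
  exact closure_mono h1 h2

/-- `Q`-monotonicity is assumed on the open `D` without `a`, but `u` may take values on the
boundary. Being `C²`, the truncation lets the inequality pass to the closure, and at `a` its
derivative is zero. -/
lemma IsQMonotone.fderiv_truncCube_nonneg (hQ : IsQMonotone G F W a Q) (hε : 0 < ε)
    (hF : IsOpen F) (hW : ContDiff ℝ 2 W) {v : Eucl n} (hv : v ∈ stabUnion G F a) :
    0 ≤ fderiv ℝ (truncCube Q ε) v (gradient W v) := by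
  have hc : Continuous fun v => fderiv ℝ (truncCube Q ε) v (gradient W v) :=
    ((hQ.contDiff_truncCube hε).continuous_fderiv two_ne_zero).clm_apply
      (continuous_gradient (hW.of_le one_le_two))
  refine closure_minimal ?_ (isClosed_le continuous_const hc)
    (stabUnion_subset_closure_stabRegion hF hv)
  intro w hw
  change 0 ≤ fderiv ℝ (truncCube Q ε) w (gradient W w)
  by_cases hwa : w = a
  · subst hwa
    rw [(hQ.truncCube_eventuallyEq hε).fderiv_eq]
    simp
  · have h1 := (hasDerivAt_max_zero_pow 1 (Q w - ε)).comp_hasFDerivAt w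
      (((hQ.contDiffAt hwa).differentiableAt two_ne_zero).hasFDerivAt.sub_const ε)
    have h2 : fderiv ℝ (truncCube Q ε) w = _ := h1.fderiv
    rw [h2, smul_apply, smul_eq_mul, ← inner_gradient_left]
    exact mul_nonneg (by positivity) (hQ.monotone w hw hwa)

lemma IsRegularMinimizer.mem_stabUnion (h : IsRegularMinimizer G F W R M u) (hF : IsOpen F)
    {y : Eucl n} (hy : y ∈ stabUnion G F a) (hyB : y ∈ Metric.ball (0 : Eucl n) R) :
    u y ∈ stabUnion G F a := by
  obtain ⟨k, hk, hka, hky⟩ := hy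
  refine ⟨k, hk, hka, ?_⟩
  rw [← h.apply_map (G.inv_mem hk) hyB]
  exact h.mem_closure hF hky (orth_mem_ball _ hyB)

/-- `(Q(u) - ε)₊³` is subharmonic in the symmetrized region. -/
lemma IsRegularMinimizer.laplacianAt_truncCube_nonneg (hG : IsFiniteReflectionGroup G)
    (hF : IsFundamentalRegion G F)
    (hW : ContDiff ℝ 2 W) (hW0 : ∀ v, 0 ≤ W v) (hWG : ∀ g ∈ G, ∀ v, W (g v) = W v)
    (h : IsRegularMinimizer G F W R M u) (hQ : IsQMonotone G F W a Q) (hε : 0 < ε)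
    {y : Eucl n} (hy : y ∈ stabUnion G F a) (hyB : y ∈ Metric.ball (0 : Eucl n) R) :
    0 ≤ laplacianAt (fun y => truncCube Q ε (u y)) y := by
  have hP := hQ.contDiff_truncCube hε
  rw [laplacianAt_comp hP (h.contDiffOn.contDiffAt (Metric.isOpen_ball.mem_nhds hyB)),
    h.laplacianAt_eq hG hF hW hW0 hWG hyB]
  exact add_nonneg (Finset.sum_nonneg fun i _ =>
      fderiv_fderiv_nonneg_of_convexOn hP hQ.convexOn_truncCube _ _)
    (hQ.fderiv_truncCube_nonneg hε hF.isOpen hW (h.mem_stabUnion hF.isOpen hy hyB))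

/-- On bounded parts of the symmetrized region the truncation of `Q` is controlled by `W`. -/
lemma IsQMonotone.exists_truncCube_le (hG : Finite G) (hQ : IsQMonotone G F W a Q)
    (hε : 0 < ε) (hW : Continuous W) (hW0 : ∀ v, 0 ≤ W v)
    (hzero : ∀ v ∈ stabUnion G F a, W v = 0 → v = a) (M : ℝ) :
    ∃ C : ℝ, 0 ≤ C ∧ ∀ v ∈ stabUnion G F a, ‖v‖ ≤ M → truncCube Q ε v ≤ C * W v := by
  -- On this compact set `W` has no zero, since its only candidate `a` has `Q a = 0 < ε`; off it,
  -- but within the bounded region, the truncation vanishes.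
  set K : Set (Eucl n) := stabUnion G F a ∩ Metric.closedBall 0 M ∩ {v | ε ≤ Q v} with hK
  have hKc : IsCompact K :=
    ((isCompact_closedBall (0 : Eucl n) M).inter_left (isClosed_stabUnion hG)).inter_right
      (isClosed_le continuous_const hQ.continuous)
  have hWK : ∀ v ∈ K, W v ≠ 0 := by
    intro v hv h0
    have hva := hzero v hv.1.1 h0
    have : ε ≤ Q v := hv.2
    rw [hva, hQ.apply_self] at this
    linarith
  obtain ⟨C, hC⟩ := hKc.exists_bound_of_continuousOn
    ((hQ.contDiff_truncCube hε).continuous.continuousOn.div hW.continuousOn hWK)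
  refine ⟨max C 0, le_max_right _ _, fun v hv hvM => ?_⟩
  by_cases hvQ : ε ≤ Q v
  · have hvK : v ∈ K := ⟨⟨hv, mem_closedBall_zero_iff.2 hvM⟩, hvQ⟩
    have hpos : 0 < W v := lt_of_le_of_ne (hW0 v) (hWK v hvK).symm
    have h1 : truncCube Q ε v / W v ≤ max C 0 :=
      (le_abs_self _).trans ((hC v hvK).trans (le_max_left _ _))
    exact (div_le_iff₀ hpos).1 h1
  · have h1 : truncCube Q ε v = 0 := by
      rw [truncCube, max_eq_right (by linarith)]; norm_num
    rw [h1]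
    exact mul_nonneg (le_max_right _ _) (hW0 v)

/-- A connected ball that avoids the frontier cannot leave `S`. With an empty frontier
`Metric.infDist` is 0, so the hypotheses exclude that case. -/
lemma ball_subset_of_le_infDist_frontier {S : Set (Eucl n)} (hS : IsOpen S) {x : Eucl n}
    (hx : x ∈ S) {d : ℝ} (hd0 : 0 < d) (hd : d ≤ Metric.infDist x (frontier S)) :
    Metric.ball x d ⊆ S := by
  have hdisj : Disjoint (Metric.ball x d) (frontier S) :=
    Metric.disjoint_ball_infDist.mono_left (Metric.ball_subset_ball hd)
  refine (convex_ball x d).isPreconnected.subset_left_of_subset_union hS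
    isClosed_closure.isOpen_compl (disjoint_compl_right.mono_left subset_closure) ?_
    ⟨x, Metric.mem_ball_self hd0, hx⟩
  intro y hy
  by_cases hyS : y ∈ closure S
  · left
    by_contra hcon
    refine Set.disjoint_left.1 hdisj hy ?_
    rw [hS.frontier_eq]
    exact ⟨hyS, hcon⟩
  · right; exact hyS

end Subharmonic

/-! ### Choice of the constants and conclusion -/

theorem lemma11 {n N : ℕ} (G : Subgroup (Orth n)) (hG : IsFiniteReflectionGroup G)
    (F : Set (Eucl n)) (hF : IsFundamentalRegion G F)
    (W : Eucl n → ℝ) (a : Fin N → Eucl n) (c q M : ℝ)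
    (hmin : HasNondegenerateMinima W a c q)
    (hsym : IsSymmetricPotential G W M)
    (i₁ : Fin N) (hloc : HasSingleMinimumIn F a i₁)
    (Q : Eucl n → ℝ) (hQ : IsQMonotone G F W (a i₁) Q) :
    ∃ R₀ : ℝ, 0 < R₀ ∧ ∃ d₀ : ℝ, 0 < d₀ ∧
      ∀ R : ℝ, R₀ ≤ R →
        ∀ u : Eucl n → Eucl n,
          IsEnergyMinimizer G F W (4 * R) u →
          ContDiffOn ℝ 2 u (Metric.ball 0 (4 * R)) →
          (∀ x ∈ Metric.ball (0 : Eucl n) (4 * R), ‖u x‖ ≤ M) →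
            ∃ Dstar : Set (Eucl n),
              Dstar ⊆ stabRegion G F (a i₁) ∩ Metric.ball 0 (4 * R) ∧
              {x | x ∈ stabRegion G F (a i₁) ∩ Metric.ball 0 (4 * R) ∧
                d₀ ≤ Metric.infDist x
                  (frontier (stabRegion G F (a i₁) ∩ Metric.ball 0 (4 * R)))} ⊆ Dstar ∧
              ∀ x ∈ Dstar, Q (u x) ≤ q := by
  have hWc : ContDiff ℝ 2 W := hmin.contDiff
  have hW0 : ∀ v, 0 ≤ W v := by
    intro v
    by_cases hv : v ∈ range a
    · obtain ⟨i, rfl⟩ := hv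
      exact (hmin.zero_at i).ge
    · exact (hmin.pos_off v hv).le
  have hWa : W (a i₁) = 0 := hmin.zero_at i₁
  have hzero : ∀ v ∈ stabUnion G F (a i₁), W v = 0 → v = a i₁ := by
    rintro v ⟨k, hk, hka, hkv⟩ hv
    have h1 : W (k⁻¹ v) = 0 := by rw [hsym.invariant _ (G.inv_mem hk), hv]
    have h2 : k⁻¹ v ∈ range a := by
      by_contra hcon
      exact (hmin.pos_off _ hcon).ne' h1
    obtain ⟨j, hj⟩ := h2
    have h3 : a j = a i₁ := hloc.2 j (by rw [hj]; exact hkv)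
    rw [← Orth.apply_inv_apply k v, ← hj, h3, hka]
  have hfinG : Finite G := hG.finite
  set ε : ℝ := q / 2 with hεdef
  have hε : 0 < ε := half_pos hmin.q_pos
  obtain ⟨C₁, hC₁, hen⟩ := exists_setIntegral_potential_le (M := M) hfinG hF hloc.1
    hWc.continuous hW0 hsym.invariant hWa
  obtain ⟨C₂, hC₂, htr⟩ := hQ.exists_truncCube_le hfinG hε hWc.continuous hW0 hzero M
  obtain ⟨c₀, hc₀, hmv⟩ := exists_mean_value_le n
  -- The final estimate bounds the truncation by `c₀ C₂ C₁ 2ⁿ / r`; this `r` makes that at most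
  -- `ε³`. The 2 gives `r ≤ 2(r - 1)`, used to compare `rⁿ` with `(r - 1)ⁿ`.
  set r : ℝ := max 2 (c₀ * (C₂ * C₁) * 2 ^ n / ε ^ 3) with hr
  have hr2 : 2 ≤ r := le_max_left _ _
  have hr0 : 0 < r := by linarith
  have hρ : 0 < r - 1 := by linarith
  -- Any positive `R₀` would do: for small `R` the set of points at distance `d₀` from the boundary
  -- may be empty. The extra 1 in `d₀ = r + 1` makes room for the closed ball of radius `r`.
  refine ⟨1, one_pos, r + 1, by linarith, ?_⟩
  intro R _ u humin hu2 huM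
  have hu : IsRegularMinimizer G F W (4 * R) M u := ⟨humin, hu2, huM⟩
  set S := stabRegion G F (a i₁) ∩ Metric.ball (0 : Eucl n) (4 * R) with hS
  have hSo : IsOpen S := isOpen_stabRegion.inter Metric.isOpen_ball
  refine ⟨{x | x ∈ S ∧ r + 1 ≤ Metric.infDist x (frontier S)}, fun x hx => hx.1, fun x hx => hx,
    ?_⟩
  rintro x ⟨hxS, hxd⟩
  have hballS : Metric.closedBall x r ⊆ S :=
    (Metric.closedBall_subset_ball (by linarith)).trans
      (ball_subset_of_le_infDist_frontier hSo hxS (by linarith) hxd)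
  have hball1 : Metric.ball x (r - 1) ⊆ S :=
    (Metric.ball_subset_closedBall.trans (Metric.closedBall_subset_closedBall (by linarith))).trans
      hballS
  have hE := hen (4 * R) u hu x r (by linarith) hballS
  have hP2 := hQ.contDiff_truncCube hε
  -- The mean value inequality asks for a globally `C²` function, while `u` is `C²` only in the
  -- ball; multiplying by `χ` changes nothing on `B_{r-1}(x)`.
  let χ : ContDiffBump x := ⟨r - 1, r, hρ, by linarith⟩
  have hχs : tsupport χ ⊆ Metric.ball (0 : Eucl n) (4 * R) := by
    rw [χ.tsupport_eq]
    exact fun y hy => (hballS hy).2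
  set g : Eucl n → ℝ := fun y => χ y • truncCube Q ε (u y) with hg
  have hg2 : ContDiff ℝ 2 g :=
    contDiff_smul_of_tsupport_subset Metric.isOpen_ball (hP2.comp_contDiffOn hu2) χ.contDiff hχs
  have hgeq : ∀ y ∈ Metric.ball x (r - 1), g y = truncCube Q ε (u y) := by
    intro y hy
    have : χ y = 1 := χ.one_of_mem_closedBall (Metric.ball_subset_closedBall hy)
    rw [hg]
    simp [this]
  have hlap : ∀ y ∈ Metric.ball x (r - 1), 0 ≤ laplacianAt g y := by
    intro y hy
    have h1 : g =ᶠ[nhds y] fun y => truncCube Q ε (u y) := by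
      filter_upwards [Metric.isOpen_ball.mem_nhds hy] with z hz using hgeq z hz
    rw [laplacianAt_congr h1]
    exact hu.laplacianAt_truncCube_nonneg hG hF hWc hW0 hsym.invariant hQ hε
      (stabRegion_subset_stabUnion (hball1 hy).1) (hball1 hy).2
  have hm := hmv g x (r - 1) hg2 hρ hlap fun y hy => by
    rw [hgeq y hy]; exact truncCube_nonneg _
  rw [hgeq x (Metric.mem_ball_self hρ)] at hm
  have hWint : IntegrableOn (fun y => W (u y)) (Metric.ball x (r - 1)) :=
    (integrableOn_comp_of_bounded hWc.continuous hu2.continuousOn huM).mono_set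
      fun y hy => (hball1 hy).2
  have hgint : IntegrableOn g (Metric.ball x (r - 1)) :=
    (hg2.continuous.continuousOn.integrableOn_compact
      (isCompact_closedBall x (r - 1))).mono_set Metric.ball_subset_closedBall
  have hgW : ∫ y in Metric.ball x (r - 1), g y ≤ C₂ * (C₁ * (r ^ n / r)) := by
    refine (setIntegral_mono_on hgint (hWint.const_mul C₂) measurableSet_ball
      fun y hy => ?_).trans ?_
    · rw [hgeq y hy]
      exact htr _ (hu.mem_stabUnion hF.isOpen (stabRegion_subset_stabUnion (hball1 hy).1)
        (hball1 hy).2) (huM y (hball1 hy).2)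
    · rw [integral_const_mul]
      exact mul_le_mul_of_nonneg_left hE hC₂
  have hpow : ((r - 1) ^ n)⁻¹ * r ^ n ≤ 2 ^ n := by
    rw [inv_mul_le_iff₀ (by positivity), ← mul_pow]
    exact pow_le_pow_left₀ hr0.le (by linarith) n
  have hfinal : truncCube Q ε (u x) ≤ ε ^ 3 := by
    calc truncCube Q ε (u x)
        ≤ c₀ * (((r - 1) ^ n)⁻¹ * ∫ y in Metric.ball x (r - 1), g y) := hm
      _ ≤ c₀ * (((r - 1) ^ n)⁻¹ * (C₂ * (C₁ * (r ^ n / r)))) := by gcongr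
      _ = c₀ * (C₂ * C₁) * (((r - 1) ^ n)⁻¹ * r ^ n) / r := by ring
      _ ≤ c₀ * (C₂ * C₁) * 2 ^ n / r := by gcongr
      _ ≤ ε ^ 3 := by
        rw [div_le_iff₀ hr0, ← div_le_iff₀' (by positivity)]
        exact le_max_right _ _
  have h3 : max (Q (u x) - ε) 0 ≤ ε := by
    by_contra hcon
    push Not at hcon
    have h5 : ε ^ 3 < truncCube Q ε (u x) := pow_lt_pow_left₀ hcon hε.le three_ne_zero
    linarith
  have h4 := (le_max_left (Q (u x) - ε) 0).trans h3
  linarith
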